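/- Let $G$ be a locally compact, second countable, Hausdorff abelian group and let $P\subseteq G$ be a closed subsemigroup with $0\in P$, $P-P=G$ and $P\subseteq\overline{\mathrm{Int}(P)}$. Let $a_0\in \mathrm{Int}(P)$ be an order unit, i.e. for every $s\in G$ there is an integer $n\ge 1$ with $na_0-s\in\mathrm{Int}(P)$. Let $c:G\to\mathbb{R}$ be a continuous homomorphism and $\beta\in\mathbb{R}$. Let $Y_u$ be the set of closed subsets $A\subseteq G$ with $-P+A\subseteq A$, $A\neq\emptyset$, $A\neq G$, with the Fell topology and the $G$-action $(A,s)\mapsto A+s$, and let $X_u=\{A\in Y_u: 0\in A\}$. A non-zero Radon measure $\mu$ on $Y_u$ is $e^{-\beta c}$-conformal if $\mu(E+s)=e^{-\beta c(s)}\mu(E)$ for all $s\in G$ and all Borel $E\subseteq Y_u$; it is ergodic if every $G$-invariant Borel subset of $Y_u$ is null or co-null. Let $\mathcal{M}_{e,\beta,a_0}(Y_u)$ be the set of non-zero, ergodic, $e^{-\beta c}$-conformal Radon measures $\mu$ on $Y_u$ with $\mu(X_u\setminus(X_u+a_0))=1$. An isometric representation $V=\{V_a\}_{a\in P}$ of $P$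 is a strongly continuous semigroup of isometries on a separable complex Hilbert space $H$. It has commuting range projections if the projections $V_aV_a^*$ $(a\in P)$ commute with each other; it is pure if $\bigcap_{a\in P}\mathrm{Ran}(V_a)=\{0\}$; it is irreducible if the commutant of $\{V_a,V_a^*:a\in P\}$ is $\mathbb{C}$. A pure $V$ is $e^{-\beta c/2}$-conformal if there is a non-zero linear functional $\phi$ on $\mathcal{D}_V=\bigcup_{a\in P}\mathrm{Ker}(V_a^*)$, bounded on $\mathrm{Ker}(V_a^*)$ for every $a\in P$, such that $\phi(V_a\xi)=e^{-\beta c(a)/2}\phi(\xi)$ for all $a\in P$ and $\xi\in\mathcal{D}_V$. Let $\mathcal{I}_{\beta,r}(P)$ be the set of unitary equivalence classes of irreducible, pure, $e^{-\beta c/2}$-conformal isometric representations of $P$ with commuting range projections. For a non-zero $e^{-\beta c}$-conformal Radon measure $\mu$ on $Y_u$, let $V^\mu=\{V^\mu_a\}_{a\in P}$ be the restricted Koopman representation on $L^2(X_u,\mu)$: $(V^\mu_af)(A)=e^{\beta c(a)/2}f(A-a)$ if $A-a\in X_u$, and $(V^\mu_af)(A)=0$ otherwise. Then $\mu\mapsto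 V^\mu$ (the unitary equivalence class of $V^\mu$) is a bijection from $\mathcal{M}_{e,\beta,a_0}(Y_u)$ onto $\mathcal{I}_{\beta,r}(P)$. -/

import Mathlib

open MeasureTheory Set TopologicalSpace
open scoped ENNReal Pointwise

universe u

noncomputable section

namespace SemigroupRep

/-! ### The Fell topology and the universal dynamical system `Y_u` -/

/-- The Fell topology on the closed subsets of `X`: it is generated by the "hit" sets
`{A | A ∩ U ≠ ∅}`, `U` open, and the "miss" sets `{A | A ∩ K = ∅}`, `K` compact. -/
@[reducible] def fellTopology (X : Type u) [TopologicalSpace X] : TopologicalSpace (Closeds X) :=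
  generateFrom
    ({S | ∃ U : Set X, IsOpen U ∧ S = {A : Closeds X | ((A : Set X) ∩ U).Nonempty}} ∪
     {S | ∃ K : Set X, IsCompact K ∧ S = {A : Closeds X | (A : Set X) ∩ K = ∅}})

section Space

variable {G : Type u} [AddCommGroup G] [TopologicalSpace G]

/-- `Y_u`: the closed sets `A ⊆ G` with `-P + A ⊆ A`, `A ≠ ∅` and `A ≠ G`. -/
@[ext]
structure Yu (P : AddSubmonoid G) where
  /-- the underlying closed subset of `G` -/
  carrier : Closeds G
  neg_add_mem : ∀ p ∈ P, ∀ x ∈ carrier, -p + x ∈ carrier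
  nonempty : (carrier : Set G).Nonempty
  ne_univ : (carrier : Set G) ≠ univ

variable {P : AddSubmonoid G}

/-- `Y_u` carries the subspace topology of the Fell topology. -/
instance : TopologicalSpace (Yu P) := (fellTopology G).induced Yu.carrier

instance : MeasurableSpace (Yu P) := borel (Yu P)

instance : BorelSpace (Yu P) := ⟨rfl⟩

variable (P) in
/-- `X_u = {A ∈ Y_u | 0 ∈ A}`. -/
def Xu : Set (Yu P) := {A | (0 : G) ∈ A.carrier}

theorem isOpen_hit {U : Set G} (hU : IsOpen U) :
    IsOpen {A : Yu P | ((A.carrier : Set G) ∩ U).Nonempty} :=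
  @isOpen_induced _ _ (fellTopology G) Yu.carrier _
    (isOpen_generateFrom_of_mem (Or.inl ⟨U, hU, rfl⟩))

theorem isOpen_miss {K : Set G} (hK : IsCompact K) :
    IsOpen {A : Yu P | (A.carrier : Set G) ∩ K = ∅} :=
  @isOpen_induced _ _ (fellTopology G) Yu.carrier _
    (isOpen_generateFrom_of_mem (Or.inr ⟨K, hK, rfl⟩))

theorem measurableSet_Xu : MeasurableSet (Xu P) := by
  have h : IsOpen (Xu P)ᶜ := by
    convert isOpen_miss (P := P) (isCompact_singleton (x := (0 : G))) using 1
    ext A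
    change (0 : G) ∉ A.carrier ↔ (A.carrier : Set G) ∩ {0} = ∅
    rw [inter_singleton_eq_empty]; rfl
  exact (isOpen_compl_iff.1 h).measurableSet

variable [IsTopologicalAddGroup G]

/-- The action of `G` on `Y_u` by translation: `s +ᵥ A = A + s`. -/
instance : VAdd G (Yu P) where
  vadd s A :=
    { carrier := ⟨{x | x - s ∈ A.carrier},
        A.carrier.isClosed.preimage (continuous_id.sub continuous_const)⟩
      neg_add_mem := fun p hp x hx => by
        have h := A.neg_add_mem p hp (x - s) hx
        change -p + x - s ∈ A.carrier
        rwa [add_sub_assoc]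
      nonempty := by
        obtain ⟨x, hx⟩ := A.nonempty
        exact ⟨x + s, by change x + s - s ∈ A.carrier; simpa using hx⟩
      ne_univ := fun h => A.ne_univ <| by
        ext x
        have hx : x + s ∈ {x | x - s ∈ A.carrier} := by
          change {x | x - s ∈ A.carrier} = univ at h
          rw [h]; trivial
        simpa using hx }

theorem mem_vadd_carrier {s x : G} {A : Yu P} : x ∈ (s +ᵥ A).carrier ↔ x - s ∈ A.carrier :=
  Iff.rfl

instance : AddAction G (Yu P) where
  zero_vadd A := by
    ext x; change x - 0 ∈ A.carrier ↔ x ∈ A.carrier; rw [sub_zero]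
  add_vadd s t A := by
    ext x; change x - (s + t) ∈ A.carrier ↔ x - s - t ∈ A.carrier; rw [sub_sub]

theorem continuous_vadd (s : G) : Continuous fun A : Yu P => s +ᵥ A := by
  refine continuous_induced_rng.2 (continuous_generateFrom_iff.2 ?_)
  rintro S (⟨U, hU, rfl⟩ | ⟨K, hK, rfl⟩)
  · have h : IsOpen {A : Yu P | ((A.carrier : Set G) ∩ (fun x => x + s) ⁻¹' U).Nonempty} :=
      isOpen_hit (hU.preimage (continuous_add_const s))
    convert h using 1
    ext A
    constructor
    · rintro ⟨x, hx, hxU⟩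
      exact ⟨x - s, hx, by simpa using hxU⟩
    · rintro ⟨x, hx, hxU⟩
      exact ⟨x + s, by change x + s - s ∈ A.carrier; simpa using hx, hxU⟩
  · have h : IsOpen {A : Yu P | (A.carrier : Set G) ∩ (fun x => x - s) '' K = ∅} :=
      isOpen_miss (hK.image (continuous_id.sub continuous_const))
    convert h using 1
    ext A
    constructor
    · intro h
      refine eq_empty_iff_forall_notMem.2 ?_
      rintro _ ⟨hx, x, hxK, rfl⟩
      exact eq_empty_iff_forall_notMem.1 h x ⟨hx, hxK⟩
    · intro h
      refine eq_empty_iff_forall_notMem.2 ?_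
      rintro x ⟨hx, hxK⟩
      exact eq_empty_iff_forall_notMem.1 h (x - s) ⟨hx, x, hxK, rfl⟩

theorem measurable_vadd (s : G) : Measurable fun A : Yu P => s +ᵥ A :=
  (continuous_vadd s).measurable

theorem vadd_Xu_subset {a : G} (ha : a ∈ P) : a +ᵥ Xu P ⊆ Xu P := by
  rintro _ ⟨A, hA, rfl⟩
  change (0 : G) - a ∈ A.carrier
  simpa [sub_eq_add_neg, add_comm] using A.neg_add_mem a ha 0 hA

theorem measurableSet_vadd (s : G) {E : Set (Yu P)} (hE : MeasurableSet E) :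
    MeasurableSet (s +ᵥ E) := by
  rw [← preimage_vadd_neg]; exact measurable_vadd (-s) hE

/-! ### Conformal, Radon and ergodic measures on `Y_u` -/

/-- `μ` is `e^{-βc}`-conformal: `μ (E + s) = e^{-β c(s)} μ (E)` for all `s ∈ G` and all Borel
sets `E ⊆ Y_u`. -/
def IsConformalMeasure (c : G →+ ℝ) (β : ℝ) (μ : Measure (Yu P)) : Prop :=
  ∀ (s : G) (E : Set (Yu P)), MeasurableSet E →
    μ (s +ᵥ E) = ENNReal.ofReal (Real.exp (-(β * c s))) * μ E

variable (P) in
/-- The set `M_β(Y_u)` of non-zero `e^{-βc}`-conformal Radon measures on `Y_u`. Since `Y_u` is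
locally compact, second countable and Hausdorff, a Radon measure on it is the same as a Borel
measure that is finite on compact sets. -/
def ConformalRadonMeasure (c : G →+ ℝ) (β : ℝ) : Type u :=
  {μ : Measure (Yu P) // μ ≠ 0 ∧ IsFiniteMeasureOnCompacts μ ∧ IsConformalMeasure c β μ}

/-- `μ` is ergodic for the `G`-action: every `G`-invariant Borel set is null or co-null. (Mathlib's
`ErgodicVAdd` is not applicable, because it requires an invariant measure.) -/
def IsErgodicMeasure (μ : Measure (Yu P)) : Prop :=
  ∀ E : Set (Yu P), MeasurableSet E → (∀ s : G, s +ᵥ E = E) → μ E = 0 ∨ μ Eᶜ = 0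

/-- The set `M_{e,β,a₀}(Y_u)` of ergodic measures in `M_β(Y_u)` with
`μ (X_u ∖ (X_u + a₀)) = 1`. -/
def normalizedErgodic (c : G →+ ℝ) (β : ℝ) (a₀ : G) : Set (ConformalRadonMeasure P c β) :=
  {μ | IsErgodicMeasure μ.1 ∧ μ.1 (Xu P \ (a₀ +ᵥ Xu P)) = 1}

end Space

/-! ### Semigroups of isometries -/

/-- A semigroup `{V_a}_{a ∈ P}` of isometries on a complex Hilbert space `H`. -/
structure IsometrySemigroup {G : Type u} [AddCommGroup G] (P : AddSubmonoid G) where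
  /-- the Hilbert space -/
  H : Type u
  [normed : NormedAddCommGroup H]
  [inner : InnerProductSpace ℂ H]
  [complete : CompleteSpace H]
  /-- the isometries -/
  V : P → H →ₗᵢ[ℂ] H
  V_zero : V 0 = LinearIsometry.id
  V_add : ∀ a b, V (a + b) = (V a).comp (V b)

attribute [instance] IsometrySemigroup.normed IsometrySemigroup.inner IsometrySemigroup.complete

namespace IsometrySemigroup

variable {G : Type u} [AddCommGroup G] {P : AddSubmonoid G} (V : IsometrySemigroup P)

/-- `V_a` as a bounded operator. -/
def op (a : P) : V.H →L[ℂ] V.H := (V.V a).toContinuousLinearMap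

/-- The adjoint `V_a^*`. -/
def opAdj (a : P) : V.H →L[ℂ] V.H := ContinuousLinearMap.adjoint (V.op a)

/-- Strong continuity of `a ↦ V_a`. -/
def IsStronglyContinuous [TopologicalSpace G] : Prop := ∀ ξ : V.H, Continuous fun a : P => V.op a ξ

/-- `V` is pure: `⋂_{a ∈ P} Ran V_a = {0}`. -/
def IsPure : Prop := (⋂ a : P, range (V.op a)) = {0}

/-- The range projections `E_a = V_a V_a^*` commute. -/
def HasCommutingRangeProjections : Prop :=
  ∀ a b : P, Commute (V.op a * V.opAdj a) (V.op b * V.opAdj b)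

/-- `V` is irreducible: the commutant of `{V_a, V_a^* : a ∈ P}` consists of the scalars. -/
def IsIrreducible : Prop :=
  ∀ T : V.H →L[ℂ] V.H, (∀ a : P, Commute T (V.op a) ∧ Commute T (V.opAdj a)) →
    ∃ z : ℂ, T = z • (1 : V.H →L[ℂ] V.H)

theorem op_add (a b : P) : V.op (a + b) = V.op a * V.op b := by
  ext ξ; simp [op, V.V_add]

theorem opAdj_add (a b : P) : V.opAdj (a + b) = V.opAdj b * V.opAdj a := by
  rw [opAdj, op_add]; exact ContinuousLinearMap.adjoint_comp _ _

theorem opAdj_op (a : P) (ξ : V.H) : V.opAdj a (V.op a ξ) = ξ := by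
  refine ext_inner_left ℂ fun η => ?_
  rw [opAdj, ContinuousLinearMap.adjoint_inner_right]
  exact (V.V a).inner_map_map η ξ

/-- The subspace `D_V = ⋃_{a ∈ P} Ker V_a^*`. -/
def domain : Submodule ℂ V.H where
  carrier := ⋃ a : P, {ξ | V.opAdj a ξ = 0}
  zero_mem' := mem_iUnion.2 ⟨0, map_zero _⟩
  add_mem' := by
    intro ξ η hξ hη
    obtain ⟨a, ha⟩ := mem_iUnion.1 hξ
    obtain ⟨b, hb⟩ := mem_iUnion.1 hη
    refine mem_iUnion.2 ⟨a + b, ?_⟩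
    have h1 : V.opAdj (a + b) ξ = 0 := by
      rw [opAdj_add, mul_apply_eq_comp, show V.opAdj a ξ = 0 from ha, map_zero]
    have h2 : V.opAdj (a + b) η = 0 := by
      rw [add_comm, opAdj_add, mul_apply_eq_comp, show V.opAdj b η = 0 from hb,
        map_zero]
    change V.opAdj (a + b) (ξ + η) = 0
    rw [map_add, h1, h2, add_zero]
  smul_mem' := by
    intro z ξ hξ
    obtain ⟨a, ha⟩ := mem_iUnion.1 hξ
    refine mem_iUnion.2 ⟨a, ?_⟩
    change V.opAdj a (z • ξ) = 0
    rw [map_smul, show V.opAdj a ξ = 0 from ha, smul_zero]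

theorem op_mem_domain (a : P) {ξ : V.H} (hξ : ξ ∈ V.domain) : V.op a ξ ∈ V.domain := by
  obtain ⟨b, hb⟩ := mem_iUnion.1 hξ
  refine mem_iUnion.2 ⟨a + b, ?_⟩
  change V.opAdj (a + b) (V.op a ξ) = 0
  rw [opAdj_add, mul_apply_eq_comp, opAdj_op]; exact hb

/-- Membership in `L_V`: the linear functional `φ` on `D_V` is bounded on each `Ker V_a^*`. -/
def IsLocallyBounded (φ : V.domain →ₗ[ℂ] ℂ) : Prop :=
  ∀ a : P, ∃ C : ℝ, ∀ ξ : V.domain, V.opAdj a ξ = 0 → ‖φ ξ‖ ≤ C * ‖(ξ : V.H)‖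

/-- `T_a φ (ξ) = φ (V_a ξ)`. -/
def translate (a : P) (φ : V.domain →ₗ[ℂ] ℂ) : V.domain →ₗ[ℂ] ℂ :=
  φ ∘ₗ (V.op a).toLinearMap.restrict fun _ hξ => V.op_mem_domain a hξ

/-- `V` is `e^{-βc/2}`-conformal: there is a non-zero `φ ∈ L_V` with
`T_a φ = e^{-β c(a)/2} φ` for all `a ∈ P`. -/
def IsConformal (c : G →+ ℝ) (β : ℝ) : Prop :=
  ∃ φ : V.domain →ₗ[ℂ] ℂ, φ ≠ 0 ∧ V.IsLocallyBounded φ ∧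
    ∀ a : P, V.translate a φ = (Real.exp (-(β * c a / 2)) : ℂ) • φ

variable (P) in
/-- Unitary equivalence of semigroups of isometries. -/
def unitaryEquiv : Setoid (IsometrySemigroup P) where
  r V W := ∃ U : V.H ≃ₗᵢ[ℂ] W.H, ∀ (a : P) (ξ : V.H), U (V.op a ξ) = W.op a (U ξ)
  iseqv :=
    { refl := fun V => ⟨LinearIsometryEquiv.refl ℂ V.H, fun _ _ => rfl⟩
      symm := by
        rintro V W ⟨U, hU⟩
        refine ⟨U.symm, fun a ξ => ?_⟩
        rw [LinearIsometryEquiv.symm_apply_eq, hU, LinearIsometryEquiv.apply_symm_apply]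
      trans := by
        rintro V W Z ⟨U, hU⟩ ⟨U', hU'⟩
        refine ⟨U.trans U', fun a ξ => ?_⟩
        simp [hU, hU'] }

variable (P) in
/-- The set `I_{β,r}(P)` of unitary equivalence classes of irreducible, pure,
`e^{-βc/2}`-conformal isometric representations (strongly continuous semigroups of isometries
on separable Hilbert spaces) of `P` with commuting range projections. -/
def irreducibleConformalClasses [TopologicalSpace G] (c : G →+ ℝ) (β : ℝ) :
    Set (Quotient (unitaryEquiv P)) :=
  Quotient.mk (unitaryEquiv P) ''
    {V | SeparableSpace V.H ∧ V.IsStronglyContinuous ∧ V.IsPure ∧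
      V.HasCommutingRangeProjections ∧ V.IsIrreducible ∧ V.IsConformal c β}

end IsometrySemigroup

/-! ### The restricted Koopman representation -/

section Koopman

variable {G : Type u} [AddCommGroup G] [TopologicalSpace G] [IsTopologicalAddGroup G]
  {P : AddSubmonoid G} {c : G →+ ℝ} {β : ℝ} {μ : Measure (Yu P)}

/-- `(V_a f)(A) = e^{β c(a)/2} f (A - a)` if `A - a ∈ X_u`, i.e. `A ∈ X_u + a`, and `0` otherwise.
This is the Koopman operator `U_a f (A) = e^{β c(a)/2} f (A - a)` of `L²(Y_u, μ)`, applied to the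
extension of `f : X_u → ℂ` by zero. -/
def koopmanFun (c : G →+ ℝ) (β : ℝ) (a : G) (f : Yu P → ℂ) : Yu P → ℂ :=
  (a +ᵥ Xu P).indicator fun A => (Real.exp (β * c a / 2) : ℂ) * f (-a +ᵥ A)

theorem map_restrict (hμ : IsConformalMeasure c β μ) {a : G} (ha : a ∈ P) :
    ((μ.restrict (Xu P)).restrict (a +ᵥ Xu P)).map (fun A => -a +ᵥ A) =
      ENNReal.ofReal (Real.exp (-(β * c a))) • μ.restrict (Xu P) := by
  ext E hE
  rw [Measure.map_apply (measurable_vadd (-a)) hE, preimage_vadd_neg,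
    Measure.restrict_apply (measurableSet_vadd a hE),
    Measure.restrict_apply ((measurableSet_vadd a hE).inter (measurableSet_vadd a measurableSet_Xu)),
    inter_assoc, inter_eq_left.2 (vadd_Xu_subset ha), ← vadd_set_inter,
    hμ a _ (hE.inter measurableSet_Xu), Measure.smul_apply, Measure.restrict_apply hE, smul_eq_mul]

theorem quasiMeasurePreserving (hμ : IsConformalMeasure c β μ) {a : G} (ha : a ∈ P) :
    Measure.QuasiMeasurePreserving (fun A : Yu P => -a +ᵥ A)
      ((μ.restrict (Xu P)).restrict (a +ᵥ Xu P)) (μ.restrict (Xu P)) :=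
  ⟨measurable_vadd (-a), by
    rw [map_restrict hμ ha]; exact Measure.smul_absolutelyContinuous⟩

theorem koopmanFun_congr (hμ : IsConformalMeasure c β μ) {a : G} (ha : a ∈ P) {f g : Yu P → ℂ}
    (h : f =ᵐ[μ.restrict (Xu P)] g) :
    koopmanFun c β a f =ᵐ[μ.restrict (Xu P)] koopmanFun c β a g := by
  have h1 := (quasiMeasurePreserving hμ ha).ae_eq_comp h
  rw [Filter.EventuallyEq, ae_restrict_iff' (measurableSet_vadd a measurableSet_Xu)] at h1
  filter_upwards [h1] with A hA
  by_cases hAX : A ∈ a +ᵥ Xu P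
  · have := hA hAX
    simp only [Function.comp_apply] at this
    simp [koopmanFun, hAX, this]
  · simp [koopmanFun, hAX]

theorem aestronglyMeasurable_koopmanFun (hμ : IsConformalMeasure c β μ) {a : G} (ha : a ∈ P)
    {f : Yu P → ℂ} (hf : AEStronglyMeasurable f (μ.restrict (Xu P))) :
    AEStronglyMeasurable (koopmanFun c β a f) (μ.restrict (Xu P)) := by
  refine (aestronglyMeasurable_indicator_iff (measurableSet_vadd a measurableSet_Xu)).2 ?_
  exact (hf.comp_quasiMeasurePreserving (quasiMeasurePreserving hμ ha)).const_mul _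

theorem eLpNorm_koopmanFun (hμ : IsConformalMeasure c β μ) {a : G} (ha : a ∈ P)
    {f : Yu P → ℂ} (hf : AEStronglyMeasurable f (μ.restrict (Xu P))) :
    eLpNorm (koopmanFun c β a f) 2 (μ.restrict (Xu P)) = eLpNorm f 2 (μ.restrict (Xu P)) := by
  have hm := map_restrict hμ ha
  have hf' : AEStronglyMeasurable f
      (((μ.restrict (Xu P)).restrict (a +ᵥ Xu P)).map (fun A => -a +ᵥ A)) := by
    rw [hm]; exact hf.smul_measure _
  rw [koopmanFun, eLpNorm_indicator_eq_eLpNorm_restrict (measurableSet_vadd a measurableSet_Xu)]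
  change eLpNorm ((Real.exp (β * c a / 2) : ℂ) • (f ∘ fun A => -a +ᵥ A)) 2 _ = _
  rw [eLpNorm_const_smul, ← eLpNorm_map_measure hf' (measurable_vadd (-a)).aemeasurable, hm,
    eLpNorm_smul_measure_of_ne_top (by norm_num), smul_eq_mul, ← mul_assoc]
  have h1 : ‖(Real.exp (β * c a / 2) : ℂ)‖ₑ = ENNReal.ofReal (Real.exp (β * c a / 2)) := by
    rw [← ofReal_norm, Complex.norm_real, Real.norm_of_nonneg (Real.exp_pos _).le]
  rw [h1, ENNReal.ofReal_rpow_of_pos (Real.exp_pos _),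
    ← ENNReal.ofReal_mul (Real.exp_pos _).le, ← Real.exp_mul, ← Real.exp_add]
  have h2 : β * c a / 2 + -(β * c a) * (1 / 2 : ℝ≥0∞).toReal = 0 := by
    simp; ring
  rw [h2]; simp

theorem memLp_koopmanFun (hμ : IsConformalMeasure c β μ) {a : G} (ha : a ∈ P)
    {f : Yu P → ℂ} (hf : MemLp f 2 (μ.restrict (Xu P))) :
    MemLp (koopmanFun c β a f) 2 (μ.restrict (Xu P)) :=
  ⟨aestronglyMeasurable_koopmanFun hμ ha hf.1, by
    rw [eLpNorm_koopmanFun hμ ha hf.1]; exact hf.2⟩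

/-- The isometry `V_a` on `L²(X_u, μ)`. -/
def koopmanIsometry (hμ : IsConformalMeasure c β μ) (a : P) :
    Lp ℂ 2 (μ.restrict (Xu P)) →ₗᵢ[ℂ] Lp ℂ 2 (μ.restrict (Xu P)) where
  toFun f := (memLp_koopmanFun hμ a.2 (Lp.memLp f)).toLp (koopmanFun c β a f)
  map_add' f g := by
    rw [← MemLp.toLp_add, MemLp.toLp_eq_toLp_iff]
    refine (koopmanFun_congr hμ a.2 (Lp.coeFn_add f g)).trans (Filter.Eventually.of_forall ?_)
    intro A
    by_cases hA : A ∈ (a : G) +ᵥ Xu P <;> simp [koopmanFun, hA, mul_add]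
  map_smul' z f := by
    rw [RingHom.id_apply, ← MemLp.toLp_const_smul, MemLp.toLp_eq_toLp_iff]
    refine (koopmanFun_congr hμ a.2 (Lp.coeFn_smul z f)).trans (Filter.Eventually.of_forall ?_)
    intro A
    by_cases hA : A ∈ (a : G) +ᵥ Xu P <;> simp [koopmanFun, hA, mul_left_comm]
  norm_map' f := by
    change ‖(memLp_koopmanFun hμ a.2 (Lp.memLp f)).toLp (koopmanFun c β a f)‖ = ‖f‖
    rw [Lp.norm_toLp, eLpNorm_koopmanFun hμ a.2 (Lp.memLp f).1, Lp.norm_def]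

theorem coeFn_koopmanIsometry (hμ : IsConformalMeasure c β μ) (a : P)
    (f : Lp ℂ 2 (μ.restrict (Xu P))) :
    koopmanIsometry hμ a f =ᵐ[μ.restrict (Xu P)] koopmanFun c β a f :=
  (memLp_koopmanFun hμ a.2 (Lp.memLp f)).coeFn_toLp

/-- The restricted Koopman representation `V^μ` of `P` on `L²(X_u, μ)`. -/
def koopmanRep (μ : ConformalRadonMeasure P c β) : IsometrySemigroup P where
  H := Lp ℂ 2 (μ.1.restrict (Xu P))
  V a := koopmanIsometry μ.2.2.2 a
  V_zero := by
    ext1 f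
    refine Lp.ext ((coeFn_koopmanIsometry μ.2.2.2 0 f).trans ?_)
    filter_upwards [ae_restrict_mem measurableSet_Xu] with A hA
    simp [koopmanFun, hA]
  V_add a b := by
    ext1 f
    refine Lp.ext ((coeFn_koopmanIsometry μ.2.2.2 (a + b) f).trans ?_)
    refine Filter.EventuallyEq.trans ?_ (((coeFn_koopmanIsometry μ.2.2.2 a _).trans
      (koopmanFun_congr μ.2.2.2 a.2 (coeFn_koopmanIsometry μ.2.2.2 b f))).symm)
    refine Filter.Eventually.of_forall fun A => ?_
    by_cases hA : A ∈ (a : G) +ᵥ Xu P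
    · have hiff : A ∈ ((a + b : P) : G) +ᵥ Xu P ↔ -(a : G) +ᵥ A ∈ (b : G) +ᵥ Xu P := by
        rw [AddSubmonoid.coe_add, add_vadd, mem_vadd_set_iff_neg_vadd_mem]
      by_cases hAb : -(a : G) +ᵥ A ∈ (b : G) +ᵥ Xu P
      · have hab := hiff.2 hAb
        have e1 : -((a + b : P) : G) +ᵥ A = -(b : G) +ᵥ (-(a : G) +ᵥ A) := by
          rw [vadd_vadd]; congr 1; push_cast; abel
        rw [koopmanFun, koopmanFun, indicator_of_mem hab, indicator_of_mem hA, koopmanFun,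
          indicator_of_mem hAb, e1, ← mul_assoc]
        congr 1
        rw [← Complex.ofReal_mul, ← Real.exp_add]
        congr 2
        push_cast
        rw [map_add]; ring
      · have hab := fun h => hAb (hiff.1 h)
        rw [koopmanFun, koopmanFun, indicator_of_notMem hab, indicator_of_mem hA, koopmanFun,
          indicator_of_notMem hAb, mul_zero]
    · have hab : A ∉ ((a + b : P) : G) +ᵥ Xu P := by
        intro h
        rw [AddSubmonoid.coe_add, add_vadd] at h
        exact hA (vadd_set_mono (vadd_Xu_subset b.2) h)
      rw [koopmanFun, koopmanFun, indicator_of_notMem hab, indicator_of_notMem hA]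

end Koopman

end SemigroupRep

end

/-!
The theorem rests on a dictionary between `L²(X_u, μ)` and an abstract representation `V`. For the
Koopman representation the range projection of `V_a` is multiplication by the indicator function of
`{A | a ∈ A}`, and `V_b^* V_a V_a^* V_b` is multiplication by that of `{A | a - b ∈ A}`. The sets
`{A | g ∈ A}`, `g ∈ G`, generate the Borel σ-algebra of `Y_u` (`measurableSpace_eq_generateFrom`),
so the algebra generated by `V` and its adjoints sees every Borel set.

*The Koopman representations belong to the target set.* Purity and commutation of the range
projections are immediate, and integration over `X_u` is a conformal functional, because the sets
`{A | 0 ∈ A, a ∉ A}` have finite measure. Strong continuity is checked on indicator functions of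
cylinder sets; it follows from the fact that, for fixed `g`, almost no `A` has `g` in its frontier
(`measure_boundary`). An operator commuting with `V` and its adjoints commutes with multiplication
by every Borel indicator function, hence is itself a multiplication operator; its symbol is invariant
almost everywhere under each translation, and ergodicity makes it constant
(`exists_ae_eq_const_of_invariant`, `koopmanRep_isIrreducible`).

*Injectivity.* A unitary between two Koopman representations matches the multiplications by Borel
indicator functions, so the two measures are equivalent on `X_u`. Their Radon–Nikodym derivative is
invariant, hence constant, and the normalization makes it `1` (`koopmanRep_injOn`).

*Surjectivity.* Let `V` be in the target set, with conformal functional `φ`. The operators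
`V_b^* V_a V_a^* V_b` are commuting projections `V.proj g` depending only on `g = a - b`, and they
decrease as `g` increases. Let `η_a ∈ Ker V_a^*` be the Riesz vector of the restriction of `φ` to
`Ker V_a^*` (`ConformalFamily`). The joint spectral measure of the projections at `η_a`, obtained
from the Gelfand transform and the Riesz–Markov–Kakutani theorem, lives on subsets of `G`; strong
continuity makes it a measure on closed sets, i.e. on `Y_u` (`exists_measure_cyl`). Conformality of
`φ` says precisely that suitable translates of these measures agree on an exhausting sequence of
slabs, so that they glue to a conformal Radon measure `μ` (`exists_measure_slab`,
`isConformalMeasure_of_slab`). Under the correspondence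
`1_{A ⊇ L, a ∉ A} ↦ V.projList L η_a` the Gram matrices agree, and both families are total, the
second one by irreducibility. The resulting unitary intertwines `V^μ` and `V`
(`exists_koopmanRep_equiv`). Finally `μ` is ergodic, because multiplication by the indicator
function of an invariant set commutes with `V^μ` (`isErgodicMeasure_of_isIrreducible`).
-/

noncomputable section

set_option linter.unusedSectionVars false

namespace SemigroupRep

/-! ### Order structure of the sets in `Y_u` -/

section Order

variable {G : Type u} [AddCommGroup G] [TopologicalSpace G] {P : AddSubmonoid G}

theorem Yu.sub_mem (A : Yu P) {x p : G} (hx : x ∈ A.carrier) (hp : p ∈ P) :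
    x - p ∈ A.carrier := by
  have := A.neg_add_mem p hp x hx
  rwa [neg_add_eq_sub] at this

theorem Yu.mem_of_sub_mem (A : Yu P) {x y : G} (hx : x ∈ A.carrier) (h : x - y ∈ P) :
    y ∈ A.carrier := by
  simpa using A.sub_mem hx h

/-- The set of all `A ∈ Y_u` containing every entry of the list `L`. -/
def cyl (P : AddSubmonoid G) (L : List G) : Set (Yu P) := {A | ∀ g ∈ L, g ∈ A.carrier}

theorem mem_cyl {L : List G} {A : Yu P} : A ∈ cyl P L ↔ ∀ g ∈ L, g ∈ A.carrier := Iff.rfl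

theorem mem_cyl_singleton {g : G} {A : Yu P} : A ∈ cyl P [g] ↔ g ∈ A.carrier := by
  simp [cyl]

theorem mem_cyl_cons {g : G} {L : List G} {A : Yu P} :
    A ∈ cyl P (g :: L) ↔ g ∈ A.carrier ∧ A ∈ cyl P L := by
  simp [cyl]

theorem cyl_nil : cyl P [] = univ := by
  ext; simp [cyl]

theorem cyl_append (L M : List G) : cyl P (L ++ M) = cyl P L ∩ cyl P M := by
  ext A
  simp only [cyl, List.mem_append, mem_ofPred_eq, mem_inter_iff]
  exact ⟨fun h => ⟨fun g hg => h g (Or.inl hg), fun g hg => h g (Or.inr hg)⟩,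
    fun h g hg => hg.elim (h.1 g) (h.2 g)⟩

theorem cyl_cons (g : G) (L : List G) : cyl P (g :: L) = cyl P [g] ∩ cyl P L := by
  rw [← cyl_append]; rfl

theorem isClosed_cyl_singleton (g : G) : IsClosed (cyl P [g]) := by
  rw [← isOpen_compl_iff]
  convert isOpen_miss (P := P) (isCompact_singleton (x := g)) using 1
  ext A
  rw [mem_compl_iff, mem_cyl_singleton]
  change g ∉ A.carrier ↔ (A.carrier : Set G) ∩ {g} = ∅
  rw [inter_singleton_eq_empty]; rfl

theorem measurableSet_cyl (L : List G) : MeasurableSet (cyl P L) := by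
  induction L with
  | nil => rw [cyl_nil]; exact MeasurableSet.univ
  | cons g L ih =>
    rw [cyl_cons]
    exact (isClosed_cyl_singleton g).measurableSet.inter ih

theorem Xu_eq_cyl : Xu P = cyl P [0] := by
  ext A; rw [mem_cyl_singleton]; rfl

variable [IsTopologicalAddGroup G]

theorem vadd_cyl (s : G) (L : List G) : s +ᵥ cyl P L = cyl P (L.map (s + ·)) := by
  ext A
  rw [mem_vadd_set_iff_neg_vadd_mem, mem_cyl, mem_cyl]
  simp only [mem_vadd_carrier, List.mem_map, forall_exists_index, and_imp,
    forall_apply_eq_imp_iff₂, sub_neg_eq_add, add_comm]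

theorem mem_vadd_Xu {a : G} {A : Yu P} : A ∈ a +ᵥ Xu P ↔ a ∈ A.carrier := by
  rw [Xu_eq_cyl, vadd_cyl]
  simp [cyl]

theorem interior_add_mem {p q : G} (hp : p ∈ interior (P : Set G)) (hq : q ∈ P) :
    p + q ∈ interior (P : Set G) := by
  refine mem_interior.2 ⟨(fun x => x - q) ⁻¹' interior (P : Set G), ?_,
    isOpen_interior.preimage (by fun_prop), by simpa using hp⟩
  intro x hx
  simpa using P.add_mem (interior_subset hx) hq

theorem Yu.sub_mem_interior (A : Yu P) {x p : G} (hx : x ∈ A.carrier)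
    (hp : p ∈ interior (P : Set G)) : x - p ∈ interior (A.carrier : Set G) := by
  refine mem_interior.2 ⟨(fun y => x - y) ⁻¹' interior (P : Set G), ?_,
    isOpen_interior.preimage (by fun_prop), by simpa using hp⟩
  intro y hy
  exact A.mem_of_sub_mem hx (interior_subset hy)

theorem mem_closure_sub_interior (hP : (P : Set G) ⊆ closure (interior (P : Set G))) (x : G)
    {U : Set G} (hU : IsOpen U) (hx : x ∈ U) : ∃ p ∈ interior (P : Set G), x - p ∈ U := by
  have h0 : (0 : G) ∈ closure (interior (P : Set G)) := hP P.zero_mem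
  obtain ⟨p, hpU, hp⟩ := mem_closure_iff.1 h0 ((fun y => x - y) ⁻¹' U)
    (hU.preimage (by fun_prop)) (by simpa using hx)
  exact ⟨p, hp, hpU⟩

/-- A dense subset meets every neighbourhood of `x` in a point strictly below `x`. -/
theorem exists_dense_below (hP : (P : Set G) ⊆ closure (interior (P : Set G))) {D : Set G}
    (hD : Dense D) {x : G} {U : Set G} (hU : IsOpen U) (hx : x ∈ U) :
    ∃ d ∈ D, d ∈ U ∧ x - d ∈ interior (P : Set G) := by
  obtain ⟨p, hp, hpU⟩ := mem_closure_sub_interior hP x hU hx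
  obtain ⟨d, ⟨hdU, hdp⟩, hdD⟩ := hD.inter_open_nonempty
    (U ∩ (fun y => x - y) ⁻¹' interior (P : Set G))
    (hU.inter (isOpen_interior.preimage (by fun_prop))) ⟨x - p, hpU, by simpa using hp⟩
  exact ⟨d, hdD, hdU, hdp⟩

/-- Since `A` is closed downwards, it meets an open set as soon as it contains a point of a dense
set there. -/
theorem Yu.inter_nonempty_iff (hP : (P : Set G) ⊆ closure (interior (P : Set G))) {D : Set G}
    (hD : Dense D) (A : Yu P) {U : Set G} (hU : IsOpen U) :
    ((A.carrier : Set G) ∩ U).Nonempty ↔ ∃ d ∈ D, d ∈ U ∧ d ∈ A.carrier := by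
  constructor
  · rintro ⟨x, hxA, hxU⟩
    obtain ⟨d, hdD, hdU, hdp⟩ := exists_dense_below hP hD hU hxU
    exact ⟨d, hdD, hdU, A.mem_of_sub_mem hxA (interior_subset hdp)⟩
  · rintro ⟨d, -, hdU, hdA⟩
    exact ⟨d, hdA, hdU⟩

end Order

/-! ### Countability and Borel structure of `Y_u` -/

section Borel

variable {G : Type u} [AddCommGroup G] [TopologicalSpace G] [IsTopologicalAddGroup G]
  [LocallyCompactSpace G] [SecondCountableTopology G] [T2Space G] {P : AddSubmonoid G}

/-- The subbasis of the topology of `Y_u` given by a countable basis of `G`: the hit sets of the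
basic open sets and the miss sets of their compact closures. -/
def countableSubbasis (P : AddSubmonoid G) : Set (Set (Yu P)) :=
  (fun U : Set G => {A : Yu P | ((A.carrier : Set G) ∩ U).Nonempty}) '' countableBasis G ∪
  (fun U : Set G => {A : Yu P | (A.carrier : Set G) ∩ closure U = ∅}) ''
    {U ∈ countableBasis G | IsCompact (closure U)}

theorem countable_countableSubbasis : (countableSubbasis P).Countable :=
  ((countable_countableBasis G).image _).union
    (((countable_countableBasis G).mono (sep_subset _ _)).image _)

theorem exists_mem_countableBasis_closure {x : G} {U : Set G} (hU : IsOpen U) (hx : x ∈ U) :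
    ∃ V ∈ countableBasis G, x ∈ V ∧ IsCompact (closure V) ∧ closure V ⊆ U := by
  obtain ⟨K, hK, hxK, hKU⟩ := exists_compact_subset hU hx
  obtain ⟨V, hV, hxV, hVK⟩ := (isBasis_countableBasis G).exists_subset_of_mem_open hxK
    isOpen_interior
  have hVK' : closure V ⊆ K := closure_minimal (hVK.trans interior_subset) hK.isClosed
  exact ⟨V, hV, hxV, hK.of_isClosed_subset isClosed_closure hVK', hVK'.trans hKU⟩

theorem topology_eq_generateFrom_countableSubbasis :
    (inferInstance : TopologicalSpace (Yu P)) = generateFrom (countableSubbasis P) := by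
  refine le_antisymm (le_generateFrom ?_) ?_
  · rintro _ (⟨U, hU, rfl⟩ | ⟨U, ⟨hU, hUc⟩, rfl⟩)
    · exact isOpen_hit ((isBasis_countableBasis G).isOpen hU)
    · exact isOpen_miss hUc
  · change generateFrom _ ≤ (fellTopology G).induced Yu.carrier
    rw [fellTopology, induced_generateFrom_eq]
    refine le_generateFrom ?_
    rintro _ ⟨_, ⟨U, hU, rfl⟩ | ⟨K, hK, rfl⟩, rfl⟩
    · have : Yu.carrier ⁻¹' {A : Closeds G | ((A : Set G) ∩ U).Nonempty} =
          ⋃ V ∈ {V ∈ countableBasis G | V ⊆ U},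
            {A : Yu P | ((A.carrier : Set G) ∩ V).Nonempty} := by
        ext A
        simp only [mem_preimage, mem_ofPred_eq, mem_iUnion, exists_prop]
        constructor
        · rintro ⟨x, hxA, hxU⟩
          obtain ⟨V, hV, hxV, hVU⟩ :=
            (isBasis_countableBasis G).exists_subset_of_mem_open hxU hU
          exact ⟨V, ⟨hV, hVU⟩, x, hxA, hxV⟩
        · rintro ⟨V, ⟨-, hVU⟩, x, hxA, hxV⟩
          exact ⟨x, hxA, hVU hxV⟩
      rw [this]
      refine @isOpen_biUnion _ _ (generateFrom _) _ _ fun V hV => ?_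
      exact isOpen_generateFrom_of_mem (Or.inl ⟨V, hV.1, rfl⟩)
    · refine (@isOpen_iff_forall_mem_open _ (generateFrom _) _).2 fun A hA => ?_
      have hA' : (A.carrier : Set G) ∩ K = ∅ := hA
      have hcov : ∀ x ∈ K, ∃ V ∈ countableBasis G, x ∈ V ∧ IsCompact (closure V) ∧
          closure V ⊆ (A.carrier : Set G)ᶜ := fun x hx =>
        exists_mem_countableBasis_closure A.carrier.isClosed.isOpen_compl
          fun hxA => eq_empty_iff_forall_notMem.1 hA' x ⟨hxA, hx⟩
      choose! V hVB hxV hVc hVA using hcov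
      obtain ⟨t, hKt⟩ := hK.elim_nhds_subcover' (fun x _ => V x)
        fun x hx => ((isBasis_countableBasis G).isOpen (hVB x hx)).mem_nhds (hxV x hx)
      refine ⟨⋂ x ∈ t, {B : Yu P | (B.carrier : Set G) ∩ closure (V x) = ∅}, ?_, ?_, ?_⟩
      · intro B hB
        change (B.carrier : Set G) ∩ K = ∅
        refine eq_empty_iff_forall_notMem.2 ?_
        rintro y ⟨hyB, hyK⟩
        obtain ⟨x, hxt, hyV⟩ := mem_iUnion₂.1 (hKt hyK)
        exact eq_empty_iff_forall_notMem.1 (mem_iInter₂.1 hB x hxt) y ⟨hyB, subset_closure hyV⟩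
      · refine @isOpen_biInter_finset _ _ (generateFrom _) t _ fun x hx => ?_
        exact isOpen_generateFrom_of_mem (Or.inr ⟨V x, ⟨hVB _ x.2, hVc _ x.2⟩, rfl⟩)
      · refine mem_iInter₂.2 fun x _ => eq_empty_iff_forall_notMem.2 ?_
        rintro y ⟨hyA, hyV⟩
        exact hVA _ x.2 hyV hyA

instance : SecondCountableTopology (Yu P) :=
  ⟨⟨countableSubbasis P, countable_countableSubbasis,
    topology_eq_generateFrom_countableSubbasis⟩⟩

/-- The miss set of a compact set is a countable union of finite intersections of complements of
hit sets. -/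
theorem miss_eq_iUnion {K : Set G} (hK : IsCompact K) :
    {A : Yu P | (A.carrier : Set G) ∩ K = ∅} =
      ⋃ t ∈ {t : Set (Set G) | t.Finite ∧ t ⊆ countableBasis G ∧ K ⊆ ⋃₀ t},
        ⋂ V ∈ t, {A : Yu P | ((A.carrier : Set G) ∩ V).Nonempty}ᶜ := by
  ext A
  simp only [mem_ofPred_eq, mem_iUnion, mem_iInter, mem_compl_iff, exists_prop]
  constructor
  · intro hA
    have hcov : ∀ x ∈ K, ∃ V ∈ countableBasis G, x ∈ V ∧ V ⊆ (A.carrier : Set G)ᶜ :=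
      fun x hx => (isBasis_countableBasis G).exists_subset_of_mem_open
        (fun hxA => eq_empty_iff_forall_notMem.1 hA x ⟨hxA, hx⟩)
        A.carrier.isClosed.isOpen_compl
    choose! V hVB hxV hVA using hcov
    obtain ⟨t, htK, hKt⟩ := hK.elim_nhds_subcover V
      fun x hx => ((isBasis_countableBasis G).isOpen (hVB x hx)).mem_nhds (hxV x hx)
    refine ⟨V '' t, ⟨t.finite_toSet.image V, ?_, ?_⟩, ?_⟩
    · rintro _ ⟨x, hx, rfl⟩
      exact hVB x (htK x hx)
    · rw [sUnion_image]; exact hKt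
    · rintro _ ⟨x, hx, rfl⟩ ⟨y, hyA, hyV⟩
      exact hVA x (htK x hx) hyV hyA
  · rintro ⟨t, ⟨-, -, hKt⟩, hA⟩
    refine eq_empty_iff_forall_notMem.2 ?_
    rintro y ⟨hyA, hyK⟩
    obtain ⟨V, hVt, hyV⟩ := hKt hyK
    exact hA V hVt ⟨y, hyA, hyV⟩

/-- The Borel σ-algebra of `Y_u` is generated by the sets `{A | d ∈ A}`, `d` in a dense
countable set. -/
theorem measurableSpace_eq_generateFrom (hP : (P : Set G) ⊆ closure (interior (P : Set G)))
    {D : Set G} (hD : Dense D) (hDc : D.Countable) :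
    (inferInstance : MeasurableSpace (Yu P)) =
      MeasurableSpace.generateFrom ((fun d => cyl P [d]) '' D) := by
  refine le_antisymm ?_ (MeasurableSpace.generateFrom_le ?_)
  · have h1 : ∀ U : Set G, IsOpen U →
        MeasurableSet[MeasurableSpace.generateFrom ((fun d => cyl P [d]) '' D)]
          {A : Yu P | ((A.carrier : Set G) ∩ U).Nonempty} := by
      intro U hU
      have : {A : Yu P | ((A.carrier : Set G) ∩ U).Nonempty} =
          ⋃ d ∈ D ∩ U, cyl P [d] := by
        ext A
        rw [mem_ofPred_eq, A.inter_nonempty_iff hP hD hU]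
        simp only [mem_iUnion, mem_cyl_singleton, exists_prop, mem_inter_iff, and_assoc]
      rw [this]
      exact MeasurableSet.biUnion (hDc.mono inter_subset_left) fun d hd =>
        MeasurableSpace.measurableSet_generateFrom ⟨d, hd.1, rfl⟩
    change borel (Yu P) ≤ _
    rw [borel_eq_generateFrom_of_subbasis topology_eq_generateFrom_countableSubbasis]
    refine MeasurableSpace.generateFrom_le ?_
    rintro _ (⟨U, hU, rfl⟩ | ⟨U, ⟨hU, hUc⟩, rfl⟩)
    · exact h1 U ((isBasis_countableBasis G).isOpen hU)
    · dsimp only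
      rw [miss_eq_iUnion hUc]
      refine MeasurableSet.biUnion ?_ fun t ht => MeasurableSet.biInter ht.1.countable
        fun V hV => (h1 V ((isBasis_countableBasis G).isOpen (ht.2.1 hV))).compl
      refine (Set.countable_ofPred_finite_subset (countable_countableBasis G)).mono ?_
      exact fun t ht => ⟨ht.1, ht.2.1⟩
  · rintro _ ⟨d, -, rfl⟩
    exact measurableSet_cyl [d]

/-- A map into `Y_u` is measurable if membership of each point of `G` is a measurable condition. -/
theorem measurable_to_Yu (hP : (P : Set G) ⊆ closure (interior (P : Set G)))
    {α : Type*} [MeasurableSpace α] {f : α → Yu P}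
    (hf : ∀ g : G, MeasurableSet {x | g ∈ (f x).carrier}) : Measurable f := by
  obtain ⟨D, hDc, hD⟩ := exists_countable_dense G
  have h := measurableSpace_eq_generateFrom (P := P) hP hD hDc
  have : @Measurable α (Yu P) _ (MeasurableSpace.generateFrom ((fun d => cyl P [d]) '' D)) f := by
    refine measurable_generateFrom ?_
    rintro _ ⟨d, -, rfl⟩
    convert hf d using 1
    ext x
    exact mem_cyl_singleton
  rwa [← h] at this

theorem generateFrom_cyl (hP : (P : Set G) ⊆ closure (interior (P : Set G))) :
    (inferInstance : MeasurableSpace (Yu P)) = MeasurableSpace.generateFrom (range (cyl P)) := by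
  obtain ⟨D, hDc, hD⟩ := exists_countable_dense G
  refine le_antisymm ?_ (MeasurableSpace.generateFrom_le ?_)
  · rw [measurableSpace_eq_generateFrom (P := P) hP hD hDc]
    refine MeasurableSpace.generateFrom_mono ?_
    rintro _ ⟨d, -, rfl⟩
    exact ⟨[d], rfl⟩
  · rintro _ ⟨L, rfl⟩
    exact measurableSet_cyl L

theorem isPiSystem_range_cyl : IsPiSystem (range (cyl P)) := by
  rintro _ ⟨L, rfl⟩ _ ⟨M, rfl⟩ -
  exact ⟨L ++ M, cyl_append L M⟩

theorem measurableSet_mem_carrier [MeasurableSpace G] [BorelSpace G] :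
    MeasurableSet {p : G × Yu P | p.1 ∈ p.2.carrier} := by
  have : {p : G × Yu P | p.1 ∈ p.2.carrier} = ⋂ U ∈ countableBasis G,
      ((Prod.fst ⁻¹' U)ᶜ ∪ Prod.snd ⁻¹' {A : Yu P | ((A.carrier : Set G) ∩ U).Nonempty}) := by
    ext ⟨x, A⟩
    simp only [mem_ofPred_eq, mem_iInter, mem_union, mem_compl_iff, mem_preimage]
    constructor
    · intro hx U _
      by_cases hxU : x ∈ U
      · exact Or.inr ⟨x, hx, hxU⟩
      · exact Or.inl hxU
    · intro h
      by_contra hx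
      obtain ⟨V, hV, hxV, hVA⟩ := (isBasis_countableBasis G).exists_subset_of_mem_open
        (show x ∈ (A.carrier : Set G)ᶜ from hx) A.carrier.isClosed.isOpen_compl
      rcases h V hV with h | ⟨y, hyA, hyV⟩
      · exact h hxV
      · exact hVA hyV hyA
  rw [this]
  refine MeasurableSet.biInter (countable_countableBasis G) fun U hU => ?_
  have hUo := (isBasis_countableBasis G).isOpen hU
  exact (measurable_fst hUo.measurableSet).compl.union
    (measurable_snd (isOpen_hit hUo).measurableSet)

/-- The action of `G` on `Y_u` is jointly measurable. -/
theorem measurable_vadd_prod [MeasurableSpace G] [BorelSpace G]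
    (hP : (P : Set G) ⊆ closure (interior (P : Set G))) :
    Measurable fun p : G × Yu P => p.1 +ᵥ p.2 := by
  refine measurable_to_Yu hP fun g => ?_
  have : Measurable fun p : G × Yu P => (g - p.1, p.2) :=
    (measurable_fst.const_sub g).prodMk measurable_snd
  exact this measurableSet_mem_carrier

end Borel

/-! ### Compact subsets of `Y_u` -/

section Compact

variable {G : Type u} [AddCommGroup G] [TopologicalSpace G] [IsTopologicalAddGroup G]
  {P : AddSubmonoid G}

theorem topology_eq_generateFrom :
    (inferInstance : TopologicalSpace (Yu P)) = generateFrom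
      ({S | ∃ U : Set G, IsOpen U ∧ S = {A : Yu P | ((A.carrier : Set G) ∩ U).Nonempty}} ∪
       {S | ∃ K : Set G, IsCompact K ∧ S = {A : Yu P | (A.carrier : Set G) ∩ K = ∅}}) := by
  refine le_antisymm (le_generateFrom ?_) ?_
  · rintro _ (⟨U, hU, rfl⟩ | ⟨K, hK, rfl⟩)
    · exact isOpen_hit hU
    · exact isOpen_miss hK
  · change generateFrom _ ≤ (fellTopology G).induced Yu.carrier
    rw [fellTopology, induced_generateFrom_eq]
    refine generateFrom_anti ?_
    rintro _ ⟨_, ⟨U, hU, rfl⟩ | ⟨K, hK, rfl⟩, rfl⟩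
    · exact Or.inl ⟨U, hU, rfl⟩
    · exact Or.inr ⟨K, hK, rfl⟩

/-- The sets in `Y_u` that contain `0` and avoid `a + Int P` form a compact set. By Alexander's
subbasis theorem only covers by hit and miss sets matter; the largest closed set compatible with
missing all the open sets of such a cover decides which miss set is needed. -/
theorem isCompact_zero_mem_disjoint (a : G) (hne : (interior (P : Set G)).Nonempty) :
    IsCompact {A : Yu P | 0 ∈ A.carrier ∧ ∀ p ∈ interior (P : Set G), a + p ∉ A.carrier} := by
  refine isCompact_generateFrom topology_eq_generateFrom fun C hC hcov => ?_
  set Z := {A : Yu P | 0 ∈ A.carrier ∧ ∀ p ∈ interior (P : Set G), a + p ∉ A.carrier}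
  set 𝒰 : Set (Set G) :=
    {U | IsOpen U ∧ {A : Yu P | ((A.carrier : Set G) ∩ U).Nonempty} ∈ C}
  -- the points lying above a point of some `U ∈ 𝒰`, and those above `a + Int P`
  let up (U : Set G) : Set G := ⋃ p ∈ P, (fun x => x - p) ⁻¹' U
  have hup : ∀ U, IsOpen U → IsOpen (up U) := fun U hU =>
    isOpen_biUnion fun p _ => hU.preimage (by fun_prop)
  have hup_add : ∀ U x p, p ∈ P → x ∉ up U → x - p ∉ up U := by
    intro U x p hp hx h
    obtain ⟨q, hq, hxq⟩ := mem_iUnion₂.1 h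
    exact hx (mem_iUnion₂.2 ⟨p + q, P.add_mem hp hq, by
      simpa [sub_sub] using hxq⟩)
  let I : Set G := (fun x => x - a) ⁻¹' interior (P : Set G)
  have hI : IsOpen I := isOpen_interior.preimage (by fun_prop)
  have hI_add : ∀ x p, p ∈ P → x ∉ I → x - p ∉ I := by
    intro x p hp hx h
    refine hx ?_
    have := interior_add_mem (show x - p - a ∈ interior (P : Set G) from h) hp
    change x - a ∈ interior (P : Set G)
    convert this using 1; abel
  let B : Set G := (⋃ U ∈ 𝒰, up U)ᶜ ∩ Iᶜ
  have hBc : IsClosed B :=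
    (isOpen_biUnion fun U hU => hup U hU.1).isClosed_compl.inter hI.isClosed_compl
  have hZI : ∀ A ∈ Z, ∀ x ∈ A.carrier, x ∉ I := by
    intro A hA x hx hxI
    exact hA.2 (x - a) hxI (by simpa using hx)
  have hhit : ∀ A ∈ Z, ∀ U ∈ 𝒰, ∀ x ∈ A.carrier, x ∈ up U →
      A ∈ {A : Yu P | ((A.carrier : Set G) ∩ U).Nonempty} := by
    intro A _ U _ x hx hxU
    obtain ⟨p, hp, hxp⟩ := mem_iUnion₂.1 hxU
    exact ⟨x - p, A.sub_mem hx hp, hxp⟩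
  by_cases h0 : (0 : G) ∈ B
  · let A₀ : Yu P :=
      { carrier := ⟨B, hBc⟩
        neg_add_mem := by
          intro p hp x hx
          change -p + x ∈ B
          have hx' : x ∈ B := hx
          rw [neg_add_eq_sub]
          refine ⟨fun h => ?_, hI_add x p hp hx'.2⟩
          obtain ⟨U, hU, hxU⟩ := mem_iUnion₂.1 h
          exact hup_add U x p hp (fun h => hx'.1 (mem_iUnion₂.2 ⟨U, hU, h⟩)) hxU
        nonempty := ⟨0, h0⟩
        ne_univ := by
          intro h
          obtain ⟨p, hp⟩ := hne
          have : a + p ∈ B := by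
            change B = univ at h
            rw [h]; trivial
          exact this.2 (show a + p - a ∈ interior (P : Set G) by simpa using hp) }
    have hA₀ : A₀ ∈ Z := ⟨h0, fun p hp h => by
      have : a + p ∈ B := h
      exact this.2 (show a + p - a ∈ interior (P : Set G) by simpa using hp)⟩
    obtain ⟨S, hSC, hAS⟩ := hcov hA₀
    rcases hC hSC with ⟨U, hU, rfl⟩ | ⟨K, hK, rfl⟩
    · obtain ⟨x, hxB, hxU⟩ := hAS
      have hxB' : x ∈ B := hxB
      exact absurd (mem_iUnion₂.2 ⟨U, ⟨hU, hSC⟩, mem_iUnion₂.2 ⟨0, P.zero_mem, by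
        simpa using hxU⟩⟩) hxB'.1
    · have hAK : B ∩ K = ∅ := hAS
      have hKcov : K \ I ⊆ ⋃ U ∈ 𝒰, up U := by
        rintro x ⟨hxK, hxI⟩
        by_contra hx
        exact eq_empty_iff_forall_notMem.1 hAK x ⟨⟨hx, hxI⟩, hxK⟩
      obtain ⟨T, hT𝒰, hT, hKT⟩ := (hK.diff hI).elim_finite_subcover_image
        (fun U hU => hup U hU.1) hKcov
      refine ⟨insert {A : Yu P | (A.carrier : Set G) ∩ K = ∅}
        ((fun U => {A : Yu P | ((A.carrier : Set G) ∩ U).Nonempty}) '' T),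
        insert_subset hSC (image_subset_iff.2 fun U hU => (hT𝒰 hU).2),
        (hT.image _).insert _, fun A hA => ?_⟩
      rw [sUnion_insert, sUnion_image]
      by_cases hAK : (A.carrier : Set G) ∩ K = ∅
      · exact Or.inl hAK
      · obtain ⟨x, hxA, hxK⟩ := nonempty_iff_ne_empty.2 hAK
        obtain ⟨U, hUT, hxU⟩ := mem_iUnion₂.1 (hKT ⟨hxK, hZI A hA x hxA⟩)
        exact Or.inr (mem_iUnion₂.2 ⟨U, hUT, hhit A hA U (hT𝒰 hUT) x hxA hxU⟩)
  · rw [mem_inter_iff, not_and_or, notMem_compl_iff, notMem_compl_iff] at h0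
    rcases h0 with h0 | h0
    · obtain ⟨U, hU, h0U⟩ := mem_iUnion₂.1 h0
      exact ⟨{{A : Yu P | ((A.carrier : Set G) ∩ U).Nonempty}}, by simpa using hU.2,
        finite_singleton _, fun A hA => ⟨_, rfl, hhit A hA U hU 0 hA.1 h0U⟩⟩
    · exact ⟨∅, empty_subset _, finite_empty, fun A hA => (hZI A hA 0 hA.1 h0).elim⟩

end Compact

/-! ### Exhaustion of `Y_u` by slabs of finite measure -/

section Slab

variable {G : Type u} [AddCommGroup G] [TopologicalSpace G] [IsTopologicalAddGroup G]
  {P : AddSubmonoid G}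

/-- The standing assumptions on the cone `P` and the order unit `a₀`. They imply `G = P - P`. -/
structure IsOrderUnit (P : AddSubmonoid G) (a₀ : G) : Prop where
  subset_closure : (P : Set G) ⊆ closure (interior (P : Set G))
  mem_interior : a₀ ∈ interior (P : Set G)
  exists_nsmul_sub : ∀ s : G, ∃ n : ℕ, 0 < n ∧ n • a₀ - s ∈ interior (P : Set G)

variable {a₀ : G}

namespace IsOrderUnit

theorem mem (h : IsOrderUnit P a₀) : a₀ ∈ P := interior_subset h.mem_interior

theorem nsmul_mem (h : IsOrderUnit P a₀) (n : ℕ) : n • a₀ ∈ P := P.nsmul_mem h.mem n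

theorem nonempty_interior (h : IsOrderUnit P a₀) : (interior (P : Set G)).Nonempty :=
  ⟨a₀, h.mem_interior⟩

theorem exists_forall_ge (h : IsOrderUnit P a₀) (s : G) :
    ∃ n : ℕ, ∀ m ≥ n, m • a₀ - s ∈ interior (P : Set G) := by
  obtain ⟨n, -, hn⟩ := h.exists_nsmul_sub s
  refine ⟨n, fun m hm => ?_⟩
  obtain ⟨k, rfl⟩ := Nat.exists_eq_add_of_le hm
  have := interior_add_mem hn (h.nsmul_mem k)
  convert this using 1
  rw [add_nsmul]; abel

/-- Finitely many elements of `G` have a common upper bound of the form `n a₀`. -/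
theorem exists_forall_ge_finite (h : IsOrderUnit P a₀) (S : List G) :
    ∃ n : ℕ, ∀ m ≥ n, ∀ s ∈ S, m • a₀ - s ∈ interior (P : Set G) := by
  induction S with
  | nil => exact ⟨0, fun m _ s hs => by simp at hs⟩
  | cons s S ih =>
    obtain ⟨n, hn⟩ := ih
    obtain ⟨k, hk⟩ := h.exists_forall_ge s
    refine ⟨max n k, fun m hm t ht => ?_⟩
    rcases List.mem_cons.1 ht with rfl | ht
    · exact hk m (le_trans (le_max_right _ _) hm)
    · exact hn m (le_trans (le_max_left _ _) hm) t ht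

end IsOrderUnit

/-- The slab of all `A ∈ Y_u` with `b ∈ A` and `a ∉ A`. -/
def slab (P : AddSubmonoid G) (b a : G) : Set (Yu P) := {A | b ∈ A.carrier ∧ a ∉ A.carrier}

theorem mem_slab {b a : G} {A : Yu P} : A ∈ slab P b a ↔ b ∈ A.carrier ∧ a ∉ A.carrier := Iff.rfl

theorem slab_eq (b a : G) : slab P b a = cyl P [b] \ cyl P [a] := by
  ext A; rw [mem_sdiff, mem_cyl_singleton, mem_cyl_singleton, mem_slab]

theorem measurableSet_slab (b a : G) : MeasurableSet (slab P b a) := by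
  rw [slab_eq]; exact (measurableSet_cyl _).diff (measurableSet_cyl _)

theorem vadd_slab (s b a : G) : s +ᵥ slab P b a = slab P (s + b) (s + a) := by
  rw [slab_eq, slab_eq, vadd_set_sdiff, vadd_cyl, vadd_cyl]; rfl

theorem slab_zero (a : G) : slab P 0 a = Xu P \ (a +ᵥ Xu P) := by
  ext A
  rw [mem_sdiff, mem_vadd_Xu]; rfl

theorem slab_mono {b a b' a' : G} (hb : b - b' ∈ P) (ha : a' - a ∈ P) :
    slab P b a ⊆ slab P b' a' := fun A hA =>
  ⟨A.mem_of_sub_mem hA.1 hb, fun h => hA.2 (A.mem_of_sub_mem h ha)⟩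

/-- The exhausting sequence of slabs between `-n a₀` and `n a₀`. -/
def bigSlab (P : AddSubmonoid G) (a₀ : G) (n : ℕ) : Set (Yu P) := slab P (-(n • a₀)) (n • a₀)

theorem measurableSet_bigSlab (n : ℕ) : MeasurableSet (bigSlab P a₀ n) := measurableSet_slab _ _

theorem iUnion_bigSlab (h : IsOrderUnit P a₀) : ⋃ n, bigSlab P a₀ n = univ := by
  refine eq_univ_of_forall fun A => ?_
  obtain ⟨x, hx⟩ := A.nonempty
  obtain ⟨y, hy⟩ := (ne_univ_iff_exists_notMem _).1 A.ne_univ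
  obtain ⟨n, hn⟩ := h.exists_forall_ge_finite [-x, y]
  have h1 := interior_subset (hn n le_rfl (-x) (by simp))
  have h2 := interior_subset (hn n le_rfl y (by simp))
  refine mem_iUnion.2 ⟨n, A.mem_of_sub_mem hx ?_, fun hA => hy (A.mem_of_sub_mem hA h2)⟩
  rw [SetLike.mem_coe] at h1
  convert h1 using 1; abel

theorem iUnion_cyl_neg (h : IsOrderUnit P a₀) : ⋃ n : ℕ, cyl P [-(n • a₀)] = univ := by
  rw [← univ_subset_iff, ← iUnion_bigSlab h]
  exact iUnion_mono fun n A hA => mem_cyl_singleton.2 hA.1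

/-- The exhausting slabs are not open, but each compact set is contained in one of them: the open
sets `O n` below are contained in the slabs and still exhaust `Y_u`. -/
theorem isFiniteMeasureOnCompacts_of_bigSlab (h : IsOrderUnit P a₀) {μ : Measure (Yu P)}
    (hμ : ∀ n, μ (bigSlab P a₀ n) < ∞) : IsFiniteMeasureOnCompacts μ := by
  refine ⟨fun K hK => ?_⟩
  let U (n : ℕ) : Set G := (fun x => x + n • a₀) ⁻¹' interior (P : Set G)
  let O (n : ℕ) : Set (Yu P) := {A | ((A.carrier : Set G) ∩ U n).Nonempty} ∩
    {A | (A.carrier : Set G) ∩ {n • a₀} = ∅}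
  have hO : ∀ n, IsOpen (O n) := fun n =>
    (isOpen_hit (isOpen_interior.preimage (by fun_prop))).inter (isOpen_miss isCompact_singleton)
  have hmemO : ∀ n A, A ∈ O n ↔ (∃ x ∈ A.carrier, x + n • a₀ ∈ interior (P : Set G)) ∧
      n • a₀ ∉ A.carrier := by
    intro n A
    refine and_congr Iff.rfl ?_
    change (A.carrier : Set G) ∩ {n • a₀} = ∅ ↔ _
    rw [inter_singleton_eq_empty]; rfl
  have hmono : Monotone O := by
    intro n m hnm A hA
    rw [hmemO] at hA ⊢
    obtain ⟨⟨x, hx, hxn⟩, hA⟩ := hA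
    obtain ⟨k, rfl⟩ := Nat.exists_eq_add_of_le hnm
    have hk := h.nsmul_mem k
    refine ⟨⟨x, hx, ?_⟩, fun h' => hA (A.mem_of_sub_mem h' ?_)⟩
    · convert interior_add_mem hxn hk using 1; rw [add_nsmul]; abel
    · convert hk using 1; rw [add_nsmul]; abel
  have hcov : K ⊆ ⋃ n, O n := by
    intro A _
    obtain ⟨x, hx⟩ := A.nonempty
    obtain ⟨y, hy⟩ := (ne_univ_iff_exists_notMem _).1 A.ne_univ
    obtain ⟨n, hn⟩ := h.exists_forall_ge_finite [-x, y]
    have h1 := hn n le_rfl (-x) (by simp)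
    have h2 := interior_subset (hn n le_rfl y (by simp))
    refine mem_iUnion.2 ⟨n, (hmemO _ _).2 ⟨⟨x, hx, ?_⟩, fun hA => hy (A.mem_of_sub_mem hA h2)⟩⟩
    convert h1 using 1; abel
  obtain ⟨n, hn⟩ := hK.elim_directed_cover O hO hcov hmono.directed_le
  refine (measure_mono (hn.trans fun A hA => ?_)).trans_lt (hμ n)
  obtain ⟨⟨x, hx, hxn⟩, hA⟩ := (hmemO _ _).1 hA
  exact ⟨A.mem_of_sub_mem hx (by simpa using interior_subset hxn), hA⟩

theorem sigmaFinite_of_bigSlab (h : IsOrderUnit P a₀) {μ : Measure (Yu P)}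
    (hμ : ∀ n, μ (bigSlab P a₀ n) < ∞) : SigmaFinite μ :=
  ⟨⟨⟨bigSlab P a₀, fun _ => trivial, hμ, iUnion_bigSlab h⟩⟩⟩

variable {c : G →+ ℝ} {β : ℝ} {μ : Measure (Yu P)}

/-- The slab `slab P 0 a` lies in a compact set, although it need not be compact itself. -/
theorem measure_slab_zero_lt_top (h : IsOrderUnit P a₀) [IsFiniteMeasureOnCompacts μ] (a : G) :
    μ (slab P 0 a) < ∞ := by
  refine (measure_mono fun A hA => ?_).trans_lt
    (isCompact_zero_mem_disjoint (P := P) a h.nonempty_interior).measure_lt_top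
  exact ⟨hA.1, fun p hp hap => hA.2 (A.mem_of_sub_mem hap (by simpa using interior_subset hp))⟩

theorem measure_slab_lt_top (h : IsOrderUnit P a₀) [IsFiniteMeasureOnCompacts μ]
    (hμ : IsConformalMeasure c β μ) (b a : G) : μ (slab P b a) < ∞ := by
  have : slab P b a = b +ᵥ slab P 0 (a - b) := by rw [vadd_slab]; simp
  rw [this, hμ _ _ (measurableSet_slab _ _)]
  exact ENNReal.mul_lt_top ENNReal.ofReal_lt_top (measure_slab_zero_lt_top h _)

theorem sigmaFinite_of_conformal (h : IsOrderUnit P a₀) [IsFiniteMeasureOnCompacts μ]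
    (hμ : IsConformalMeasure c β μ) : SigmaFinite μ :=
  sigmaFinite_of_bigSlab h fun _ => measure_slab_lt_top h hμ _ _

/-- An invariant set that is null inside `X_u` is null, because the translates of `X_u` cover
`Y_u`. -/
theorem measure_eq_zero_of_inter_Xu (h : IsOrderUnit P a₀) (hμ : IsConformalMeasure c β μ)
    {E : Set (Yu P)} (hE : MeasurableSet E) (hinv : ∀ s : G, s +ᵥ E = E)
    (h0 : μ (E ∩ Xu P) = 0) : μ E = 0 := by
  have : E = ⋃ n : ℕ, -(n • a₀) +ᵥ (E ∩ Xu P) := by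
    have h1 : ∀ n : ℕ, -(n • a₀) +ᵥ (E ∩ Xu P) = E ∩ cyl P [-(n • a₀)] := by
      intro n
      rw [vadd_set_inter, hinv, Xu_eq_cyl, vadd_cyl]; simp
    simp_rw [h1]
    rw [← inter_iUnion, iUnion_cyl_neg h, inter_univ]
  rw [this, measure_iUnion_null_iff]
  intro n
  rw [hμ _ _ (hE.inter measurableSet_Xu), h0, mul_zero]

/-- Conformal measures agreeing inside `X_u` are equal. -/
theorem conformal_ext (h : IsOrderUnit P a₀) {ν : Measure (Yu P)} (hμ : IsConformalMeasure c β μ)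
    (hν : IsConformalMeasure c β ν) (heq : μ.restrict (Xu P) = ν.restrict (Xu P)) : μ = ν := by
  have hX : ∀ E, MeasurableSet E → E ⊆ Xu P → μ E = ν E := by
    intro E hE hEX
    have := congrArg (fun m : Measure (Yu P) => m E) heq
    simpa [Measure.restrict_apply hE, inter_eq_left.2 hEX] using this
  refine (Measure.ext_iff_of_iUnion_eq_univ (iUnion_cyl_neg h)).2 fun n => ?_
  ext E hE
  have hm := hE.inter (measurableSet_cyl (P := P) [-(n • a₀)])
  have hm' := measurableSet_vadd (n • a₀) hm
  rw [Measure.restrict_apply hE, Measure.restrict_apply hE]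
  have hE' : E ∩ cyl P [-(n • a₀)] = -(n • a₀) +ᵥ (n • a₀ +ᵥ (E ∩ cyl P [-(n • a₀)])) := by
    rw [vadd_vadd]; simp
  rw [hE', hμ _ _ hm', hν _ _ hm', hX _ hm']
  rw [vadd_set_inter, vadd_cyl, Xu_eq_cyl]
  simp

variable [LocallyCompactSpace G] [SecondCountableTopology G] [T2Space G]

/-- The cylinder sets form a π-system, so a measure finite on slabs is determined by its values on
the intersections of cylinder sets with the exhausting slabs. -/
theorem ext_of_cyl_inter_bigSlab (h : IsOrderUnit P a₀) {ν : Measure (Yu P)}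
    (hμ : ∀ n, μ (bigSlab P a₀ n) < ∞)
    (heq : ∀ n L, μ (cyl P L ∩ bigSlab P a₀ n) = ν (cyl P L ∩ bigSlab P a₀ n)) : μ = ν := by
  refine (Measure.ext_iff_of_iUnion_eq_univ (iUnion_bigSlab h)).2 fun n => ?_
  have : IsFiniteMeasure (μ.restrict (bigSlab P a₀ n)) := ⟨by
    rw [Measure.restrict_apply_univ]; exact hμ n⟩
  refine ext_of_generate_finite _ (generateFrom_cyl h.subset_closure) isPiSystem_range_cyl ?_ ?_
  · rintro _ ⟨L, rfl⟩
    rw [Measure.restrict_apply (measurableSet_cyl L), Measure.restrict_apply (measurableSet_cyl L),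
      heq]
  · have := heq n []
    rwa [cyl_nil, univ_inter, ← Measure.restrict_apply_univ,
      ← Measure.restrict_apply_univ (μ := ν)] at this

end Slab

/-! ### Boundary points -/

section Boundary

variable {G : Type u} [AddCommGroup G] [TopologicalSpace G] [IsTopologicalAddGroup G]
  {P : AddSubmonoid G} {a₀ : G} {c : G →+ ℝ} {β : ℝ} {μ : Measure (Yu P)}

/-- The `A ∈ Y_u` having `g` as a maximal point: `g ∈ A` but no point of `g + Int P` lies in `A`.
Since `A` contains `x - Int P` for each `x ∈ A`, these are the `A` having `g` in their frontier. -/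
def boundary (P : AddSubmonoid G) (g : G) : Set (Yu P) :=
  {A | g ∈ A.carrier ∧ ∀ p ∈ interior (P : Set G), g + p ∉ A.carrier}

theorem measurableSet_boundary (g : G) : MeasurableSet (boundary P g) := by
  have : boundary P g = cyl P [g] ∩
      {A : Yu P | ((A.carrier : Set G) ∩ (fun x => x - g) ⁻¹' interior (P : Set G)).Nonempty}ᶜ := by
    ext A
    rw [mem_inter_iff, mem_cyl_singleton]
    refine and_congr_right fun _ => ⟨?_, ?_⟩
    · rintro h ⟨x, hx, hxg⟩
      exact h _ hxg (by simpa using hx)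
    · intro h p hp hgp
      exact h ⟨g + p, hgp, by simpa using hp⟩
  rw [this]
  exact (measurableSet_cyl _).inter
    (isOpen_hit (isOpen_interior.preimage (by fun_prop))).measurableSet.compl

theorem vadd_boundary (s g : G) : s +ᵥ boundary P g = boundary P (s + g) := by
  ext A
  rw [mem_vadd_set_iff_neg_vadd_mem]
  refine and_congr ?_ (forall₂_congr fun p _ => not_congr ?_)
  · rw [mem_vadd_carrier, sub_neg_eq_add, add_comm]
  · rw [mem_vadd_carrier, sub_neg_eq_add, add_comm, add_assoc]

/-- Away from the boundary, membership is locally constant. -/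
theorem eventually_mem_iff {g : G} {A : Yu P} (hA : A ∉ boundary P g) :
    ∀ᶠ x in nhds g, (x ∈ A.carrier ↔ g ∈ A.carrier) := by
  by_cases hg : g ∈ A.carrier
  · have : ∃ p ∈ interior (P : Set G), g + p ∈ A.carrier := by
      by_contra! h
      exact hA ⟨hg, h⟩
    obtain ⟨p, hp, hgp⟩ := this
    have h1 : g ∈ interior (A.carrier : Set G) := by simpa using A.sub_mem_interior hgp hp
    filter_upwards [mem_interior_iff_mem_nhds.1 h1] with x hx
    exact iff_of_true hx hg
  · filter_upwards [A.carrier.isClosed.isOpen_compl.mem_nhds hg] with x hx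
    exact iff_of_false hx hg

/-- For a conformal measure, almost no `A` has `g` in its frontier. The order interval `[0, a₀]`
contains an increasing sequence `g₀, g₁, …` on which `c` is bounded; the sets `boundary g_i` are
disjoint, lie in a slab of finite measure, and their measures are bounded below by a multiple of
the measure of `boundary 0`. -/
theorem measure_boundary (h : IsOrderUnit P a₀) (hc : Continuous c) [IsFiniteMeasureOnCompacts μ]
    (hμ : IsConformalMeasure c β μ) (g : G) : μ (boundary P g) = 0 := by
  suffices h0 : μ (boundary P 0) = 0 by
    have := hμ g _ (measurableSet_boundary (P := P) 0)
    rwa [vadd_boundary, add_zero, h0, mul_zero] at this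
  -- `y` runs through the points `a₀ - g_i`
  let O : Set G := {y | y ∈ interior (P : Set G) ∧ |c (a₀ - y)| < 1}
  have hO : IsOpen O := isOpen_interior.inter
    (isOpen_lt (hc.comp (continuous_const.sub continuous_id)).abs continuous_const)
  have step : ∀ y : {y // y ∈ O ∧ a₀ - y ∈ P},
      ∃ z : {y // y ∈ O ∧ a₀ - y ∈ P}, y.1 - z.1 ∈ interior (P : Set G) := by
    rintro ⟨y, hyO, hyP⟩
    obtain ⟨p, hp, hpO⟩ := mem_closure_sub_interior h.subset_closure y hO hyO
    refine ⟨⟨y - p, hpO, ?_⟩, by simpa using hp⟩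
    have := P.add_mem hyP (interior_subset hp)
    convert this using 1; abel
  choose next hnext using step
  let y (n : ℕ) : {y // y ∈ O ∧ a₀ - y ∈ P} :=
    next^[n] ⟨a₀, ⟨h.mem_interior, by simp⟩, by simp⟩
  have hy_succ : ∀ n, (y n).1 - (y (n + 1)).1 ∈ interior (P : Set G) := by
    intro n
    simp only [y, Function.iterate_succ_apply']
    exact hnext _
  have hy_lt : ∀ i k, (y i).1 - (y (i + k + 1)).1 ∈ interior (P : Set G) := by
    intro i k
    induction k with
    | zero => exact hy_succ i
    | succ k ih =>
      have := interior_add_mem ih (interior_subset (hy_succ (i + k + 1)))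
      convert this using 1; rw [← add_assoc]; abel
  let g (n : ℕ) : G := a₀ - (y n).1
  have hdisj' : ∀ i j, i < j → Disjoint (boundary P (g i)) (boundary P (g j)) := by
    intro i j hij
    obtain ⟨k, rfl⟩ := Nat.exists_eq_add_of_lt hij
    refine disjoint_left.2 fun A hi hj => hi.2 _ (hy_lt i k) ?_
    convert hj.1 using 1
    simp only [g]; abel
  have hdisj : Pairwise (Function.onFun Disjoint fun n => boundary P (g n)) := by
    intro i j hij
    rcases lt_or_gt_of_ne hij with h | h
    · exact hdisj' i j h
    · exact (hdisj' j i h).symm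
  have hsub : ⋃ n, boundary P (g n) ⊆ slab P 0 a₀ := by
    refine iUnion_subset fun n A hA => ⟨A.mem_of_sub_mem hA.1 ?_, fun ha => ?_⟩
    · simpa [g] using (y n).2.2
    · exact hA.2 _ (y n).2.1.1 (by simpa [g] using ha)
  have hfin : ∑' n, μ (boundary P (g n)) ≠ ∞ := by
    rw [← measure_iUnion hdisj fun n => measurableSet_boundary _]
    exact ((measure_mono hsub).trans_lt (measure_slab_zero_lt_top h a₀)).ne
  have hle : ∀ n, ENNReal.ofReal (Real.exp (-|β|)) * μ (boundary P 0) ≤ μ (boundary P (g n)) := by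
    intro n
    have := hμ (g n) _ (measurableSet_boundary (P := P) 0)
    rw [vadd_boundary, add_zero] at this
    rw [this]
    gcongr
    have h1 : |β * c (g n)| ≤ |β| := by
      rw [abs_mul]
      exact mul_le_of_le_one_right (abs_nonneg _) (y n).2.1.2.le
    exact (le_abs_self _).trans h1
  by_contra hne
  refine hfin (top_le_iff.1 ?_)
  rw [← ENNReal.tsum_const_eq_top_of_ne_zero (α := ℕ)
    (c := ENNReal.ofReal (Real.exp (-|β|)) * μ (boundary P 0))]
  · exact ENNReal.tsum_le_tsum hle
  · exact mul_ne_zero (by simpa using Real.exp_pos _) hne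

end Boundary

/-! ### Ergodic measures -/

section Ergodic

variable {G : Type u} [AddCommGroup G] [TopologicalSpace G] [IsTopologicalAddGroup G]
  {P : AddSubmonoid G} {a₀ : G} {c : G →+ ℝ} {β : ℝ} {μ : Measure (Yu P)}

theorem quasiMeasurePreserving_vadd (hμ : IsConformalMeasure c β μ) (s : G) :
    Measure.QuasiMeasurePreserving (fun A : Yu P => s +ᵥ A) μ μ := by
  refine ⟨measurable_vadd s, Measure.AbsolutelyContinuous.mk fun E hE h0 => ?_⟩
  rw [Measure.map_apply (measurable_vadd s) hE, preimage_vadd, hμ _ _ hE, h0, mul_zero]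

variable [LocallyCompactSpace G] [SecondCountableTopology G] [T2Space G]

/-- A function on `X_u` that is invariant almost everywhere under each translation by an element
of `P` is constant almost everywhere, for an ergodic conformal measure. Since `G` may be
uncountable, a strictly invariant set is produced from an almost invariant one by averaging
over Haar measure. -/
theorem exists_ae_eq_const_of_invariant (h : IsOrderUnit P a₀) [IsFiniteMeasureOnCompacts μ]
    (hμ : IsConformalMeasure c β μ) (herg : IsErgodicMeasure μ) {Z : Type*} [MeasurableSpace Z]
    [Nonempty Z] [MeasurableSpace.CountablySeparated Z] {f : Yu P → Z} (hf : Measurable f)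
    (hinv : ∀ a ∈ P, ∀ᵐ A ∂μ.restrict (Xu P), f (a +ᵥ A) = f A) :
    ∃ z, f =ᵐ[μ.restrict (Xu P)] fun _ => z := by
  refine Filter.exists_eventuallyEq_const_of_forall_separating MeasurableSet fun U hU => ?_
  let _ : MeasurableSpace G := borel G
  have : BorelSpace G := ⟨rfl⟩
  let m : Measure G := Measure.addHaar
  have := sigmaFinite_of_conformal h hμ
  have hvadd := measurable_vadd_prod (P := P) h.subset_closure
  let R : Set (G × Yu P) := {p | p.1 +ᵥ p.2 ∈ Xu P → f (p.1 +ᵥ p.2) ∈ U}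
  have hR : MeasurableSet R := by
    have : R = ((fun p : G × Yu P => p.1 +ᵥ p.2) ⁻¹' Xu P)ᶜ ∪
        (fun p : G × Yu P => p.1 +ᵥ p.2) ⁻¹' (f ⁻¹' U) := by
      ext p
      simp only [R, mem_ofPred_eq, mem_union, mem_compl_iff, mem_preimage]
      tauto
    rw [this]
    exact (hvadd measurableSet_Xu).compl.union (hvadd (hf hU))
  -- `E` is strictly invariant, because translation preserves the Haar null sets
  let E : Set (Yu P) := {A | ∀ᵐ s ∂m, s +ᵥ A ∈ Xu P → f (s +ᵥ A) ∈ U}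
  have hE : MeasurableSet E := by
    have : E = (fun A => m ((fun s => (s, A)) ⁻¹' Rᶜ)) ⁻¹' {0} := by
      ext A; rfl
    rw [this]
    exact (measurable_measure_prodMk_right hR.compl) (measurableSet_singleton 0)
  have hEvadd : ∀ (t : G) (A : Yu P), A ∈ E → t +ᵥ A ∈ E := by
    intro t A hA
    have h1 := (measurePreserving_add_right m t).quasiMeasurePreserving.ae hA
    filter_upwards [h1] with s hs
    rwa [vadd_vadd]
  have hEinv : ∀ t : G, t +ᵥ E = E := by
    intro t
    ext A
    rw [mem_vadd_set_iff_neg_vadd_mem]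
    exact ⟨fun hA => by simpa using hEvadd t _ hA, hEvadd (-t) A⟩
  have hinv' : ∀ a ∈ P, ∀ᵐ A ∂μ, A ∈ Xu P → f (a +ᵥ A) = f A := fun a ha =>
    (ae_restrict_iff' measurableSet_Xu).1 (hinv a ha)
  -- invariance under `P` extends to all `s ∈ G` by writing `s` as a difference
  have hs : ∀ s : G, ∀ᵐ A ∂μ, A ∈ Xu P → s +ᵥ A ∈ Xu P → (f (s +ᵥ A) ∈ U ↔ f A ∈ U) := by
    intro s
    obtain ⟨n, hn⟩ := h.exists_forall_ge (-s)
    have hb := h.nsmul_mem n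
    have ha : s + n • a₀ ∈ P := by
      have h1 := interior_subset (hn n le_rfl)
      rw [SetLike.mem_coe] at h1
      convert h1 using 1; abel
    filter_upwards [hinv' _ ha, (quasiMeasurePreserving_vadd hμ s).ae (hinv' _ hb)] with A h1 h2
      hA hsA
    have h3 := h2 hsA
    rw [vadd_vadd, add_comm, h1 hA] at h3
    rw [h3]
  have hae : ∀ᵐ A ∂μ, ∀ᵐ s ∂m, A ∈ Xu P → s +ᵥ A ∈ Xu P → (f (s +ᵥ A) ∈ U ↔ f A ∈ U) := by
    refine (Measure.ae_ae_comm ?_).1 (Filter.Eventually.of_forall hs)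
    have hX2 : MeasurableSet {p : G × Yu P | p.2 ∈ Xu P} := measurable_snd measurableSet_Xu
    have hX1 : MeasurableSet {p : G × Yu P | p.1 +ᵥ p.2 ∈ Xu P} := hvadd measurableSet_Xu
    have hU1 : MeasurableSet {p : G × Yu P | f (p.1 +ᵥ p.2) ∈ U} := hvadd (hf hU)
    have hU2 : MeasurableSet {p : G × Yu P | f p.2 ∈ U} := measurable_snd (hf hU)
    exact hX2.imp (hX1.imp (hU1.iff hU2))
  have key : ∀ᵐ A ∂μ.restrict (Xu P), (A ∈ E ↔ f A ∈ U) := by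
    rw [ae_restrict_iff' measurableSet_Xu]
    filter_upwards [hae] with A hA hAX
    constructor
    · intro hAE
      by_contra hfA
      -- `s + A` contains `0` for all `s` in the open set `Int P`, which is not Haar null
      have h0 : m (interior (P : Set G)) = 0 := by
        have : ∀ᵐ s ∂m, s ∉ interior (P : Set G) := by
          filter_upwards [hA, hAE] with s h1 h2 hs
          have hsX : s +ᵥ A ∈ Xu P := by
            change (0 : G) - s ∈ A.carrier
            exact A.sub_mem hAX (interior_subset hs)
          exact hfA ((h1 hAX hsX).1 (h2 hsX))
        simpa [ae_iff] using this
      exact (isOpen_interior.measure_pos m h.nonempty_interior).ne' h0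
    · intro hfA
      change ∀ᵐ s ∂m, _
      filter_upwards [hA] with s h1 h2
      exact (h1 hAX h2).2 hfA
  rcases herg E hE hEinv with h0 | h0
  · right
    have h1 : ∀ᵐ A ∂μ.restrict (Xu P), A ∉ E :=
      ae_restrict_of_ae (by simpa [ae_iff] using h0)
    filter_upwards [key, h1] with A h2 h3 h4
    exact h3 (h2.2 h4)
  · left
    have h1 : ∀ᵐ A ∂μ.restrict (Xu P), A ∈ E :=
      ae_restrict_of_ae (by rw [ae_iff]; exact h0)
    filter_upwards [key, h1] with A h2 h3
    exact h2.1 h3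

end Ergodic

/-! ### Multiplication operators on `L²` -/

section Multiplication

variable {α : Type*} {mα : MeasurableSpace α} {μ ν : Measure α}

/-- Multiplication by the indicator function of `E` on `L²(μ)`. -/
def mulIndicator {E : Set α} (hE : MeasurableSet E) (μ : Measure α) :
    Lp ℂ 2 μ →L[ℂ] Lp ℂ 2 μ :=
  LinearMap.mkContinuous
    { toFun := fun f => ((Lp.memLp f).indicator hE).toLp (E.indicator f)
      map_add' := fun f g => by
        rw [← MemLp.toLp_add, MemLp.toLp_eq_toLp_iff]
        filter_upwards [Lp.coeFn_add f g] with x hx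
        by_cases hxE : x ∈ E
        · simp only [indicator_of_mem hxE, hx, Pi.add_apply]
        · simp [hxE]
      map_smul' := fun z f => by
        rw [RingHom.id_apply, ← MemLp.toLp_const_smul, MemLp.toLp_eq_toLp_iff]
        filter_upwards [Lp.coeFn_smul z f] with x hx
        by_cases hxE : x ∈ E
        · simp only [indicator_of_mem hxE, hx, Pi.smul_apply]
        · simp [hxE] }
    1 fun f => by
      rw [one_mul, LinearMap.coe_mk, AddHom.coe_mk, Lp.norm_toLp, Lp.norm_def]
      exact ENNReal.toReal_mono (Lp.eLpNorm_ne_top f) (eLpNorm_indicator_le _)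

theorem coeFn_mulIndicator {E : Set α} (hE : MeasurableSet E) (f : Lp ℂ 2 μ) :
    mulIndicator hE μ f =ᵐ[μ] E.indicator f :=
  ((Lp.memLp f).indicator hE).coeFn_toLp

theorem mulIndicator_mulIndicator {E F : Set α} (hE : MeasurableSet E) (hF : MeasurableSet F)
    (f : Lp ℂ 2 μ) :
    mulIndicator hE μ (mulIndicator hF μ f) = mulIndicator (hE.inter hF) μ f := by
  refine Lp.ext ?_
  filter_upwards [coeFn_mulIndicator hE (mulIndicator hF μ f), coeFn_mulIndicator hF f,
    coeFn_mulIndicator (hE.inter hF) f] with x h1 h2 h3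
  rw [h1, h3, ← indicator_indicator]
  by_cases hx : x ∈ E <;> simp [hx, h2]

theorem mulIndicator_add_compl {E : Set α} (hE : MeasurableSet E) (f : Lp ℂ 2 μ) :
    mulIndicator hE μ f + mulIndicator hE.compl μ f = f := by
  refine Lp.ext ?_
  filter_upwards [coeFn_mulIndicator hE f, coeFn_mulIndicator hE.compl f,
    Lp.coeFn_add (mulIndicator hE μ f) (mulIndicator hE.compl μ f)] with x h1 h2 h3
  rw [h3, Pi.add_apply, h1, h2, indicator_self_add_compl_apply]

theorem mulIndicator_eq_zero_iff {E : Set α} (hE : MeasurableSet E) (f : Lp ℂ 2 μ) :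
    mulIndicator hE μ f = 0 ↔ ∀ᵐ x ∂μ, x ∈ E → f x = 0 := by
  rw [Lp.eq_zero_iff_ae_eq_zero]
  constructor
  · intro h
    filter_upwards [h, coeFn_mulIndicator hE f] with x h1 h2 hx
    rw [h2, indicator_of_mem hx] at h1
    exact h1
  · intro h
    filter_upwards [h, coeFn_mulIndicator hE f] with x h1 h2
    rw [h2]
    by_cases hx : x ∈ E
    · simpa [hx] using h1 hx
    · simp [hx]

theorem inner_mulIndicator {E : Set α} (hE : MeasurableSet E) (f g : Lp ℂ 2 μ) :
    inner ℂ (mulIndicator hE μ f) g = ∫ x in E, inner ℂ (f x) (g x) ∂μ := by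
  rw [L2.inner_def, ← integral_indicator hE]
  refine integral_congr_ae ?_
  filter_upwards [coeFn_mulIndicator hE f] with x h1
  rw [h1]
  by_cases hx : x ∈ E <;> simp [hx]

theorem inner_mulIndicator_comm {E : Set α} (hE : MeasurableSet E) (f g : Lp ℂ 2 μ) :
    inner ℂ (mulIndicator hE μ f) g = inner ℂ f (mulIndicator hE μ g) := by
  rw [inner_mulIndicator, ← inner_conj_symm f, inner_mulIndicator, ← integral_conj]
  simp_rw [inner_conj_symm]

theorem mulIndicator_congr {E F : Set α} (hE : MeasurableSet E) (hF : MeasurableSet F)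
    (hEF : E =ᵐ[μ] F) (f : Lp ℂ 2 μ) : mulIndicator hE μ f = mulIndicator hF μ f := by
  refine Lp.ext ?_
  filter_upwards [coeFn_mulIndicator hE f, coeFn_mulIndicator hF f,
    indicator_ae_eq_of_ae_eq_set (f := f) hEF] with x h1 h2 h3
  rw [h1, h2, h3]

/-- `T` intertwines the multiplications by the indicator function of `E`. Measurability of `E` is
a hypothesis inside the definition, so that only measurable sets are constrained. -/
def Intertwines (T : Lp ℂ 2 μ →L[ℂ] Lp ℂ 2 ν) (E : Set α) : Prop :=
  ∀ (hE : MeasurableSet E) (f : Lp ℂ 2 μ), T (mulIndicator hE μ f) = mulIndicator hE ν (T f)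

theorem Intertwines.adjoint {T : Lp ℂ 2 μ →L[ℂ] Lp ℂ 2 ν} {E : Set α} (h : Intertwines T E) :
    Intertwines (ContinuousLinearMap.adjoint T) E := by
  intro hE g
  refine ext_inner_right ℂ fun f => ?_
  rw [ContinuousLinearMap.adjoint_inner_left, inner_mulIndicator_comm, inner_mulIndicator_comm,
    ContinuousLinearMap.adjoint_inner_left, h]

theorem Intertwines.compl {T : Lp ℂ 2 μ →L[ℂ] Lp ℂ 2 ν} {E : Set α} (hE : MeasurableSet E)
    (h : Intertwines T E) : Intertwines T Eᶜ := by
  intro hEc f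
  have h1 := congrArg T (mulIndicator_add_compl hE f)
  rw [map_add, h hE] at h1
  have h2 := mulIndicator_add_compl hE (T f)
  exact add_left_cancel (h1.trans h2.symm)

theorem mulIndicator_iUnion_eq_zero {E : ℕ → Set α} (hE : ∀ n, MeasurableSet (E n))
    {f : Lp ℂ 2 μ} (h : ∀ n, mulIndicator (hE n) μ f = 0) :
    mulIndicator (MeasurableSet.iUnion hE) μ f = 0 := by
  rw [mulIndicator_eq_zero_iff]
  have := fun n => (mulIndicator_eq_zero_iff (hE n) f).1 (h n)
  filter_upwards [ae_all_iff.2 this] with x hx hxE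
  obtain ⟨n, hn⟩ := mem_iUnion.1 hxE
  exact hx n hn

theorem mulIndicator_mulIndicator_compl_eq_zero {E F : Set α} (hE : MeasurableSet E)
    (hF : MeasurableSet F) (hEF : E ⊆ F) (f : Lp ℂ 2 μ) :
    mulIndicator hE μ (mulIndicator hF.compl μ f) = 0 := by
  rw [mulIndicator_mulIndicator, mulIndicator_eq_zero_iff]
  exact Filter.Eventually.of_forall fun x hx => (hx.2 (hEF hx.1)).elim

/-- Both off-diagonal corners of `T` with respect to `⋃ E n` vanish: one because the union is
exhausted by the `E n`, the other by the same argument for the adjoint of `T`. -/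
theorem Intertwines.iUnion {T : Lp ℂ 2 μ →L[ℂ] Lp ℂ 2 ν} {E : ℕ → Set α}
    (hE : ∀ n, MeasurableSet (E n)) (h : ∀ n, Intertwines T (E n)) :
    Intertwines T (⋃ n, E n) := by
  intro hU f
  have off : ∀ {μ' ν' : Measure α} {S : Lp ℂ 2 μ' →L[ℂ] Lp ℂ 2 ν'},
      (∀ n, Intertwines S (E n)) →
      ∀ g, mulIndicator hU ν' (S (mulIndicator hU.compl μ' g)) = 0 := by
    intro μ' ν' S hS g
    refine mulIndicator_iUnion_eq_zero hE fun n => ?_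
    rw [← hS n (hE n), mulIndicator_mulIndicator_compl_eq_zero (hE n) hU (subset_iUnion E n),
      map_zero]
  have h1 := off h f
  have h2 : mulIndicator hU.compl ν (T (mulIndicator hU μ f)) = 0 := by
    refine ext_inner_left ℂ fun g => ?_
    rw [← inner_mulIndicator_comm, ← ContinuousLinearMap.adjoint_inner_left,
      ← inner_mulIndicator_comm, off fun n => (h n).adjoint, inner_zero_left, inner_zero_right]
  have h3 := mulIndicator_add_compl hU (T (mulIndicator hU μ f))
  have h4 := congrArg (fun g => mulIndicator hU ν (T g)) (mulIndicator_add_compl hU f)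
  simp only [map_add, h1, add_zero] at h4
  rw [h2, add_zero] at h3
  rw [← h3, h4]

theorem Intertwines.of_generateFrom {S : Set (Set α)} (hS : mα = MeasurableSpace.generateFrom S)
    {T : Lp ℂ 2 μ →L[ℂ] Lp ℂ 2 ν} (h : ∀ E ∈ S, Intertwines T E) {E : Set α}
    (hE : MeasurableSet E) : Intertwines T E := by
  have hE' : MeasurableSet[MeasurableSpace.generateFrom S] E := by rwa [← hS]
  induction E, hE' using MeasurableSpace.generateFrom_induction with
  | hC E hES _ => exact h E hES
  | empty =>
    intro h0 f
    have : ∀ {μ' : Measure α} (g : Lp ℂ 2 μ'), mulIndicator h0 μ' g = 0 := fun g => by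
      rw [mulIndicator_eq_zero_iff]
      exact Filter.Eventually.of_forall fun x hx => hx.elim
    rw [this, this, map_zero]
  | compl E hE' ih =>
    have : MeasurableSet E := by rwa [hS]
    exact (ih this).compl this
  | iUnion E hE' ih =>
    have : ∀ n, MeasurableSet (E n) := fun n => by rw [hS]; exact hE' n
    exact Intertwines.iUnion this fun n => ih n (this n)

/-- A σ-finite measure has an everywhere positive square integrable function. -/
theorem exists_pos_memLp_two [SigmaFinite μ] :
    ∃ w : α → ℝ, (∀ x, 0 < w x) ∧ Measurable w ∧ MemLp (fun x => (w x : ℂ)) 2 μ := by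
  obtain ⟨g, hg0, hgm, hg⟩ := exists_pos_lintegral_lt_of_sigmaFinite μ one_ne_zero
  refine ⟨fun x => Real.sqrt (g x), fun x => Real.sqrt_pos.2 (hg0 x),
    hgm.coe_nnreal_real.sqrt, ?_⟩
  have hm : Measurable fun x => (Real.sqrt (g x) : ℂ) :=
    Complex.measurable_ofReal.comp hgm.coe_nnreal_real.sqrt
  refine ⟨hm.aestronglyMeasurable, ?_⟩
  rw [eLpNorm_lt_top_iff_lintegral_rpow_enorm_lt_top two_ne_zero ENNReal.ofNat_ne_top]
  refine lt_of_eq_of_lt (lintegral_congr fun x => ?_) (hg.trans ENNReal.one_lt_top)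
  rw [← ofReal_norm, Complex.norm_real, Real.norm_of_nonneg (Real.sqrt_nonneg _),
    ENNReal.ofReal_rpow_of_nonneg (Real.sqrt_nonneg _) (by norm_num)]
  simp

/-- An operator on `L²` commuting with all multiplications by indicator functions is a
multiplication operator: its symbol is the quotient `T w / w` for any positive `w`. -/
theorem exists_mul_of_intertwines [SigmaFinite μ] {T : Lp ℂ 2 μ →L[ℂ] Lp ℂ 2 μ}
    (hT : ∀ E, MeasurableSet E → Intertwines T E) :
    ∃ k : α → ℂ, Measurable k ∧ ∀ f : Lp ℂ 2 μ, T f =ᵐ[μ] fun x => k x * f x := by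
  obtain ⟨w, hw0, hwm, hw⟩ := exists_pos_memLp_two (μ := μ)
  set W : Lp ℂ 2 μ := hw.toLp _
  have hW : W =ᵐ[μ] fun x => (w x : ℂ) := hw.coeFn_toLp
  have key : ∀ f : Lp ℂ 2 μ, (fun x => inner ℂ (W x) (T f x)) =ᵐ[μ]
      fun x => inner ℂ (ContinuousLinearMap.adjoint T W x) (f x) := by
    intro f
    refine Integrable.ae_eq_of_forall_setIntegral_eq _ _ (L2.integrable_inner _ _)
      (L2.integrable_inner _ _) fun E hE _ => ?_
    rw [← inner_mulIndicator hE, ← inner_mulIndicator hE, ← (hT E hE).adjoint hE,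
      ContinuousLinearMap.adjoint_inner_left]
  refine ⟨fun x => T W x / w x, ?_, fun f => ?_⟩
  · exact (Lp.stronglyMeasurable _).measurable.div (Complex.measurable_ofReal.comp hwm)
  · filter_upwards [hW, key f, key W] with x h1 h2 h3
    have h0 : (w x : ℂ) ≠ 0 := by exact_mod_cast (hw0 x).ne'
    simp only [h1, RCLike.inner_apply, Complex.conj_ofReal] at h2 h3
    have h4 := mul_right_cancel₀ h0 (h3.trans (mul_comm _ _))
    rw [← h4] at h2
    field_simp
    rw [h2, mul_comm]

end Multiplication

/-! ### The Koopman isometries and their adjoints -/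

section KoopmanAdjoint

variable {G : Type u} [AddCommGroup G] [TopologicalSpace G] [IsTopologicalAddGroup G]
  {P : AddSubmonoid G} {a₀ : G} {c : G →+ ℝ} {β : ℝ} {μ : Measure (Yu P)}

theorem map_vadd_restrict (hμ : IsConformalMeasure c β μ) {a : G} (ha : a ∈ P) :
    (μ.restrict (Xu P)).map (fun A => a +ᵥ A) =
      ENNReal.ofReal (Real.exp (β * c a)) • (μ.restrict (Xu P)).restrict (a +ᵥ Xu P) := by
  ext E hE
  have h1 : (-a +ᵥ E) ∩ Xu P = -a +ᵥ (E ∩ (a +ᵥ Xu P)) := by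
    rw [vadd_set_inter, vadd_vadd]; simp
  rw [Measure.map_apply (measurable_vadd a) hE, preimage_vadd, Measure.restrict_apply
    (measurableSet_vadd (-a) hE), h1, hμ _ _ (hE.inter (measurableSet_vadd a measurableSet_Xu)),
    Measure.smul_apply, Measure.restrict_apply hE,
    Measure.restrict_apply (hE.inter (measurableSet_vadd a measurableSet_Xu)), inter_assoc,
    inter_eq_left.2 (vadd_Xu_subset ha), smul_eq_mul, map_neg]
  simp

theorem quasiMeasurePreserving_vadd_restrict (hμ : IsConformalMeasure c β μ) {a : G}
    (ha : a ∈ P) : Measure.QuasiMeasurePreserving (fun A : Yu P => a +ᵥ A)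
      (μ.restrict (Xu P)) (μ.restrict (Xu P)) :=
  ⟨measurable_vadd a, by
    rw [map_vadd_restrict hμ ha]
    exact Measure.smul_absolutelyContinuous.trans Measure.restrict_le_self.absolutelyContinuous⟩

theorem memLp_comp_vadd (hμ : IsConformalMeasure c β μ) {a : G} (ha : a ∈ P) {f : Yu P → ℂ}
    (hf : MemLp f 2 (μ.restrict (Xu P))) :
    MemLp (fun A => (Real.exp (-(β * c a / 2)) : ℂ) * f (a +ᵥ A)) 2 (μ.restrict (Xu P)) := by
  refine MemLp.const_mul ?_ _
  refine MemLp.comp_of_map (f := fun A : Yu P => a +ᵥ A) ?_ (measurable_vadd a).aemeasurable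
  rw [map_vadd_restrict hμ ha]
  exact (hf.restrict _).smul_measure ENNReal.ofReal_ne_top

/-- The function `A ↦ e^{-β c(a)/2} f(A + a)`, as an element of `L²(X_u, μ)`. -/
def koopmanAdj (hμ : IsConformalMeasure c β μ) (a : P) (f : Lp ℂ 2 (μ.restrict (Xu P))) :
    Lp ℂ 2 (μ.restrict (Xu P)) :=
  (memLp_comp_vadd hμ a.2 (Lp.memLp f)).toLp _

theorem coeFn_koopmanAdj (hμ : IsConformalMeasure c β μ) (a : P)
    (f : Lp ℂ 2 (μ.restrict (Xu P))) :
    koopmanAdj hμ a f =ᵐ[μ.restrict (Xu P)]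
      fun A => (Real.exp (-(β * c a / 2)) : ℂ) * f ((a : G) +ᵥ A) :=
  (memLp_comp_vadd hμ a.2 (Lp.memLp f)).coeFn_toLp

theorem koopmanIsometry_koopmanAdj (hμ : IsConformalMeasure c β μ) (a : P)
    (f : Lp ℂ 2 (μ.restrict (Xu P))) :
    koopmanIsometry hμ a (koopmanAdj hμ a f) =
      mulIndicator (measurableSet_vadd (a : G) measurableSet_Xu) _ f := by
  refine Lp.ext ((coeFn_koopmanIsometry hμ a _).trans
    ((koopmanFun_congr hμ a.2 (coeFn_koopmanAdj hμ a f)).trans ?_))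
  filter_upwards [coeFn_mulIndicator (measurableSet_vadd (a : G) measurableSet_Xu) f] with A hA
  rw [hA, koopmanFun]
  by_cases hAX : A ∈ (a : G) +ᵥ Xu P
  · rw [indicator_of_mem hAX, indicator_of_mem hAX, vadd_neg_vadd, ← mul_assoc,
      ← Complex.ofReal_mul, ← Real.exp_add]
    simp
  · rw [indicator_of_notMem hAX, indicator_of_notMem hAX]

/-- The Koopman isometries carry multiplication by `1_E` to multiplication by `1_{E + a}`. -/
theorem mulIndicator_vadd_koopmanIsometry (hμ : IsConformalMeasure c β μ) (a : P)
    {E : Set (Yu P)} (hE : MeasurableSet E) (f : Lp ℂ 2 (μ.restrict (Xu P))) :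
    mulIndicator (measurableSet_vadd (a : G) hE) _ (koopmanIsometry hμ a f) =
      koopmanIsometry hμ a (mulIndicator hE _ f) := by
  refine Lp.ext ((coeFn_mulIndicator _ _).trans (Filter.EventuallyEq.trans ?_
    ((coeFn_koopmanIsometry hμ a _).trans
      (koopmanFun_congr hμ a.2 (coeFn_mulIndicator hE f))).symm))
  filter_upwards [coeFn_koopmanIsometry hμ a f] with A hA
  by_cases hAE : A ∈ (a : G) +ᵥ E
  · rw [indicator_of_mem hAE, hA, koopmanFun, koopmanFun]
    by_cases hAX : A ∈ (a : G) +ᵥ Xu P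
    · rw [indicator_of_mem hAX, indicator_of_mem hAX,
        indicator_of_mem (mem_vadd_set_iff_neg_vadd_mem.1 hAE)]
    · rw [indicator_of_notMem hAX, indicator_of_notMem hAX]
  · rw [indicator_of_notMem hAE, koopmanFun]
    by_cases hAX : A ∈ (a : G) +ᵥ Xu P
    · rw [indicator_of_mem hAX, indicator_of_notMem
        (fun h => hAE (mem_vadd_set_iff_neg_vadd_mem.2 h)), mul_zero]
    · rw [indicator_of_notMem hAX]

theorem mulIndicator_koopmanIsometry (hμ : IsConformalMeasure c β μ) (a : P)
    (f : Lp ℂ 2 (μ.restrict (Xu P))) :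
    mulIndicator (measurableSet_vadd (a : G) measurableSet_Xu) _ (koopmanIsometry hμ a f) =
      koopmanIsometry hμ a f := by
  rw [mulIndicator_vadd_koopmanIsometry hμ a measurableSet_Xu]
  congr 1
  refine Lp.ext ((coeFn_mulIndicator _ _).trans ?_)
  filter_upwards [ae_restrict_mem measurableSet_Xu] with A hA
  rw [indicator_of_mem hA]

theorem adjoint_koopmanIsometry (hμ : IsConformalMeasure c β μ) (a : P)
    (f : Lp ℂ 2 (μ.restrict (Xu P))) :
    ContinuousLinearMap.adjoint (koopmanIsometry hμ a).toContinuousLinearMap f =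
      koopmanAdj hμ a f := by
  refine ext_inner_left ℂ fun g => ?_
  rw [ContinuousLinearMap.adjoint_inner_right, ← (koopmanIsometry hμ a).inner_map_map g,
    koopmanIsometry_koopmanAdj, ← inner_mulIndicator_comm, mulIndicator_koopmanIsometry]
  rfl

end KoopmanAdjoint

section KoopmanRep

variable {G : Type u} [AddCommGroup G] [TopologicalSpace G] [IsTopologicalAddGroup G]
  {P : AddSubmonoid G} {a₀ : G} {c : G →+ ℝ} {β : ℝ}

variable (μ : ConformalRadonMeasure P c β)

instance : IsFiniteMeasureOnCompacts μ.1 := μ.2.2.1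

/-- The measure `μ` restricted to `X_u`. -/
abbrev ConformalRadonMeasure.res : Measure (Yu P) := μ.1.restrict (Xu P)

variable {μ}

/-- A vector of the Koopman representation, as an element of `L²(X_u, μ)`. This ascription lets
elaboration find the coercion to functions, which the field `H` hides. -/
abbrev koopmanVec (f : (koopmanRep μ).H) : Lp ℂ 2 μ.res := f

theorem koopmanRep_op (a : P) (f : Lp ℂ 2 μ.res) :
    (koopmanRep μ).op a f = koopmanIsometry μ.2.2.2 a f := rfl

theorem koopmanRep_opAdj (a : P) (f : Lp ℂ 2 μ.res) :
    (koopmanRep μ).opAdj a f = koopmanAdj μ.2.2.2 a f :=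
  adjoint_koopmanIsometry μ.2.2.2 a f

theorem koopmanRep_op_opAdj (a : P) (f : Lp ℂ 2 μ.res) :
    (koopmanRep μ).op a ((koopmanRep μ).opAdj a f) =
      mulIndicator (measurableSet_vadd (a : G) measurableSet_Xu) μ.res f := by
  rw [koopmanRep_opAdj]
  exact koopmanIsometry_koopmanAdj μ.2.2.2 a f

theorem koopmanRep_hasCommutingRangeProjections :
    (koopmanRep μ).HasCommutingRangeProjections := by
  intro a b
  refine ContinuousLinearMap.ext fun f => ?_
  change (koopmanRep μ).op a ((koopmanRep μ).opAdj a ((koopmanRep μ).op b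
    ((koopmanRep μ).opAdj b f))) = (koopmanRep μ).op b ((koopmanRep μ).opAdj b
      ((koopmanRep μ).op a ((koopmanRep μ).opAdj a f)))
  erw [koopmanRep_op_opAdj, koopmanRep_op_opAdj, koopmanRep_op_opAdj, koopmanRep_op_opAdj,
    mulIndicator_mulIndicator, mulIndicator_mulIndicator]
  exact mulIndicator_congr _ _ (Filter.EventuallyEq.of_eq (inter_comm _ _)) _

/-- A vector in the range of every `V_{n a₀}` is supported on sets containing all `n a₀`, and there
is no such set in `Y_u`. -/
theorem koopmanRep_isPure (h : IsOrderUnit P a₀) : (koopmanRep μ).IsPure := by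
  refine eq_singleton_iff_unique_mem.2 ⟨mem_iInter.2 fun a => ⟨0, map_zero _⟩, ?_⟩
  intro (f : Lp ℂ 2 μ.res) hf
  have h1 : ∀ n : ℕ, ∀ᵐ A ∂μ.res, A ∉ (n • a₀) +ᵥ Xu P → f A = 0 := by
    intro n
    obtain ⟨g, hg⟩ := mem_iInter.1 hf ⟨n • a₀, h.nsmul_mem n⟩
    have h2 := mulIndicator_koopmanIsometry μ.2.2.2 ⟨n • a₀, h.nsmul_mem n⟩ g
    have h3 := koopmanRep_op (μ := μ) ⟨n • a₀, h.nsmul_mem n⟩ g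
    rw [hg] at h3
    rw [← h3] at h2
    have h4 := coeFn_mulIndicator (measurableSet_vadd (n • a₀) (measurableSet_Xu (P := P))) f
    rw [h2] at h4
    filter_upwards [h4] with A hA hAX
    rw [hA, indicator_of_notMem hAX]
  change f = 0
  rw [Lp.eq_zero_iff_ae_eq_zero]
  filter_upwards [ae_all_iff.2 h1] with A hA
  have : A ∈ ⋃ n, bigSlab P a₀ n := by rw [iUnion_bigSlab h]; trivial
  obtain ⟨n, hn⟩ := mem_iUnion.1 this
  exact hA n fun h' => hn.2 (mem_vadd_Xu.1 h')

/-- An element of the domain `D_V` of the Koopman representation vanishes outside a slab. -/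
theorem koopmanRep_ae_eq_zero_of_opAdj {a : P} {f : Lp ℂ 2 μ.res}
    (hf : (koopmanRep μ).opAdj a f = 0) : ∀ᵐ A ∂μ.res, A ∈ (a : G) +ᵥ Xu P → f A = 0 := by
  rw [← mulIndicator_eq_zero_iff (measurableSet_vadd (a : G) measurableSet_Xu),
    ← koopmanRep_op_opAdj, hf]
  exact map_zero _

theorem slab_ne_top (h : IsOrderUnit P a₀) (a : G) : μ.res (slab P 0 a) ≠ ∞ :=
  ((Measure.restrict_apply_le _ _).trans_lt (measure_slab_zero_lt_top h a)).ne

theorem koopmanRep_integrable (h : IsOrderUnit P a₀) {a : P} {f : Lp ℂ 2 μ.res}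
    (hf : (koopmanRep μ).opAdj a f = 0) : Integrable f μ.res := by
  have h1 := integrableOn_Lp_of_measure_ne_top f fact_one_le_two_ennreal.elim
    (slab_ne_top (μ := μ) h (a : G))
  have h2 := (integrable_indicator_iff (measurableSet_slab (P := P) 0 (a : G))).2 h1
  refine h2.congr ?_
  filter_upwards [koopmanRep_ae_eq_zero_of_opAdj hf, ae_restrict_mem measurableSet_Xu] with A hA hAX
  by_cases hAs : A ∈ slab P 0 (a : G)
  · rw [indicator_of_mem hAs]
  · rw [indicator_of_notMem hAs, hA]
    rw [slab_zero, mem_sdiff, not_and_not_right] at hAs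
    exact hAs hAX

theorem koopmanRep_integral_eq (h : IsOrderUnit P a₀) {a : P} {f : Lp ℂ 2 μ.res}
    (hf : (koopmanRep μ).opAdj a f = 0) : ∫ A, f A ∂μ.res =
      inner ℂ (indicatorConstLp 2 (measurableSet_slab 0 (a : G)) (slab_ne_top (μ := μ) h (a : G))
        (1 : ℂ)) f := by
  rw [L2.inner_indicatorConstLp_one]
  refine (setIntegral_eq_integral_of_ae_compl_eq_zero ?_).symm
  filter_upwards [koopmanRep_ae_eq_zero_of_opAdj hf, ae_restrict_mem measurableSet_Xu] with A hA hAX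
    hAs
  rw [hA]
  rw [slab_zero, mem_sdiff, not_and_not_right] at hAs
  exact hAs hAX

theorem integral_koopmanIsometry (a : P) (f : Lp ℂ 2 μ.res) :
    ∫ A, koopmanIsometry μ.2.2.2 a f A ∂μ.res =
      (Real.exp (-(β * c a / 2)) : ℂ) * ∫ A, f A ∂μ.res := by
  have hf : AEStronglyMeasurable f ((μ.res.restrict ((a : G) +ᵥ Xu P)).map
      (fun A => -(a : G) +ᵥ A)) := by
    rw [map_restrict μ.2.2.2 a.2]
    exact (Lp.aestronglyMeasurable f).smul_measure _
  rw [integral_congr_ae (coeFn_koopmanIsometry μ.2.2.2 a f)]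
  unfold koopmanFun
  rw [integral_indicator (measurableSet_vadd (a : G) measurableSet_Xu), integral_const_mul,
    ← integral_map (measurable_vadd (-(a : G))).aemeasurable hf, map_restrict μ.2.2.2 a.2,
    integral_smul_measure, ENNReal.toReal_ofReal (Real.exp_pos _).le, Complex.real_smul,
    ← mul_assoc, ← Complex.ofReal_mul, ← Real.exp_add]
  congr 3
  ring_nf

/-- Integration over `X_u` is a conformal functional on the domain `D_V`. -/
theorem koopmanRep_isConformal (h : IsOrderUnit P a₀) (h1 : μ.1 (Xu P \ (a₀ +ᵥ Xu P)) = 1) :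
    (koopmanRep μ).IsConformal c β := by
  have hint : ∀ f : (koopmanRep μ).domain, Integrable (koopmanVec f.1) μ.res := by
    rintro ⟨f, hf⟩
    obtain ⟨a, ha⟩ := mem_iUnion.1 hf
    exact koopmanRep_integrable h ha
  let φ : (koopmanRep μ).domain →ₗ[ℂ] ℂ :=
    { toFun := fun f => ∫ A, (koopmanVec f.1) A ∂μ.res
      map_add' := fun f g => by
        rw [← integral_add (hint f) (hint g)]
        exact integral_congr_ae (Lp.coeFn_add (koopmanVec f.1) g.1)
      map_smul' := fun z f => by
        rw [RingHom.id_apply, ← integral_smul]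
        exact integral_congr_ae (Lp.coeFn_smul z (koopmanVec f.1)) }
  refine ⟨φ, ?_, ?_, ?_⟩
  · intro h0
    let f : Lp ℂ 2 μ.res := indicatorConstLp 2 (measurableSet_slab 0 a₀)
      (slab_ne_top (μ := μ) h a₀) (1 : ℂ)
    have hf : (koopmanRep μ).opAdj ⟨a₀, h.mem⟩ f = 0 := by
      refine ((koopmanRep μ).V ⟨a₀, h.mem⟩).injective ?_
      rw [map_zero]
      refine (koopmanRep_op_opAdj (μ := μ) ⟨a₀, h.mem⟩ f).trans ?_
      refine (mulIndicator_eq_zero_iff _ f).2 ?_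
      filter_upwards [indicatorConstLp_coeFn (p := 2) (hs := measurableSet_slab (P := P) 0 a₀)
        (hμs := slab_ne_top (μ := μ) h a₀) (c := (1 : ℂ))] with A hA hAX
      rw [hA, indicator_of_notMem fun hAs => hAs.2 (mem_vadd_Xu.1 hAX)]
    have h2 := DFunLike.congr_fun h0 ⟨f, mem_iUnion.2 ⟨⟨a₀, h.mem⟩, hf⟩⟩
    have h3 : ∫ A, f A ∂μ.res = 1 := by
      rw [koopmanRep_integral_eq h hf, L2.inner_indicatorConstLp_one_indicatorConstLp_one (𝕜 := ℂ)
        (measurableSet_slab 0 a₀) (measurableSet_slab 0 a₀) (slab_ne_top h a₀) (slab_ne_top h a₀),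
        inter_self, Measure.real, Measure.restrict_apply (measurableSet_slab _ _),
        inter_eq_left.2 (show slab P 0 a₀ ⊆ Xu P from fun A hA => hA.1), slab_zero, h1]
      simp
    exact one_ne_zero (h3.symm.trans h2)
  · intro a
    refine ⟨‖(indicatorConstLp 2 (measurableSet_slab 0 (a : G)) (slab_ne_top (μ := μ) h (a : G))
        (1 : ℂ) : Lp ℂ 2 μ.res)‖, fun f hf => ?_⟩
    change ‖∫ A, (koopmanVec f.1) A ∂μ.res‖ ≤ _
    rw [koopmanRep_integral_eq h hf]
    exact norm_inner_le_norm _ _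
  · intro a
    ext f
    exact integral_koopmanIsometry a f.1

end KoopmanRep

/-! ### Intertwiners of Koopman representations -/

section Intertwiner

variable {G : Type u} [AddCommGroup G] [TopologicalSpace G] [IsTopologicalAddGroup G]
  [LocallyCompactSpace G] [SecondCountableTopology G] [T2Space G]
  {P : AddSubmonoid G} {a₀ : G} {c : G →+ ℝ} {β : ℝ} {μ ν : ConformalRadonMeasure P c β}

theorem koopmanAdj_koopmanIsometry (a : P) (f : Lp ℂ 2 μ.res) :
    koopmanAdj μ.2.2.2 a (koopmanIsometry μ.2.2.2 a f) = f :=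
  (koopmanIsometry μ.2.2.2 a).injective <| by
    rw [koopmanIsometry_koopmanAdj, mulIndicator_koopmanIsometry]

/-- Multiplication by the indicator function of `{A | a - b ∈ A}` is the operator
`V_b^* V_a V_a^* V_b`. -/
theorem mulIndicator_cyl_sub (a b : P) (f : Lp ℂ 2 μ.res) :
    mulIndicator (measurableSet_cyl [(a : G) - b]) μ.res f =
      koopmanAdj μ.2.2.2 b (koopmanIsometry μ.2.2.2 a (koopmanAdj μ.2.2.2 a
        (koopmanIsometry μ.2.2.2 b f))) := by
  rw [koopmanIsometry_koopmanAdj, ← koopmanAdj_koopmanIsometry b (mulIndicator _ μ.res f),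
    ← mulIndicator_vadd_koopmanIsometry]
  congr 1
  have hs : (a : G) +ᵥ Xu P = (b : G) +ᵥ cyl P [(a : G) - b] := by
    rw [vadd_cyl, Xu_eq_cyl, vadd_cyl]
    simp
  exact mulIndicator_congr _ _ (Filter.EventuallyEq.of_eq hs.symm) _

/-- An operator intertwining two Koopman representations and their adjoints intertwines the
multiplications by all bounded Borel functions. -/
theorem intertwines_of_koopman (h : IsOrderUnit P a₀) {T : Lp ℂ 2 μ.res →L[ℂ] Lp ℂ 2 ν.res}
    (hV : ∀ a f, T (koopmanIsometry μ.2.2.2 a f) = koopmanIsometry ν.2.2.2 a (T f))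
    (hA : ∀ a f, T (koopmanAdj μ.2.2.2 a f) = koopmanAdj ν.2.2.2 a (T f))
    {E : Set (Yu P)} (hE : MeasurableSet E) : Intertwines T E := by
  obtain ⟨D, hDc, hD⟩ := exists_countable_dense G
  refine Intertwines.of_generateFrom (measurableSpace_eq_generateFrom h.subset_closure hD hDc)
    ?_ hE
  rintro _ ⟨g, -, rfl⟩ hg f
  obtain ⟨n, hn⟩ := h.exists_forall_ge (-g)
  have ha : g + n • a₀ ∈ P := by
    have h1 := interior_subset (hn n le_rfl)
    rw [SetLike.mem_coe] at h1
    convert h1 using 1; abel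
  have hga : g = ((⟨g + n • a₀, ha⟩ : P) : G) - ((⟨n • a₀, h.nsmul_mem n⟩ : P) : G) := by simp
  generalize (⟨g + n • a₀, ha⟩ : P) = a at hga
  generalize (⟨n • a₀, h.nsmul_mem n⟩ : P) = b at hga
  subst hga
  rw [mulIndicator_cyl_sub, mulIndicator_cyl_sub, hA, hV, hA, hV]

/-- An operator in the commutant is multiplication by a function `k`; commutation with `V_a^*` makes
`k` invariant under translation by `a`, and ergodicity makes it constant. -/
theorem koopmanRep_isIrreducible (h : IsOrderUnit P a₀) (herg : IsErgodicMeasure μ.1) :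
    (koopmanRep μ).IsIrreducible := by
  intro T₀ hT
  let T : Lp ℂ 2 μ.res →L[ℂ] Lp ℂ 2 μ.res := T₀
  have hV : ∀ a f, T (koopmanIsometry μ.2.2.2 a f) = koopmanIsometry μ.2.2.2 a (T f) :=
    fun a f => DFunLike.congr_fun (hT a).1 f
  have hA : ∀ a f, T (koopmanAdj μ.2.2.2 a f) = koopmanAdj μ.2.2.2 a (T f) := by
    intro a f
    have := DFunLike.congr_fun (hT a).2 f
    change T ((koopmanRep μ).opAdj a f) = (koopmanRep μ).opAdj a (T f) at this
    rwa [koopmanRep_opAdj, koopmanRep_opAdj] at this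
  have := sigmaFinite_of_conformal h μ.2.2.2
  obtain ⟨k, hkm, hk⟩ := exists_mul_of_intertwines fun E hE => intertwines_of_koopman h hV hA hE
  obtain ⟨w, hw0, -, hw⟩ := exists_pos_memLp_two (μ := μ.res)
  have hinv : ∀ a ∈ P, ∀ᵐ A ∂μ.1.restrict (Xu P), k (a +ᵥ A) = k A := by
    intro a ha
    set W : Lp ℂ 2 μ.res := hw.toLp _
    have hW : W =ᵐ[μ.res] fun x => (w x : ℂ) := hw.coeFn_toLp
    have h1 := coeFn_koopmanAdj μ.2.2.2 ⟨a, ha⟩ (T W)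
    rw [← hA] at h1
    have hq := quasiMeasurePreserving_vadd_restrict μ.2.2.2 ha
    filter_upwards [h1, hk (koopmanAdj μ.2.2.2 ⟨a, ha⟩ W), coeFn_koopmanAdj μ.2.2.2 ⟨a, ha⟩ W,
      hq.ae (hk W), hq.ae hW] with A h1 h2 h3 h4 h5
    rw [h2, h3, h4, h5] at h1
    have e0 : (Real.exp (-(β * c a / 2)) : ℂ) ≠ 0 := by exact_mod_cast (Real.exp_pos _).ne'
    have w0 : (w (a +ᵥ A) : ℂ) ≠ 0 := by exact_mod_cast (hw0 _).ne'
    have h6 : k A * ((Real.exp (-(β * c a / 2)) : ℂ) * w (a +ᵥ A)) =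
        k (a +ᵥ A) * ((Real.exp (-(β * c a / 2)) : ℂ) * w (a +ᵥ A)) := by
      rw [h1]; ring
    exact (mul_right_cancel₀ (mul_ne_zero e0 w0) h6).symm
  obtain ⟨z, hz⟩ := exists_ae_eq_const_of_invariant h μ.2.2.2 herg hkm hinv
  refine ⟨z, ContinuousLinearMap.ext fun f => ?_⟩
  refine Lp.ext (p := 2) (μ := μ.res) (f := T f) (g := z • koopmanVec f) ?_
  filter_upwards [hk f, hz, Lp.coeFn_smul z (koopmanVec f)] with A h1 h2 h3
  rw [h1, h2, h3]; rfl

/-- A unitary matching the multiplications by indicator functions on two `L²` spaces respects null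
sets, since a set is null if and only if its indicator function multiplies by zero. -/
theorem absolutelyContinuous_of_intertwines {α : Type*} [MeasurableSpace α] {μ ν : Measure α}
    [SigmaFinite ν] (U : Lp ℂ 2 μ ≃ₗᵢ[ℂ] Lp ℂ 2 ν)
    (hU : ∀ E, MeasurableSet E →
      Intertwines (U.toContinuousLinearEquiv : Lp ℂ 2 μ →L[ℂ] Lp ℂ 2 ν) E) : ν ≪ μ := by
  refine Measure.AbsolutelyContinuous.mk fun E hE h0 => ?_
  obtain ⟨w, hw0, -, hw⟩ := exists_pos_memLp_two (μ := ν)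
  obtain ⟨f, hf⟩ := U.surjective (hw.toLp _)
  have h1 : mulIndicator hE μ f = 0 := by
    rw [mulIndicator_eq_zero_iff]
    have : ∀ᵐ x ∂μ, x ∉ E := by simpa [ae_iff] using h0
    filter_upwards [this] with x hx hxE using absurd hxE hx
  have h2 := hU E hE hE f
  rw [h1, map_zero] at h2
  change 0 = mulIndicator hE ν (U f) at h2
  rw [hf] at h2
  have h3 := (mulIndicator_eq_zero_iff hE _).1 h2.symm
  have h4 : ∀ᵐ x ∂ν, x ∉ E := by
    filter_upwards [h3, hw.coeFn_toLp] with x h5 h6 hx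
    have h7 := h5 hx
    rw [h6] at h7
    exact (hw0 x).ne' (by exact_mod_cast h7)
  simpa [ae_iff] using h4

/-- The Radon–Nikodym derivative of a conformal measure with respect to an ergodic one of the
same exponent is invariant, hence constant. -/
theorem exists_eq_smul_of_absolutelyContinuous (h : IsOrderUnit P a₀)
    (herg : IsErgodicMeasure μ.1) (hac : ν.res ≪ μ.res) : ∃ z : ℝ≥0∞, ν.res = z • μ.res := by
  have := sigmaFinite_of_conformal h μ.2.2.2
  have := sigmaFinite_of_conformal h ν.2.2.2
  set k := ν.res.rnDeriv μ.res
  have hkm : Measurable k := Measure.measurable_rnDeriv _ _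
  have hk : μ.res.withDensity k = ν.res := Measure.withDensity_rnDeriv_eq _ _ hac
  have hinv : ∀ a ∈ P, ∀ᵐ A ∂μ.1.restrict (Xu P), k (a +ᵥ A) = k A := by
    intro a ha
    refine ae_eq_of_forall_setLIntegral_eq_of_sigmaFinite (hkm.comp (measurable_vadd a)) hkm
      fun E hE _ => ?_
    have hE' := measurableSet_vadd a (hE.inter (measurableSet_Xu (P := P)))
    have hsub : a +ᵥ (E ∩ Xu P) ⊆ a +ᵥ Xu P := vadd_set_mono inter_subset_right
    have hX : ∀ (m : Measure (Yu P)) (f : Yu P → ℝ≥0∞), ∫⁻ A in E, f A ∂m.restrict (Xu P) =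
        ∫⁻ A in E ∩ Xu P, f A ∂m.restrict (Xu P) := by
      intro m f
      rw [Measure.restrict_restrict hE, Measure.restrict_restrict (hE.inter measurableSet_Xu),
        inter_assoc, inter_self]
    -- `∫_{E + a} k dμ = ν(E + a) = e^{-βc(a)} ν(E)`, and a change of variables on the left
    have h1 : ν.res (a +ᵥ (E ∩ Xu P)) =
        ENNReal.ofReal (Real.exp (-(β * c a))) * ν.res (E ∩ Xu P) := by
      rw [Measure.restrict_apply hE', inter_eq_left.2 (hsub.trans (vadd_Xu_subset ha)),
        ν.2.2.2 _ _ (hE.inter measurableSet_Xu), Measure.restrict_apply (hE.inter measurableSet_Xu),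
        inter_assoc, inter_self]
    have h2 : ∫⁻ A in E ∩ Xu P, k (a +ᵥ A) ∂μ.res =
        ENNReal.ofReal (Real.exp (β * c a)) * ν.res (a +ᵥ (E ∩ Xu P)) := by
      rw [← hk, withDensity_apply _ hE', ← lintegral_indicator hE',
        ← lintegral_indicator (hE.inter measurableSet_Xu), ← smul_eq_mul]
      have h3 : ∀ A, (E ∩ Xu P).indicator (fun A => k (a +ᵥ A)) A =
          (a +ᵥ (E ∩ Xu P)).indicator k (a +ᵥ A) := by
        intro A
        by_cases hA : A ∈ E ∩ Xu P
        · rw [indicator_of_mem hA, indicator_of_mem (vadd_mem_vadd_set_iff.2 hA)]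
        · rw [indicator_of_notMem hA,
            indicator_of_notMem fun hA' => hA (vadd_mem_vadd_set_iff.1 hA')]
      simp_rw [h3]
      rw [← lintegral_map (f := (a +ᵥ (E ∩ Xu P)).indicator k) (hkm.indicator hE')
        (measurable_vadd a), map_vadd_restrict μ.2.2.2 ha, lintegral_smul_measure,
        lintegral_indicator hE', lintegral_indicator hE', Measure.restrict_restrict hE',
        inter_eq_left.2 hsub]
    rw [hX, hX]
    change ∫⁻ A in E ∩ Xu P, k (a +ᵥ A) ∂μ.res = ∫⁻ A in E ∩ Xu P, k A ∂μ.res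
    rw [h2, h1, ← mul_assoc, ← ENNReal.ofReal_mul (Real.exp_pos _).le, ← Real.exp_add]
    simp only [add_neg_cancel, Real.exp_zero, ENNReal.ofReal_one, one_mul]
    rw [← hk, withDensity_apply _ (hE.inter measurableSet_Xu)]
  obtain ⟨z, hz⟩ := exists_ae_eq_const_of_invariant h μ.2.2.2 herg hkm hinv
  exact ⟨z, by rw [← hk, withDensity_congr_ae hz, withDensity_const]⟩

/-- Unitarily equivalent Koopman representations come from proportional measures, and the
normalization fixes the factor. -/
theorem koopmanRep_injOn (h : IsOrderUnit P a₀) :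
    Set.InjOn (fun μ : ConformalRadonMeasure P c β =>
      Quotient.mk (IsometrySemigroup.unitaryEquiv P) (koopmanRep μ))
      (normalizedErgodic c β a₀) := by
  intro μ hμ ν hν hμν
  obtain ⟨U₀, hU₀⟩ : (IsometrySemigroup.unitaryEquiv P).r (koopmanRep μ) (koopmanRep ν) :=
    Quotient.exact hμν
  let U : Lp ℂ 2 μ.res ≃ₗᵢ[ℂ] Lp ℂ 2 ν.res := U₀
  have hV : ∀ a f, U (koopmanIsometry μ.2.2.2 a f) = koopmanIsometry ν.2.2.2 a (U f) := hU₀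
  have hA : ∀ a f, U (koopmanAdj μ.2.2.2 a f) = koopmanAdj ν.2.2.2 a (U f) := by
    intro a f
    refine ext_inner_left ℂ fun g => ?_
    obtain ⟨g, rfl⟩ := U.surjective g
    rw [U.inner_map_map, ← adjoint_koopmanIsometry, ← adjoint_koopmanIsometry,
      ContinuousLinearMap.adjoint_inner_right, ContinuousLinearMap.adjoint_inner_right]
    change _ = inner ℂ (koopmanIsometry ν.2.2.2 a (U g)) (U f)
    rw [← hV, U.inner_map_map]; rfl
  have := sigmaFinite_of_conformal h ν.2.2.2
  have hac : ν.res ≪ μ.res := absolutelyContinuous_of_intertwines U fun E hE =>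
    intertwines_of_koopman h hV hA hE
  obtain ⟨z, hz⟩ := exists_eq_smul_of_absolutelyContinuous h hμ.1 hac
  have hn : ∀ ρ : ConformalRadonMeasure P c β, ρ.1 (Xu P \ (a₀ +ᵥ Xu P)) = 1 →
      ρ.res (slab P 0 a₀) = 1 := by
    intro ρ hρ
    rw [Measure.restrict_apply (measurableSet_slab _ _),
      inter_eq_left.2 (show slab P 0 a₀ ⊆ Xu P from fun A hA => hA.1), slab_zero, hρ]
  have hz1 : z = 1 := by
    have := hn ν hν.2
    rwa [hz, Measure.smul_apply, hn μ hμ.2, smul_eq_mul, mul_one] at this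
  rw [hz1, one_smul] at hz
  exact Subtype.ext (conformal_ext h μ.2.2.2 ν.2.2.2 hz.symm)

theorem koopmanRep_separableSpace (h : IsOrderUnit P a₀) : SeparableSpace (koopmanRep μ).H := by
  have := sigmaFinite_of_conformal h μ.2.2.2
  have : Fact ((2 : ℝ≥0∞) ≠ ∞) := ⟨ENNReal.ofNat_ne_top⟩
  change SeparableSpace (Lp ℂ 2 μ.res)
  infer_instance

end Intertwiner

/-! ### Cylinder functions -/

section Cylinder

variable {G : Type u} [AddCommGroup G] [TopologicalSpace G] [IsTopologicalAddGroup G]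
  {P : AddSubmonoid G} {a₀ : G} {c : G →+ ℝ} {β : ℝ} {μ : ConformalRadonMeasure P c β}

theorem measurableSet_cyl_diff (L : List G) (t : G) : MeasurableSet (cyl P L \ cyl P [t]) :=
  (measurableSet_cyl L).diff (measurableSet_cyl [t])

theorem res_cyl_diff_ne_top (h : IsOrderUnit P a₀) (L : List G) (t : G) :
    μ.res (cyl P L \ cyl P [t]) ≠ ∞ := by
  rw [Measure.restrict_apply (measurableSet_cyl_diff L t)]
  refine ((measure_mono ?_).trans_lt (measure_slab_zero_lt_top h t)).ne
  exact fun A hA => ⟨hA.2, fun ht => hA.1.2 (mem_cyl_singleton.2 ht)⟩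

/-- The indicator function of `{A ∈ X_u | L ⊆ A, t ∉ A}` as an element of `L²(X_u, μ)`. -/
def cylVec (h : IsOrderUnit P a₀) (μ : ConformalRadonMeasure P c β) (L : List G) (t : G) :
    Lp ℂ 2 μ.res :=
  indicatorConstLp 2 (measurableSet_cyl_diff L t) (res_cyl_diff_ne_top h L t) (1 : ℂ)

theorem inner_cylVec (h : IsOrderUnit P a₀) (L L' : List G) (t t' : G) :
    inner ℂ (cylVec h μ L t) (cylVec h μ L' t') =
      (μ.res.real ((cyl P L \ cyl P [t]) ∩ (cyl P L' \ cyl P [t'])) : ℂ) :=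
  L2.inner_indicatorConstLp_one_indicatorConstLp_one (𝕜 := ℂ) (measurableSet_cyl_diff L t)
    (measurableSet_cyl_diff L' t') (res_cyl_diff_ne_top h L t) (res_cyl_diff_ne_top h L' t')

theorem koopmanIsometry_cylVec (h : IsOrderUnit P a₀) (a : P) (L : List G) (t : G) :
    koopmanIsometry μ.2.2.2 a (cylVec h μ L t) =
      (Real.exp (β * c a / 2) : ℂ) • cylVec h μ (a :: L.map ((a : G) + ·)) (a + t) := by
  refine Lp.ext ((coeFn_koopmanIsometry μ.2.2.2 a _).trans
    ((koopmanFun_congr μ.2.2.2 a.2 indicatorConstLp_coeFn).trans ?_))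
  filter_upwards [Lp.coeFn_smul (Real.exp (β * c a / 2) : ℂ)
    (cylVec h μ (a :: L.map ((a : G) + ·)) (a + t)), indicatorConstLp_coeFn (p := 2)
    (hs := measurableSet_cyl_diff (P := P) (a :: L.map ((a : G) + ·)) (a + t))
    (hμs := res_cyl_diff_ne_top (μ := μ) h _ _) (c := (1 : ℂ))] with A h1 h2
  rw [h1, Pi.smul_apply]
  erw [h2]
  have h3 : cyl P (a :: L.map ((a : G) + ·)) \ cyl P [(a : G) + t] =
      ((a : G) +ᵥ Xu P) ∩ ((a : G) +ᵥ (cyl P L \ cyl P [t])) := by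
    rw [vadd_set_sdiff, vadd_cyl, vadd_cyl, Xu_eq_cyl, vadd_cyl, cyl_cons, inter_sdiff_assoc]
    simp
  rw [h3, koopmanFun, smul_eq_mul]
  by_cases hA : A ∈ (a : G) +ᵥ Xu P
  · rw [indicator_of_mem hA]
    by_cases hA' : A ∈ (a : G) +ᵥ (cyl P L \ cyl P [t])
    · rw [indicator_of_mem (mem_inter hA hA'),
        indicator_of_mem (mem_vadd_set_iff_neg_vadd_mem.1 hA')]
    · have h5 : A ∉ ((a : G) +ᵥ Xu P) ∩ ((a : G) +ᵥ (cyl P L \ cyl P [t])) := fun hx => hA' hx.2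
      rw [indicator_of_notMem h5,
        indicator_of_notMem (mt mem_vadd_set_iff_neg_vadd_mem.2 hA')]
  · rw [indicator_of_notMem hA, indicator_of_notMem (mt (fun hx => hx.1) hA), mul_zero]

variable [LocallyCompactSpace G] [SecondCountableTopology G] [T2Space G]

/-- The cylinder functions are total in `L²(X_u, μ)`. -/
theorem topologicalClosure_span_cylVec (h : IsOrderUnit P a₀) :
    (Submodule.span ℂ (range fun p : List G × P => cylVec h μ p.1 p.2)).topologicalClosure = ⊤ := by
  rw [Submodule.topologicalClosure_eq_top_iff, Submodule.eq_bot_iff]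
  intro f hf
  have horth : ∀ (L : List G) (n : ℕ), ∫ A in cyl P L \ cyl P [n • a₀], f A ∂μ.res = 0 := by
    intro L n
    have := (Submodule.mem_orthogonal _ f).1 hf (cylVec h μ L (n • a₀))
      (Submodule.subset_span ⟨(L, ⟨n • a₀, h.nsmul_mem n⟩), rfl⟩)
    rwa [cylVec, L2.inner_indicatorConstLp_one] at this
  have hn : ∀ n : ℕ, ∀ᵐ A ∂μ.res, A ∈ (cyl P [n • a₀])ᶜ → f A = 0 := by
    intro n
    have hS : MeasurableSet (cyl P [n • a₀])ᶜ := (measurableSet_cyl _).compl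
    have hint : IntegrableOn f (cyl P [n • a₀])ᶜ μ.res := by
      have h1 := res_cyl_diff_ne_top (μ := μ) h [] (n • a₀)
      rw [cyl_nil, ← compl_eq_univ_sdiff] at h1
      exact integrableOn_Lp_of_measure_ne_top f fact_one_le_two_ennreal.elim h1
    rw [← ae_restrict_iff' hS]
    refine Integrable.ae_eq_zero_of_forall_setIntegral_eq_zero hint fun E hE hfin => ?_
    clear hfin
    induction E, hE using MeasurableSpace.induction_on_inter
      (generateFrom_cyl h.subset_closure) isPiSystem_range_cyl with
    | empty => simp
    | basic E hE =>
      obtain ⟨L, rfl⟩ := hE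
      rw [Measure.restrict_restrict (measurableSet_cyl L)]
      exact horth L n
    | compl E hE ih =>
      have h2 := integral_add_compl hE hint
      have h3 := horth [] n
      rw [cyl_nil, ← compl_eq_univ_sdiff] at h3
      rwa [ih, zero_add, h3] at h2
    | iUnion E hd hE ih =>
      rw [integral_iUnion hE hd hint.integrableOn]
      simp [ih]
  rw [Lp.eq_zero_iff_ae_eq_zero]
  filter_upwards [ae_all_iff.2 hn] with A hA
  have : A ∈ ⋃ n, bigSlab P a₀ n := by rw [iUnion_bigSlab h]; trivial
  obtain ⟨n, hn⟩ := mem_iUnion.1 this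
  exact hA n fun h' => hn.2 (mem_cyl_singleton.1 h')

end Cylinder

/-! ### Strong continuity of the Koopman representation -/

section Continuity

variable {G : Type u} [AddCommGroup G] [TopologicalSpace G] [IsTopologicalAddGroup G]
  [LocallyCompactSpace G] [SecondCountableTopology G] [T2Space G]
  {P : AddSubmonoid G} {a₀ : G} {c : G →+ ℝ} {β : ℝ} {μ : ConformalRadonMeasure P c β}

/-- The translates of a cylinder set depend continuously, in measure, on the translation: outside
the null set of those `A` that have one of the relevant points in their frontier, membership is
locally constant. -/
theorem tendsto_measure_cyl_inter (h : IsOrderUnit P a₀) (hc : Continuous c) (L : List G) (t : G)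
    (a : P) :
    Filter.Tendsto (fun b : P => μ.res.real
      ((cyl P (b :: L.map ((b : G) + ·)) \ cyl P [(b : G) + t]) ∩
        (cyl P (a :: L.map ((a : G) + ·)) \ cyl P [(a : G) + t]))) (nhds a)
      (nhds (μ.res.real ((cyl P (a :: L.map ((a : G) + ·)) \ cyl P [(a : G) + t]) ∩
        (cyl P (a :: L.map ((a : G) + ·)) \ cyl P [(a : G) + t])))) := by
  have : SecondCountableTopology P :=
    TopologicalSpace.Subtype.secondCountableTopology (P : Set G)
  have hb : ∀ g, ∀ᵐ A ∂μ.res, A ∉ boundary P g := fun g => by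
    refine ae_restrict_of_ae ?_
    simpa [ae_iff] using measure_boundary h hc μ.2.2.2 g
  have hev : ∀ {A : Yu P} {g : G}, A ∉ boundary P ((a : G) + g) →
      ∀ᶠ b : P in nhds a, ((b : G) + g ∈ A.carrier ↔ (a : G) + g ∈ A.carrier) := fun hA =>
    Filter.Tendsto.eventually
      ((continuous_subtype_val.add continuous_const).tendsto a) (eventually_mem_iff hA)
  refine (ENNReal.tendsto_toReal ?_).comp (tendsto_measure_of_ae_tendsto_indicator (nhds a)
    ((measurableSet_cyl_diff _ _).inter (measurableSet_cyl_diff _ _))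
    (fun b => (measurableSet_cyl_diff _ _).inter (measurableSet_cyl_diff _ _))
    (measurableSet_cyl_diff ((a : G) :: L.map ((a : G) + ·)) ((a : G) + t))
    (res_cyl_diff_ne_top h _ _) (Filter.Eventually.of_forall fun b => inter_subset_right) ?_)
  · rw [inter_self]
    exact res_cyl_diff_ne_top h _ _
  · have hL : ∀ᵐ A ∂μ.res, ∀ g ∈ {g | g ∈ L}, A ∉ boundary P ((a : G) + g) :=
      (ae_ball_iff L.finite_toSet.countable).2 fun g _ => hb _
    filter_upwards [hb ((a : G) + 0), hb ((a : G) + t), hL] with A h0 ht hL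
    have hL' : ∀ᶠ b : P in nhds a, ∀ g ∈ {g | g ∈ L},
        ((b : G) + g ∈ A.carrier ↔ (a : G) + g ∈ A.carrier) :=
      (Filter.eventually_all_finite L.finite_toSet).2 fun g hg => hev (hL g hg)
    filter_upwards [hev h0, hev ht, hL'] with b h1 h2 h3
    rw [add_zero, add_zero] at h1
    have h4 : A ∈ cyl P (b :: L.map ((b : G) + ·)) \ cyl P [(b : G) + t] ↔
        A ∈ cyl P (a :: L.map ((a : G) + ·)) \ cyl P [(a : G) + t] := by
      rw [mem_sdiff, mem_sdiff, mem_cyl_singleton, mem_cyl_singleton, h2, mem_cyl_cons,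
        mem_cyl_cons, h1]
      refine and_congr_left' (and_congr_right' ?_)
      simp only [mem_cyl, List.mem_map, forall_exists_index, and_imp, forall_apply_eq_imp_iff₂]
      exact forall₂_congr h3
    rw [mem_inter_iff, mem_inter_iff, h4]

theorem continuous_koopmanIsometry_cylVec (h : IsOrderUnit P a₀) (hc : Continuous c) (L : List G)
    (t : G) : Continuous fun a : P => koopmanIsometry μ.2.2.2 a (cylVec h μ L t) := by
  rw [continuous_iff_continuousAt]
  intro a
  set V := fun a : P => koopmanIsometry μ.2.2.2 a (cylVec h μ L t) with hV
  have hinner : ∀ b, inner ℂ (V b) (V a) =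
      ((Real.exp (β * c b / 2) * Real.exp (β * c a / 2) * μ.res.real
      ((cyl P (b :: L.map ((b : G) + ·)) \ cyl P [(b : G) + t]) ∩
        (cyl P (a :: L.map ((a : G) + ·)) \ cyl P [(a : G) + t])) : ℝ) : ℂ) := by
    intro b
    simp only [hV]
    rw [koopmanIsometry_cylVec, koopmanIsometry_cylVec, inner_smul_left, inner_smul_right,
      inner_cylVec, Complex.conj_ofReal]
    push_cast
    ring
  have hlim : Filter.Tendsto (fun b => RCLike.re (inner ℂ (V b) (V a))) (nhds a)
      (nhds (‖V a‖ ^ 2)) := by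
    rw [← inner_self_eq_norm_sq (𝕜 := ℂ)]
    simp only [hinner, RCLike.re_to_complex, Complex.ofReal_re]
    refine Filter.Tendsto.mul (Filter.Tendsto.mul ?_ tendsto_const_nhds)
      (tendsto_measure_cyl_inter h hc L t a)
    have : Continuous fun b : P => Real.exp (β * c b / 2) := by
      have := hc.comp (continuous_subtype_val (p := fun x => x ∈ P))
      exact Real.continuous_exp.comp ((continuous_const.mul this).div_const 2)
    exact this.tendsto a
  -- all `V b` have the same norm, so continuity of the inner products suffices
  have hnorm : ∀ b, ‖V b - V a‖ ^ 2 = 2 * (‖V a‖ ^ 2 - RCLike.re (inner ℂ (V b) (V a))) := by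
    intro b
    have h1 : ‖V b‖ = ‖V a‖ := by simp [hV]
    rw [norm_sub_sq (𝕜 := ℂ), h1]; ring
  have h2 : Filter.Tendsto (fun b => ‖V b - V a‖ ^ 2) (nhds a) (nhds 0) := by
    simp_rw [hnorm]
    have := (hlim.const_sub (‖V a‖ ^ 2)).const_mul 2
    rwa [sub_self, mul_zero] at this
  refine tendsto_iff_norm_sub_tendsto_zero.2 ?_
  have h3 := h2.sqrt
  simpa [Real.sqrt_sq (norm_nonneg _)] using h3

theorem koopmanRep_isStronglyContinuous (h : IsOrderUnit P a₀) (hc : Continuous c) :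
    (koopmanRep μ).IsStronglyContinuous := by
  intro f
  change Continuous fun a : P => koopmanIsometry μ.2.2.2 a (koopmanVec f)
  have hspan : ∀ g ∈ Submodule.span ℂ (range fun p : List G × P => cylVec h μ p.1 p.2),
      Continuous fun a : P => koopmanIsometry μ.2.2.2 a g := by
    intro g hg
    induction hg using Submodule.span_induction with
    | mem g hg =>
      obtain ⟨p, rfl⟩ := hg
      exact continuous_koopmanIsometry_cylVec h hc p.1 p.2
    | zero => simpa using continuous_const
    | add g g' _ _ h1 h2 => simp only [map_add]; exact h1.add h2
    | smul z g _ h1 => simp only [map_smul]; exact h1.const_smul z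
  refine Metric.continuous_iff'.2 fun a ε hε => ?_
  have hf : koopmanVec f ∈ closure (Submodule.span ℂ
      (range fun p : List G × P => cylVec h μ p.1 p.2) : Set (Lp ℂ 2 μ.res)) := by
    rw [← Submodule.topologicalClosure_coe, topologicalClosure_span_cylVec]; trivial
  obtain ⟨g, hg, hfg⟩ := Metric.mem_closure_iff.1 hf (ε / 3) (by positivity)
  filter_upwards [Metric.continuous_iff'.1 (hspan g hg) a (ε / 3) (by positivity)] with b hb
  have h1 : ∀ x : P, dist (koopmanIsometry μ.2.2.2 x (koopmanVec f))
      (koopmanIsometry μ.2.2.2 x g) < ε / 3 := fun x => by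
    rwa [(koopmanIsometry μ.2.2.2 x).isometry.dist_eq]
  have h2 := dist_triangle4 (koopmanIsometry μ.2.2.2 b (koopmanVec f))
    (koopmanIsometry μ.2.2.2 b g) (koopmanIsometry μ.2.2.2 a g)
    (koopmanIsometry μ.2.2.2 a (koopmanVec f))
  have h3 := h1 a
  rw [dist_comm] at h3
  linarith [h1 b]

end Continuity

/-! ### Projections in a Hilbert space -/

section HilbertProjections

variable {H : Type*} [NormedAddCommGroup H] [InnerProductSpace ℂ H] [CompleteSpace H]

theorem inner_apply_of_star_eq {Q : H →L[ℂ] H} (hQ : star Q = Q) (ξ ζ : H) :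
    inner ℂ (Q ξ) ζ = inner ℂ ξ (Q ζ) := by
  conv_lhs => rw [← hQ]
  exact ContinuousLinearMap.adjoint_inner_left Q ζ ξ

theorem inner_apply_self_of_proj {Q : H →L[ℂ] H} (hQ : star Q = Q) (hQ2 : Q * Q = Q) (ξ : H) :
    inner ℂ ξ (Q ξ) = ((‖Q ξ‖ ^ 2 : ℝ) : ℂ) := by
  have h1 : Q (Q ξ) = Q ξ := DFunLike.congr_fun hQ2 ξ
  rw [← h1, ← inner_apply_of_star_eq hQ, inner_self_eq_norm_sq_to_K, h1]
  push_cast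
  rfl

/-- Pythagoras: removing a commuting projection. -/
theorem norm_sq_sub_of_proj {Q F : H →L[ℂ] H} (hQF : Commute Q F) (hF : star F = F)
    (hF2 : F * F = F) (ξ : H) : ‖Q (ξ - F ξ)‖ ^ 2 = ‖Q ξ‖ ^ 2 - ‖Q (F ξ)‖ ^ 2 := by
  have h1 : Q (F ξ) = F (Q ξ) := DFunLike.congr_fun hQF.eq ξ
  have h2 := inner_apply_self_of_proj hF hF2 (Q ξ)
  rw [map_sub, norm_sub_sq (𝕜 := ℂ), h1, h2, RCLike.re_to_complex, Complex.ofReal_re]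
  ring

/-- A decreasing sequence of projections converges strongly to the projection onto the
intersection of the ranges. -/
theorem tendsto_of_decreasing_projections {Q : ℕ → H →L[ℂ] H} {Q' : H →L[ℂ] H}
    (hs : ∀ n, star (Q n) = Q n) (hQ : ∀ n m, n ≤ m → Q n * Q m = Q m)
    (hQ' : ∀ n, Q' * Q n = Q') (hfix : ∀ ζ, (∀ n, Q n ζ = ζ) → Q' ζ = ζ) (ξ : H) :
    Filter.Tendsto (fun n => Q n ξ) Filter.atTop (nhds (Q' ξ)) := by
  have hcomm : ∀ n m, n ≤ m → Q m * Q n = Q m := by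
    intro n m hnm
    have := congrArg star (hQ n m hnm)
    rwa [star_mul, hs, hs] at this
  have hdiff : ∀ n m, n ≤ m → ‖Q n ξ - Q m ξ‖ ^ 2 = ‖Q n ξ‖ ^ 2 - ‖Q m ξ‖ ^ 2 := by
    intro n m hnm
    have h1 := norm_sq_sub_of_proj (Q := 1) (Commute.one_left (Q m)) (hs m) (hQ m m le_rfl) (Q n ξ)
    have h2 : Q m (Q n ξ) = Q m ξ := DFunLike.congr_fun (hcomm n m hnm) ξ
    simpa [h2] using h1
  have hanti : Antitone fun n => ‖Q n ξ‖ ^ 2 := by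
    intro n m hnm
    have := hdiff n m hnm
    have h0 := sq_nonneg ‖Q n ξ - Q m ξ‖
    simp only
    linarith
  have hbdd : BddBelow (range fun n => ‖Q n ξ‖ ^ 2) :=
    ⟨0, by rintro _ ⟨n, rfl⟩; positivity⟩
  have hc := (tendsto_atTop_ciInf hanti hbdd).cauchySeq
  have hcauchy : CauchySeq fun n => Q n ξ := by
    rw [Metric.cauchySeq_iff'] at hc ⊢
    intro ε hε
    obtain ⟨N, hN⟩ := hc (ε ^ 2) (by positivity)
    refine ⟨N, fun n hn => ?_⟩
    have h1 := hN n hn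
    rw [Real.dist_eq, abs_sub_comm, ← hdiff N n hn, abs_of_nonneg (by positivity)] at h1
    rw [dist_comm, dist_eq_norm]
    exact lt_of_pow_lt_pow_left₀ 2 hε.le h1
  obtain ⟨ζ, hζ⟩ := cauchySeq_tendsto_of_complete hcauchy
  have h1 : ∀ n, Q n ζ = ζ := by
    intro n
    refine tendsto_nhds_unique (((Q n).continuous.tendsto ζ).comp hζ) (hζ.congr' ?_)
    filter_upwards [Filter.eventually_ge_atTop n] with m hm
    exact (DFunLike.congr_fun (hQ n m hm) ξ).symm
  have h2 : Q' ζ = Q' ξ := by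
    refine tendsto_nhds_unique ((Q'.continuous.tendsto ζ).comp hζ) (tendsto_const_nhds.congr ?_)
    intro n
    exact (DFunLike.congr_fun (hQ' n) ξ).symm
  rw [← h2, hfix ζ h1]
  exact hζ

end HilbertProjections

namespace IsometrySemigroup

/-! ### The projections attached to an isometric representation -/

section Projections

variable {G : Type u} [AddCommGroup G] {P : AddSubmonoid G} (V : IsometrySemigroup P)

theorem opAdj_mul_op (a : P) : V.opAdj a * V.op a = 1 :=
  ContinuousLinearMap.ext fun ξ => V.opAdj_op a ξ

theorem star_op (a : P) : star (V.op a) = V.opAdj a := rfl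

theorem star_opAdj (a : P) : star (V.opAdj a) = V.op a := by
  rw [← star_op, star_star]

theorem norm_op (a : P) (ξ : V.H) : ‖V.op a ξ‖ = ‖ξ‖ := (V.V a).norm_map ξ

/-- The range projection `V_a V_a^*`. -/
def rangeProj (a : P) : V.H →L[ℂ] V.H := V.op a * V.opAdj a

theorem star_rangeProj (a : P) : star (V.rangeProj a) = V.rangeProj a := by
  rw [rangeProj, star_mul, star_op, star_opAdj]

theorem rangeProj_mul_op (a : P) : V.rangeProj a * V.op a = V.op a := by
  rw [rangeProj, mul_assoc, opAdj_mul_op, mul_one]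

theorem opAdj_mul_rangeProj (a : P) : V.opAdj a * V.rangeProj a = V.opAdj a := by
  rw [rangeProj, ← mul_assoc, opAdj_mul_op, one_mul]

theorem rangeProj_mul_rangeProj_add (a x : P) :
    V.rangeProj a * V.rangeProj (a + x) = V.rangeProj (a + x) := by
  rw [rangeProj, rangeProj, op_add, opAdj_add]
  calc V.op a * V.opAdj a * (V.op a * V.op x * (V.opAdj x * V.opAdj a))
      = V.op a * (V.opAdj a * V.op a) * V.op x * (V.opAdj x * V.opAdj a) := by
        simp only [mul_assoc]
    _ = _ := by rw [opAdj_mul_op, mul_one]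

/-- The projection `V_b^* V_a V_a^* V_b` attached to `g = a - b`; for the Koopman representation
it is multiplication by the indicator function of `{A | g ∈ A}`. It takes the junk value `0`
if `g` is not a difference of elements of `P`. -/
def proj (g : G) : V.H →L[ℂ] V.H :=
  open Classical in
  if h : ∃ p : P × P, g = (p.1 : G) - p.2 then
    V.opAdj h.choose.2 * V.rangeProj h.choose.1 * V.op h.choose.2 else 0

theorem opAdj_rangeProj_op_add (a b x : P) :
    V.opAdj (b + x) * V.rangeProj (a + x) * V.op (b + x) =
      V.opAdj b * V.rangeProj a * V.op b := by
  rw [rangeProj, rangeProj, add_comm b x, add_comm a x]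
  simp only [op_add, opAdj_add]
  calc V.opAdj b * V.opAdj x * (V.op x * V.op a * (V.opAdj a * V.opAdj x)) * (V.op x * V.op b)
      = V.opAdj b * (V.opAdj x * V.op x) * V.op a * V.opAdj a * (V.opAdj x * V.op x) * V.op b := by
        simp only [mul_assoc]
    _ = _ := by rw [opAdj_mul_op, mul_one, mul_one]; simp only [mul_assoc]

theorem proj_sub (a b : P) : V.proj ((a : G) - b) = V.opAdj b * V.rangeProj a * V.op b := by
  have h : ∃ p : P × P, (a : G) - b = (p.1 : G) - p.2 := ⟨(a, b), rfl⟩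
  rw [proj, dif_pos h]
  have hs := h.choose_spec
  generalize h.choose = p at hs
  obtain ⟨a', b'⟩ := p
  have h1 : a' + b = a + b' := by
    apply Subtype.ext
    push_cast
    have : (a : G) - b = a' - b' := hs
    rw [sub_eq_sub_iff_add_eq_add] at this
    exact this.symm
  calc V.opAdj b' * V.rangeProj a' * V.op b'
      = V.opAdj (b' + b) * V.rangeProj (a' + b) * V.op (b' + b) :=
        (V.opAdj_rangeProj_op_add a' b' b).symm
    _ = V.opAdj (b + b') * V.rangeProj (a + b') * V.op (b + b') := by rw [h1, add_comm b' b]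
    _ = _ := V.opAdj_rangeProj_op_add a b b'

theorem proj_coe (a : P) : V.proj (a : G) = V.rangeProj a := by
  have h0 : V.op 0 = 1 := by
    ext ξ; simp [op, V.V_zero]
  have h := V.proj_sub a 0
  rw [AddSubmonoid.coe_zero, sub_zero] at h
  rw [h, ← star_op, h0]; simp

variable {V}

theorem rangeProj_mul_op_of_comm (hV : V.HasCommutingRangeProjections) (a b : P) :
    V.rangeProj a * V.op b = V.op b * V.proj ((a : G) - b) := by
  rw [proj_sub]
  calc V.rangeProj a * V.op b = V.rangeProj a * (V.rangeProj b * V.op b) := by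
        rw [rangeProj_mul_op]
    _ = V.rangeProj b * V.rangeProj a * V.op b := by
        rw [← mul_assoc, show V.rangeProj a * V.rangeProj b = V.rangeProj b * V.rangeProj a from
          hV a b]
    _ = V.op b * (V.opAdj b * V.rangeProj a * V.op b) := by
        simp only [rangeProj, mul_assoc]

theorem proj_mul_proj (hV : V.HasCommutingRangeProjections) (a a' b : P) :
    V.proj ((a : G) - b) * V.proj ((a' : G) - b) =
      V.opAdj b * (V.rangeProj a * V.rangeProj a') * V.op b := by
  rw [proj_sub V a b, mul_assoc _ (V.op b), ← rangeProj_mul_op_of_comm hV]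
  simp only [mul_assoc]

variable [TopologicalSpace G] [IsTopologicalAddGroup G] {a₀ : G}

/-- Two elements of `G` are differences of elements of `P` with a common subtrahend. -/
theorem _root_.SemigroupRep.IsOrderUnit.exists_eq_sub (h : IsOrderUnit P a₀) (g g' : G) :
    ∃ a a' b : P, g = a - b ∧ g' = a' - b := by
  obtain ⟨n, hn⟩ := h.exists_forall_ge_finite [-g, -g']
  have h1 := interior_subset (hn n le_rfl (-g) (by simp))
  have h2 := interior_subset (hn n le_rfl (-g') (by simp))
  exact ⟨⟨_, h1⟩, ⟨_, h2⟩, ⟨_, h.nsmul_mem n⟩, by simp, by simp⟩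

theorem star_proj (h : IsOrderUnit P a₀) (g : G) : star (V.proj g) = V.proj g := by
  obtain ⟨a, -, b, rfl, -⟩ := h.exists_eq_sub g g
  rw [proj_sub]
  simp only [star_mul, star_op, star_opAdj, star_rangeProj, mul_assoc]

theorem proj_commute (h : IsOrderUnit P a₀) (hV : V.HasCommutingRangeProjections) (g g' : G) :
    Commute (V.proj g) (V.proj g') := by
  obtain ⟨a, a', b, rfl, rfl⟩ := h.exists_eq_sub g g'
  rw [Commute, SemiconjBy, proj_mul_proj hV, proj_mul_proj hV,
    show V.rangeProj a * V.rangeProj a' = V.rangeProj a' * V.rangeProj a from hV a a']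

/-- The projections decrease along the order of `G` defined by `P`. -/
theorem proj_mul_of_sub_mem (h : IsOrderUnit P a₀) (hV : V.HasCommutingRangeProjections)
    {g g' : G} (hg : g' - g ∈ P) : V.proj g * V.proj g' = V.proj g' := by
  obtain ⟨a, a', b, rfl, rfl⟩ := h.exists_eq_sub g g'
  have : a' = a + ⟨_, hg⟩ := by
    apply Subtype.ext; push_cast; abel
  rw [proj_mul_proj hV, proj_sub, this, rangeProj_mul_rangeProj_add]

theorem proj_mul_self (h : IsOrderUnit P a₀) (hV : V.HasCommutingRangeProjections) (g : G) :
    V.proj g * V.proj g = V.proj g :=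
  proj_mul_of_sub_mem h hV (by simp)

theorem proj_of_neg_mem (h : IsOrderUnit P a₀) (hV : V.HasCommutingRangeProjections) {g : G}
    (hg : -g ∈ P) : V.proj g = 1 := by
  have h0 : V.proj 0 = 1 := by
    have := V.proj_sub 0 0
    rw [sub_self] at this
    rw [this, mul_assoc, rangeProj_mul_op, opAdj_mul_op]
  have := proj_mul_of_sub_mem h hV (show (0 : G) - g ∈ P by simpa using hg)
  rwa [h0, mul_one] at this

theorem op_mul_proj (h : IsOrderUnit P a₀) (hV : V.HasCommutingRangeProjections) (b : P) (g : G) :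
    V.op b * V.proj g = V.proj ((b : G) + g) * V.op b := by
  obtain ⟨a', -, b', rfl, -⟩ := h.exists_eq_sub g g
  have h1 : (b : G) + (a' - b') = ((b + a' : P) : G) - b' := by push_cast; abel
  have h2 : (a' : G) - b' = ((b + a' : P) : G) - (b + b' : P) := by push_cast; abel
  symm
  calc V.proj ((b : G) + (a' - b')) * V.op b
      = V.opAdj b' * (V.rangeProj (b + a') * V.op (b + b')) := by
        rw [h1, proj_sub, add_comm b b', op_add]; simp only [mul_assoc]
    _ = V.opAdj b' * V.op b' * V.op b * V.proj ((a' : G) - b') := by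
        rw [rangeProj_mul_op_of_comm hV, ← h2, add_comm b b', op_add]; simp only [mul_assoc]
    _ = V.op b * V.proj ((a' : G) - b') := by rw [opAdj_mul_op, one_mul]

theorem opAdj_mul_proj (h : IsOrderUnit P a₀) (hV : V.HasCommutingRangeProjections) (b : P)
    (g : G) : V.opAdj b * V.proj g = V.proj (g - b) * V.opAdj b := by
  have h1 := congrArg star (op_mul_proj h hV b (g - b))
  rw [star_mul, star_mul, star_op, star_proj h, star_proj h, add_sub_cancel] at h1
  exact h1.symm

variable (V) in
/-- The product of the projections attached to the entries of a list. -/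
def projList (L : List G) : V.H →L[ℂ] V.H := (L.map V.proj).prod

theorem projList_nil : V.projList [] = 1 := rfl

theorem projList_cons (g : G) (L : List G) : V.projList (g :: L) = V.proj g * V.projList L := by
  simp [projList]

theorem projList_append (L M : List G) :
    V.projList (L ++ M) = V.projList L * V.projList M := by
  simp [projList]

theorem proj_commute_projList (h : IsOrderUnit P a₀) (hV : V.HasCommutingRangeProjections) (g : G)
    (L : List G) : Commute (V.proj g) (V.projList L) := by
  refine Commute.list_prod_right _ _ fun x hx => ?_
  obtain ⟨g', -, rfl⟩ := List.mem_map.1 hx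
  exact proj_commute h hV g g'

theorem projList_commute (h : IsOrderUnit P a₀) (hV : V.HasCommutingRangeProjections)
    (L M : List G) : Commute (V.projList L) (V.projList M) := by
  refine Commute.list_prod_left _ _ fun x hx => ?_
  obtain ⟨g', -, rfl⟩ := List.mem_map.1 hx
  exact proj_commute_projList h hV g' M

theorem star_projList (h : IsOrderUnit P a₀) (hV : V.HasCommutingRangeProjections) (L : List G) :
    star (V.projList L) = V.projList L := by
  induction L with
  | nil => simp [projList_nil]
  | cons g L ih =>
    rw [projList_cons, star_mul, ih, star_proj h, (proj_commute_projList h hV g L).eq]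

theorem projList_mul_self (h : IsOrderUnit P a₀) (hV : V.HasCommutingRangeProjections)
    (L : List G) : V.projList L * V.projList L = V.projList L := by
  induction L with
  | nil => simp [projList_nil]
  | cons g L ih =>
    have h1 := (proj_commute_projList h hV g L).eq
    calc V.projList (g :: L) * V.projList (g :: L)
        = V.proj g * (V.projList L * V.proj g) * V.projList L := by
          rw [projList_cons]; simp only [mul_assoc]
      _ = V.proj g * V.proj g * (V.projList L * V.projList L) := by
          rw [← h1]; simp only [mul_assoc]
      _ = V.projList (g :: L) := by rw [proj_mul_self h hV, ih, projList_cons]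

theorem proj_mul_projList_of_mem (h : IsOrderUnit P a₀) (hV : V.HasCommutingRangeProjections)
    {g : G} {L : List G} (hg : g ∈ L) : V.proj g * V.projList L = V.projList L := by
  induction L with
  | nil => simp at hg
  | cons g' L ih =>
    rw [projList_cons]
    rcases List.mem_cons.1 hg with rfl | hg
    · rw [← mul_assoc, proj_mul_self h hV]
    · rw [← mul_assoc, (proj_commute h hV g g').eq, mul_assoc, ih hg]

theorem op_mul_projList (h : IsOrderUnit P a₀) (hV : V.HasCommutingRangeProjections) (b : P)
    (L : List G) : V.op b * V.projList L = V.projList (L.map ((b : G) + ·)) * V.op b := by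
  induction L with
  | nil => simp [projList_nil]
  | cons g L ih =>
    rw [List.map_cons, projList_cons, projList_cons, ← mul_assoc, op_mul_proj h hV, mul_assoc, ih,
      mul_assoc]

theorem opAdj_mul_projList (h : IsOrderUnit P a₀) (hV : V.HasCommutingRangeProjections) (b : P)
    (L : List G) :
    V.opAdj b * V.projList L = V.projList (L.map fun g => g - b) * V.opAdj b := by
  induction L with
  | nil => simp [projList_nil]
  | cons g L ih =>
    rw [List.map_cons, projList_cons, projList_cons, ← mul_assoc, opAdj_mul_proj h hV, mul_assoc,
      ih, mul_assoc]

end Projections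

/-! ### The vectors representing a conformal functional -/

section ConformalFamily

variable {G : Type u} [AddCommGroup G] {P : AddSubmonoid G} (V : IsometrySemigroup P)
  {c : G →+ ℝ} {β : ℝ}

/-- A family of vectors `η_a ∈ Ker V_a^*` representing a conformal functional `φ` in the sense
that `φ(ξ) = ⟨η_a, ξ⟩` for `ξ ∈ Ker V_a^*`. For the Koopman representation `η_a` is the indicator
function of `X_u ∖ (X_u + a)`. -/
structure ConformalFamily (c : G →+ ℝ) (β : ℝ) where
  /-- the vectors `η_a` -/
  vec : P → V.H
  proj_vec : ∀ a : P, V.proj a (vec a) = 0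
  vec_sub : ∀ a b : P, vec (a + b) - V.proj a (vec (a + b)) = vec a
  op_vec : ∀ a b : P,
    V.op b (vec a) = (Real.exp (β * c b / 2) : ℂ) • V.proj b (vec (a + b))

theorem sub_rangeProj_mem_domain (a : P) (ξ : V.H) :
    V.opAdj a (ξ - V.rangeProj a ξ) = 0 := by
  have : V.opAdj a (V.rangeProj a ξ) = V.opAdj a ξ :=
    DFunLike.congr_fun (V.opAdj_mul_rangeProj a) ξ
  rw [map_sub, this, sub_self]

/-- The projection `1 - V_a V_a^*`, as a map into the domain `D_V`. -/
def toDomain (a : P) : V.H →ₗ[ℂ] V.domain :=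
  LinearMap.codRestrict V.domain ((1 - V.rangeProj a : V.H →L[ℂ] V.H) : V.H →ₗ[ℂ] V.H)
    fun ξ => mem_iUnion.2 ⟨a, V.sub_rangeProj_mem_domain a ξ⟩

theorem coe_toDomain (a : P) (ξ : V.H) : (V.toDomain a ξ : V.H) = ξ - V.rangeProj a ξ := rfl

theorem toDomain_of_opAdj {a : P} {ξ : V.H} (hξ : V.opAdj a ξ = 0) :
    (V.toDomain a ξ : V.H) = ξ := by
  rw [coe_toDomain, rangeProj, mul_apply_eq_comp, hξ, map_zero, sub_zero]

variable {V}

/-- The vectors `η_a` are the Riesz vectors of the functionals `ξ ↦ φ((1 - V_a V_a^*) ξ)`. -/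
theorem exists_conformalFamily (hV : V.IsConformal c β) :
    ∃ Φ : V.ConformalFamily c β, ∃ a, Φ.vec a ≠ 0 := by
  obtain ⟨φ, hφ0, hφb, hφc⟩ := hV
  have hbd : ∀ a : P, ∃ C : ℝ, ∀ ξ, ‖(φ ∘ₗ V.toDomain a) ξ‖ ≤ C * ‖ξ‖ := by
    intro a
    obtain ⟨C, hC⟩ := hφb a
    refine ⟨|C| * ‖1 - V.rangeProj a‖, fun ξ => ?_⟩
    refine (hC (V.toDomain a ξ) (V.sub_rangeProj_mem_domain a ξ)).trans ?_
    have h1 : ‖(V.toDomain a ξ : V.H)‖ ≤ ‖1 - V.rangeProj a‖ * ‖ξ‖ :=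
      (1 - V.rangeProj a).le_opNorm ξ
    calc C * ‖(V.toDomain a ξ : V.H)‖ ≤ |C| * ‖(V.toDomain a ξ : V.H)‖ := by
          gcongr; exact le_abs_self C
      _ ≤ |C| * (‖1 - V.rangeProj a‖ * ‖ξ‖) := by gcongr
      _ = _ := by ring
  let ℓ (a : P) : V.H →L[ℂ] ℂ := (φ ∘ₗ V.toDomain a).mkContinuousOfExistsBound (hbd a)
  let η (a : P) : V.H := (InnerProductSpace.toDual ℂ V.H).symm (ℓ a)
  have hη : ∀ a ξ, Inner.inner ℂ (η a) ξ = φ (V.toDomain a ξ) := fun a ξ =>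
    InnerProductSpace.toDual_symm_apply
  have hsa : ∀ (a : P) (ξ ζ : V.H), Inner.inner ℂ (V.proj a ξ) ζ = Inner.inner ℂ ξ (V.proj a ζ) :=
    fun a ξ ζ => by
      rw [proj_coe]; exact inner_apply_of_star_eq (V.star_rangeProj a) ξ ζ
  have hconf : ∀ (b : P) (x : V.domain), φ x = (Real.exp (β * c b / 2) : ℂ) *
      φ ⟨V.op b x, V.op_mem_domain b x.2⟩ := by
    intro b x
    have h1 : φ ⟨V.op b x, V.op_mem_domain b x.2⟩ = (Real.exp (-(β * c b / 2)) : ℂ) * φ x :=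
      DFunLike.congr_fun (hφc b) x
    rw [h1, ← mul_assoc, ← Complex.ofReal_mul, ← Real.exp_add]
    simp
  have hadj : ∀ (a b : P) (ξ : V.H), V.opAdj a ξ = 0 → V.opAdj (a + b) ξ = 0 := by
    intro a b ξ hξ
    rw [opAdj_add, mul_apply_eq_comp, hξ, map_zero]
  refine ⟨⟨η, ?_, ?_, ?_⟩, ?_⟩
  · intro a
    refine ext_inner_right ℂ fun ξ => ?_
    have h1 : V.toDomain a (V.proj a ξ) = 0 := by
      apply Subtype.ext
      have h2 : V.rangeProj a (V.rangeProj a ξ) = V.rangeProj a ξ := by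
        rw [← mul_apply_eq_comp]
        congr 1
        rw [rangeProj, ← mul_assoc, mul_assoc (V.op a), opAdj_mul_op, mul_one]
      rw [coe_toDomain, proj_coe, h2, sub_self]; rfl
    rw [hsa, hη, h1, map_zero, inner_zero_left]
  · intro a b
    refine ext_inner_right ℂ fun ξ => ?_
    rw [inner_sub_left, hsa, ← inner_sub_right, hη, hη]
    congr 1
    apply Subtype.ext
    rw [proj_coe, V.toDomain_of_opAdj (hadj a b _ (V.sub_rangeProj_mem_domain a ξ))]
    rfl
  · intro a b
    refine ext_inner_right ℂ fun ξ => ?_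
    have h1 : Inner.inner ℂ (V.op b (η a)) ξ = Inner.inner ℂ (η a) (V.opAdj b ξ) :=
      (ContinuousLinearMap.adjoint_inner_right (V.op b) (η a) ξ).symm
    rw [h1, hη, hconf b, inner_smul_left, Complex.conj_ofReal, hsa, hη]
    congr 2
    apply Subtype.ext
    change V.op b (V.opAdj b ξ - V.op a (V.opAdj a (V.opAdj b ξ))) =
      V.proj b ξ - V.op (a + b) (V.opAdj (a + b) (V.proj b ξ))
    rw [proj_coe, map_sub, add_comm a b, opAdj_add, mul_apply_eq_comp,
      show V.opAdj b (V.rangeProj b ξ) = V.opAdj b ξ from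
        DFunLike.congr_fun (V.opAdj_mul_rangeProj b) ξ, op_add]
    rfl
  · by_contra! h0
    refine hφ0 (LinearMap.ext fun x => ?_)
    obtain ⟨a, ha⟩ := mem_iUnion.1 x.2
    have h1 : V.toDomain a (x : V.H) = x := Subtype.ext (V.toDomain_of_opAdj ha)
    have h2 := hη a (x : V.H)
    rw [h1] at h2
    have h3 : η a = 0 := h0 a
    rw [← h2, h3, inner_zero_left]; rfl

namespace ConformalFamily

/-- Rescaling of a conformal family. -/
def smul (z : ℂ) (Φ : V.ConformalFamily c β) : V.ConformalFamily c β where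
  vec a := z • Φ.vec a
  proj_vec a := by rw [map_smul, Φ.proj_vec, smul_zero]
  vec_sub a b := by rw [map_smul, ← smul_sub, Φ.vec_sub]
  op_vec a b := by rw [map_smul, Φ.op_vec, map_smul, smul_comm]

variable (Φ : V.ConformalFamily c β)

theorem proj_vec_add (a b : P) :
    V.proj b (Φ.vec (a + b)) = (Real.exp (-(β * c b / 2)) : ℂ) • V.op b (Φ.vec a) := by
  rw [Φ.op_vec, smul_smul, ← Complex.ofReal_mul, ← Real.exp_add]
  simp

theorem opAdj_vec_add (a b : P) :
    V.opAdj b (Φ.vec (a + b)) = (Real.exp (-(β * c b / 2)) : ℂ) • Φ.vec a := by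
  have h1 : V.opAdj b (V.proj b (Φ.vec (a + b))) = V.opAdj b (Φ.vec (a + b)) := by
    rw [proj_coe]
    exact DFunLike.congr_fun (V.opAdj_mul_rangeProj b) _
  rw [← h1, proj_vec_add, map_smul, opAdj_op]

variable [TopologicalSpace G] [IsTopologicalAddGroup G] {a₀ : G}

/-- A conformal family with `η_{a₀} = 0` vanishes. -/
theorem vec_ne_zero (h : IsOrderUnit P a₀) {a : P} (ha : Φ.vec a ≠ 0) :
    Φ.vec ⟨a₀, h.mem⟩ ≠ 0 := by
  intro h0
  have h1 : ∀ n : ℕ, Φ.vec (n • ⟨a₀, h.mem⟩) = 0 := by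
    intro n
    induction n with
    | zero =>
      have := Φ.proj_vec 0
      rw [proj_coe, rangeProj, ← star_op] at this
      have e : V.op 0 = 1 := by ext ξ; simp [op, V.V_zero]
      rw [zero_smul]
      simpa [e] using this
    | succ n ih =>
      have h2 := Φ.vec_sub ⟨a₀, h.mem⟩ (n • ⟨a₀, h.mem⟩)
      rw [h0, add_comm, Φ.proj_vec_add, ih, map_zero, smul_zero, sub_zero] at h2
      rw [succ_nsmul, h2]
  obtain ⟨n, hn⟩ := h.exists_forall_ge (a : G)
  have h2 := interior_subset (hn n le_rfl)
  have h3 : a + ⟨_, h2⟩ = n • (⟨a₀, h.mem⟩ : P) := by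
    apply Subtype.ext; push_cast; abel
  have h4 := Φ.vec_sub a ⟨_, h2⟩
  rw [h3, h1, map_zero, sub_zero] at h4
  exact ha h4.symm

/-- The covariance of the vectors `η_a` under the shift by `x`, in terms of the norms that will
become measures of cylinder sets. -/
theorem norm_sq_sub (h : IsOrderUnit P a₀) (hV : V.HasCommutingRangeProjections) (L : List G)
    (x s z : P) :
    ‖V.projList (L.map ((x : G) + ·)) (V.proj x (Φ.vec (s + x + z)))‖ ^ 2 -
      ‖V.projList (L.map ((x : G) + ·)) (V.proj x (V.proj ((s + x : P) : G)
        (Φ.vec (s + x + z))))‖ ^ 2 = Real.exp (-(β * c x)) * ‖V.projList L (Φ.vec s)‖ ^ 2 := by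
  have hc : Commute (V.projList (L.map ((x : G) + ·)) * V.proj x) (V.proj ((s + x : P) : G)) :=
    ((proj_commute_projList h hV _ _).symm).mul_left (proj_commute h hV _ _)
  have h1 := norm_sq_sub_of_proj hc (star_proj h _) (proj_mul_self h hV _) (Φ.vec (s + x + z))
  rw [mul_apply_eq_comp, mul_apply_eq_comp, mul_apply_eq_comp, Φ.vec_sub, Φ.proj_vec_add, map_smul,
    ← mul_apply_eq_comp, ← op_mul_projList h hV, mul_apply_eq_comp, norm_smul, norm_op] at h1
  rw [← h1, mul_pow, Complex.norm_real, Real.norm_of_nonneg (Real.exp_pos _).le, ← Real.exp_nat_mul]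
  congr 2
  push_cast
  ring

end ConformalFamily

end ConformalFamily

end IsometrySemigroup

/-! ### Spectral measures of commuting projections -/

section Spectral

open WeakDual

/-- A positive functional on a commutative C⋆-algebra is given by a measure on the character
space; its value at a projection `p` is the measure of the clopen set `{χ | χ p = 1}`. -/
theorem exists_measure_characterSpace {A : Type*} [CommCStarAlgebra A]
    [MeasurableSpace (characterSpace ℂ A)] [BorelSpace (characterSpace ℂ A)] (Λ : A →ₗ[ℂ] ℂ)
    (hΛ : ∀ a, 0 ≤ (Λ (star a * a)).re) :
    ∃ m : Measure (characterSpace ℂ A), IsFiniteMeasure m ∧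
      ∀ p : A, p * p = p → star p = p → m.real {χ | χ p = 1} = (Λ p).re := by
  let Γ := gelfandStarTransform A
  let emb (f : C(characterSpace ℂ A, ℝ)) : C(characterSpace ℂ A, ℂ) :=
    ⟨fun x => (f x : ℂ), Complex.continuous_ofReal.comp f.continuous⟩
  let Λr : CompactlySupportedContinuousMap (characterSpace ℂ A) ℝ →ₗ[ℝ] ℝ :=
    { toFun := fun f => (Λ (Γ.symm (emb f.toContinuousMap))).re
      map_add' := fun f g => by
        have : emb (f + g).toContinuousMap = emb f.toContinuousMap + emb g.toContinuousMap := by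
          ext x; simp [emb]
        rw [this, map_add, map_add, Complex.add_re]
      map_smul' := fun r f => by
        have : emb (r • f).toContinuousMap = (r : ℂ) • emb f.toContinuousMap := by
          ext x; simp [emb]
        rw [this, map_smul, map_smul, RingHom.id_apply, smul_eq_mul, Complex.re_ofReal_mul,
          smul_eq_mul] }
  let Λp : CompactlySupportedContinuousMap (characterSpace ℂ A) ℝ →ₚ[ℝ] ℝ :=
    PositiveLinearMap.mk₀ Λr fun f hf => by
      let g : C(characterSpace ℂ A, ℝ) := ⟨fun x => Real.sqrt (f x), f.continuous.sqrt⟩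
      have h1 : emb f.toContinuousMap = star (emb g) * emb g := by
        ext x
        have h2 : Real.sqrt (f x) * Real.sqrt (f x) = f x := Real.mul_self_sqrt (hf x)
        simp only [emb, g, ContinuousMap.mul_apply, ContinuousMap.star_apply,
          ContinuousMap.coe_mk, RCLike.star_def, Complex.conj_ofReal]
        exact_mod_cast h2.symm
      change 0 ≤ (Λ (Γ.symm (emb f.toContinuousMap))).re
      rw [h1, map_mul, map_star]
      exact hΛ _
  let m := RealRMK.rieszMeasure Λp
  have hm : IsFiniteMeasure m := ⟨isCompact_univ.measure_lt_top⟩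
  refine ⟨m, hm, fun p hp hps => ?_⟩
  have hval : ∀ χ : characterSpace ℂ A, χ p = 0 ∨ χ p = 1 := by
    intro χ
    have h1 : χ p * χ p = χ p := by rw [← map_mul, hp]
    rcases eq_or_ne (χ p) 0 with h0 | h0
    · exact Or.inl h0
    · exact Or.inr (mul_left_cancel₀ h0 (by rw [h1, mul_one]))
  let B : Set (characterSpace ℂ A) := {χ | χ p = 1}
  let f : CompactlySupportedContinuousMap (characterSpace ℂ A) ℝ :=
    ⟨⟨fun χ => (Γ p χ).re, Complex.continuous_re.comp (Γ p).continuous⟩,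
      HasCompactSupport.of_compactSpace _⟩
  have hB : MeasurableSet B := by
    have hcl : IsClosed B :=
      isClosed_eq (Γ p).continuous (continuous_const (y := (1 : ℂ)))
    exact hcl.measurableSet
  have hfB : ∀ χ, f χ = B.indicator 1 χ := by
    intro χ
    change (χ p).re = _
    rcases hval χ with h0 | h0
    · have : χ ∉ B := fun hx => by
        rw [show χ p = 1 from hx] at h0; exact one_ne_zero h0
      rw [indicator_of_notMem this, h0]; rfl
    · have : χ ∈ B := h0
      rw [indicator_of_mem this, h0]; rfl
  have hint := RealRMK.integral_rieszMeasure Λp f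
  have hemb : emb f.toContinuousMap = Γ p := by
    ext χ
    change (((χ p).re : ℝ) : ℂ) = χ p
    rcases hval χ with h0 | h0 <;> simp [h0]
  have h1 : Λp f = (Λ p).re := by
    change (Λ (Γ.symm (emb f.toContinuousMap))).re = _
    rw [hemb, StarAlgEquiv.symm_apply_apply]
  rw [h1] at hint
  rw [← hint]
  simp_rw [hfB]
  rw [integral_indicator_one hB]

variable {H : Type u} [NormedAddCommGroup H] [InnerProductSpace ℂ H] [CompleteSpace H]

/-- Commuting self-adjoint operators lie in a commutative C⋆-algebra of operators. -/
theorem exists_commCStarAlgebra {ι : Type*} {p : ι → H →L[ℂ] H} (hs : ∀ i, star (p i) = p i)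
    (hc : ∀ i j, Commute (p i) (p j)) :
    ∃ (A : Type u) (_ : CommCStarAlgebra A) (π : A →⋆ₐ[ℂ] (H →L[ℂ] H)) (q : ι → A),
      Function.Injective π ∧ ∀ i, π (q i) = p i := by
  let S : StarSubalgebra ℂ (H →L[ℂ] H) := StarAlgebra.adjoin ℂ (range p)
  have hS : IsMulCommutative S := by
    refine StarAlgebra.isMulCommutative_adjoin ℂ ?_ ?_
    · rintro _ ⟨i, rfl⟩ _ ⟨j, rfl⟩
      exact hc i j
    · rintro _ ⟨i, rfl⟩ _ ⟨j, rfl⟩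
      rw [hs]; exact hc i j
  let A : StarSubalgebra ℂ (H →L[ℂ] H) := S.topologicalClosure
  have hA : IsClosed (A : Set (H →L[ℂ] H)) := S.isClosed_topologicalClosure
  have hmul : ∀ x y : A, x * y = y * x := (StarSubalgebra.commRingTopologicalClosure S fun x y =>
        IsMulCommutative.is_comm.comm x y).mul_comm
  let iA : CommCStarAlgebra A := { StarSubalgebra.cstarAlgebra A with mul_comm := hmul }
  exact ⟨↥A, iA, A.subtype,
    fun i => ⟨p i, S.le_topologicalClosure (StarAlgebra.subset_adjoin ℂ _ ⟨i, rfl⟩)⟩,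
    Subtype.val_injective, fun i => rfl⟩

/-- The joint spectral measure of a commuting family of projections at a vector `ξ`, as a measure
on the subsets of the index set: the sets containing all entries of `L` have measure
`‖p_L ξ‖²`, where `p_L` is the product of the projections over `L`. -/
theorem exists_spectralMeasure {ι : Type*} {p : ι → H →L[ℂ] H} (hs : ∀ i, star (p i) = p i)
    (hp : ∀ i, p i * p i = p i) (hc : ∀ i j, Commute (p i) (p j)) (ξ : H) :
    ∃ m : Measure (ι → Prop), IsFiniteMeasure m ∧
      ∀ L : List ι, m.real {s | ∀ i ∈ L, s i} = ‖(L.map p).prod ξ‖ ^ 2 := by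
  obtain ⟨A, iA, π, pA, hπ, hπp⟩ := exists_commCStarAlgebra hs hc
  let _ : MeasurableSpace (characterSpace ℂ A) := borel _
  have : BorelSpace (characterSpace ℂ A) := ⟨rfl⟩
  let Λ : A →ₗ[ℂ] ℂ :=
    { toFun := fun a => inner ℂ ξ (π a ξ)
      map_add' := fun a b => by simp
      map_smul' := fun z a => by simp }
  have hΛ : ∀ a, 0 ≤ (Λ (star a * a)).re := by
    intro a
    have h1 : Λ (star a * a) = inner ℂ (π a ξ) (π a ξ) := by
      change inner ℂ ξ (π (star a * a) ξ) = _
      rw [map_mul, map_star]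
      exact ContinuousLinearMap.adjoint_inner_right (π a) ξ (π a ξ)
    rw [h1, ← RCLike.re_to_complex]
    exact inner_self_nonneg
  obtain ⟨m, hm, hmp⟩ := exists_measure_characterSpace Λ hΛ
  let Φ (χ : characterSpace ℂ A) : ι → Prop := fun i => χ (pA i) = 1
  have hΦ : Measurable Φ := by
    refine measurable_pi_lambda _ fun i => measurable_to_prop ?_
    have hcl : IsClosed {χ : characterSpace ℂ A | χ (pA i) = 1} :=
      isClosed_eq (gelfandStarTransform A (pA i)).continuous (continuous_const (y := (1 : ℂ)))
    convert hcl.measurableSet using 1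
    ext χ; simp [Φ]
  have hcoe : ∀ L : List ι, π (L.map pA).prod = (L.map p).prod := by
    intro L
    rw [map_list_prod, List.map_map]
    congr 2
    exact funext hπp
  have hpA : ∀ i, pA i * pA i = pA i := fun i => hπ (by rw [map_mul, hπp, hp])
  have hpAs : ∀ i, star (pA i) = pA i := fun i => hπ (by rw [map_star, hπp, hs])
  have hLA : ∀ L : List ι, (L.map pA).prod * (L.map pA).prod = (L.map pA).prod ∧
      star (L.map pA).prod = (L.map pA).prod ∧
      ∀ χ : characterSpace ℂ A, χ (L.map pA).prod = 1 ↔ ∀ i ∈ L, χ (pA i) = 1 := by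
    intro L
    induction L with
    | nil => simp
    | cons i L ih =>
      obtain ⟨h1, h2, h3⟩ := ih
      rw [List.map_cons, List.prod_cons]
      refine ⟨?_, ?_, fun χ => ?_⟩
      · rw [mul_mul_mul_comm, hpA, h1]
      · rw [star_mul, h2, hpAs, mul_comm]
      · rw [map_mul, List.forall_mem_cons, ← h3 χ]
        have h4 : χ (pA i) * χ (pA i) = χ (pA i) := by rw [← map_mul, hpA]
        constructor
        · intro h
          have h5 : χ (pA i) = 1 := by
            have h6 : χ (pA i) * (χ (pA i) * χ (L.map pA).prod) = χ (pA i) := by rw [h, mul_one]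
            rwa [← mul_assoc, h4, h, eq_comm] at h6
          refine ⟨h5, ?_⟩
          rwa [h5, one_mul] at h
        · rintro ⟨h5, h6⟩
          rw [h5, h6, one_mul]
  have hmeas : ∀ L : List ι, MeasurableSet {s : ι → Prop | ∀ i ∈ L, s i} := by
    intro L
    have : {s : ι → Prop | ∀ i ∈ L, s i} = ⋂ i ∈ {i | i ∈ L}, (fun s => s i) ⁻¹' {True} := by
      ext s; simp
    rw [this]
    exact MeasurableSet.biInter L.finite_toSet.countable fun i _ =>
      measurable_pi_apply i (measurableSet_singleton _)
  refine ⟨m.map Φ, inferInstance, fun L => ?_⟩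
  obtain ⟨h1, h2, h3⟩ := hLA L
  have h4 : Φ ⁻¹' {s | ∀ i ∈ L, s i} = {χ | χ (L.map pA).prod = 1} := by
    ext χ
    exact (h3 χ).symm
  rw [Measure.real, Measure.map_apply hΦ (hmeas L), h4]
  change m.real _ = _
  rw [hmp _ h1 h2]
  change (inner ℂ ξ (π (L.map pA).prod ξ)).re = _
  have h5 := congrArg π h1
  have h6 := congrArg π h2
  rw [map_mul] at h5
  rw [map_star] at h6
  rw [inner_apply_self_of_proj h6 h5, hcoe, Complex.ofReal_re]

end Spectral

namespace IsometrySemigroup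

/-! ### The spectral measure on `Y_u` of a vector -/

section SpectralMeasure

variable {G : Type u} [AddCommGroup G] [TopologicalSpace G] [IsTopologicalAddGroup G]
  {P : AddSubmonoid G} {V : IsometrySemigroup P} {a₀ : G}

theorem projList_mul_projList_of_le (h : IsOrderUnit P a₀) (hV : V.HasCommutingRangeProjections)
    {L M : List G} (hLM : ∀ g ∈ L, ∃ g' ∈ M, g' - g ∈ P) :
    V.projList L * V.projList M = V.projList M := by
  induction L with
  | nil => rw [projList_nil, one_mul]
  | cons g L ih =>
    obtain ⟨g', hg', hgg'⟩ := hLM g (by simp)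
    rw [projList_cons, mul_assoc, ih fun x hx => hLM x (by simp [hx]),
      ← proj_mul_projList_of_mem h hV hg', ← mul_assoc, proj_mul_of_sub_mem h hV hgg']

/-- Left continuity of `g ↦ V.proj g`, a consequence of strong continuity: `V_p ζ` lies in the
range of `V.proj g` for `p = g - d`, and `V_p ζ → ζ` as `p → 0`. -/
theorem proj_apply_eq_self_of_dense (h : IsOrderUnit P a₀) (hV : V.HasCommutingRangeProjections)
    (hc : V.IsStronglyContinuous) {D : Set G} (hD : Dense D) {g : G} {ζ : V.H}
    (hζ : ∀ d ∈ D, g - d ∈ interior (P : Set G) → V.proj d ζ = ζ) : V.proj g ζ = ζ := by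
  have hcl : IsClosed {p : P | V.proj g (V.op p ζ) = V.op p ζ} :=
    isClosed_eq ((V.proj g).continuous.comp (hc ζ)) (hc ζ)
  have h0 : (0 : P) ∈ closure {p : P | V.proj g (V.op p ζ) = V.op p ζ} := by
    refine mem_closure_iff.2 fun O hO h0 => ?_
    obtain ⟨W, hW, rfl⟩ := isOpen_induced_iff.1 hO
    obtain ⟨d, hdD, hdW, hdP⟩ := exists_dense_below h.subset_closure hD
      (hW.preimage (continuous_const.sub continuous_id : Continuous fun y => g - y))
      (x := g) (by simpa using h0)
    refine ⟨⟨g - d, interior_subset hdP⟩, hdW, ?_⟩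
    have h1 := op_mul_proj h hV ⟨g - d, interior_subset hdP⟩ d
    have h2 := DFunLike.congr_fun h1 ζ
    rw [mul_apply_eq_comp, mul_apply_eq_comp, hζ d hdD hdP] at h2
    simpa using h2.symm
  have h1 : V.proj g (V.op 0 ζ) = V.op 0 ζ := hcl.closure_subset h0
  simpa [op, V.V_zero] using h1

/-- The closed set determined by a subset `s` of a dense set `D ⊆ G`: it consists of the `g` such
that `s` contains all points of `D` strictly below `g`. The hypotheses on `s` make it non-empty and
proper. -/
def yuOfDense {D : Set G} (hP : (P : Set G) ⊆ closure (interior (P : Set G))) (hD : Dense D)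
    {a b : G} (hb : b ∈ interior (P : Set G)) (s : D → Prop)
    (h1 : ∀ d : D, -(d : G) ∈ P → s d) (h2 : ∀ d : D, (d : G) - a ∈ P → ¬ s d) : Yu P where
  carrier := ⟨{g : G | ∀ d : D, g - d ∈ interior (P : Set G) → s d}, by
    have : {g : G | ∀ d : D, g - d ∈ interior (P : Set G) → s d} =
        ⋂ d ∈ {d : D | ¬ s d}, {g : G | g - d ∈ interior (P : Set G)}ᶜ := by
      ext g
      simp only [mem_ofPred_eq, mem_iInter, mem_compl_iff]
      exact forall_congr' fun d => not_imp_not.symm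
    rw [this]
    exact isClosed_biInter fun d _ =>
      (isOpen_interior.preimage (continuous_sub_right (d : G))).isClosed_compl⟩
  neg_add_mem p hp g hg d hd := by
    refine hg d ?_
    convert interior_add_mem hd hp using 1
    abel
  nonempty := ⟨0, fun d hd => h1 d (by simpa using interior_subset hd)⟩
  ne_univ huniv := by
    obtain ⟨d, hdD, hdU, hdP⟩ := exists_dense_below hP hD
      (isOpen_interior.preimage (continuous_sub_right a)) (x := a + b) (by simpa using hb)
    have : a + b ∈ (univ : Set G) := mem_univ _
    rw [← huniv] at this
    exact h2 ⟨d, hdD⟩ (interior_subset hdU) (this ⟨d, hdD⟩ hdP)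

variable [LocallyCompactSpace G] [SecondCountableTopology G] [T2Space G]

/-- A vector `ξ` in the kernel of `V.proj a` has a spectral measure on `Y_u`: under it the set of
all `A` containing the entries of `L` has measure `‖V.projList L ξ‖²`. It is the image of the
joint spectral measure of the projections indexed by a countable dense subset of `G`, the
characters being turned into closed sets by `yuOfDense`. -/
theorem exists_measure_cyl (h : IsOrderUnit P a₀) (hV : V.HasCommutingRangeProjections)
    (hc : V.IsStronglyContinuous) {a : G} {ξ : V.H} (hξ : V.proj a ξ = 0) :
    ∃ κ : Measure (Yu P), IsFiniteMeasure κ ∧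
      ∀ L : List G, κ.real (cyl P L) = ‖V.projList L ξ‖ ^ 2 := by
  rcases eq_or_ne ξ 0 with rfl | hξ0
  · exact ⟨0, inferInstance, fun L => by simp⟩
  obtain ⟨D, hDc, hD⟩ := exists_countable_dense G
  have : Countable D := hDc.to_subtype
  have : Nonempty D := hD.nonempty.to_subtype
  obtain ⟨e, he⟩ := exists_surjective_nat D
  obtain ⟨m, hm, hmL⟩ := exists_spectralMeasure (p := fun d : D => V.proj (d : G))
    (fun d => star_proj h _) (fun d => proj_mul_self h hV _)
    (fun d d' => proj_commute h hV _ _) ξ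
  have hmL' : ∀ L : List D, m.real {s | ∀ i ∈ L, s i} = ‖V.projList (L.map (↑)) ξ‖ ^ 2 := by
    intro L
    rw [hmL, projList, List.map_map]
    rfl
  have hms : ∀ d : D, MeasurableSet {s : D → Prop | s d} := fun d =>
    (measurable_pi_apply d).setOf
  -- `V.proj d ξ = ξ` for `-d ∈ P` and `V.proj d ξ = 0` for `d - a ∈ P`
  let good : Set (D → Prop) :=
    {s | (∀ d : D, -(d : G) ∈ P → s d) ∧ ∀ d : D, (d : G) - a ∈ P → ¬ s d}
  have hgoodm : MeasurableSet good := by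
    have : good = (⋂ d : D, {s | -(d : G) ∈ P → s d}) ∩ ⋂ d : D, {s | (d : G) - a ∈ P → ¬ s d} := by
      ext s; simp [good]
    rw [this]
    refine (MeasurableSet.iInter fun d => ?_).inter (MeasurableSet.iInter fun d => ?_)
    · by_cases hd : -(d : G) ∈ P
      · simpa [hd] using hms d
      · simp [hd]
    · by_cases hd : (d : G) - a ∈ P
      · simp only [hd, true_imp_iff]
        exact (hms d).compl
      · simp [hd]
  have hgood : ∀ᵐ s ∂m, s ∈ good := by
    refine (ae_all_iff.2 fun d => ?_).and (ae_all_iff.2 fun d => ?_)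
    · by_cases hd : -(d : G) ∈ P
      · simp only [hd, true_imp_iff]
        rw [ae_iff, ← compl_ofPred, measure_compl (hms d) (measure_ne_top m _)]
        have h1 := hmL' [d]
        have h2 := hmL' []
        have e1 : {s : D → Prop | ∀ i ∈ [d], s i} = {s | s d} := by ext s; simp
        have e2 : {s : D → Prop | ∀ i ∈ ([] : List D), s i} = univ := by ext s; simp
        rw [e1, List.map_singleton, projList_cons, proj_of_neg_mem h hV hd, one_mul] at h1
        rw [e2] at h2
        have h3 : m.real {s | s d} = m.real univ := by rw [h1, h2]; rfl
        rw [measureReal_eq_measureReal_iff] at h3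
        rw [h3, tsub_self]
      · simp [hd]
    · by_cases hd : (d : G) - a ∈ P
      · simp only [hd, true_imp_iff]
        rw [ae_iff]
        have h1 := hmL' [d]
        have e1 : {s : D → Prop | ∀ i ∈ [d], s i} = {s | s d} := by ext s; simp
        have h2 : V.proj (d : G) ξ = 0 := by
          rw [← proj_mul_of_sub_mem h hV hd, (proj_commute h hV _ _).eq, mul_apply_eq_comp, hξ,
            map_zero]
        rw [e1, List.map_singleton, projList_cons, projList_nil, mul_one, h2] at h1
        simp only [norm_zero, ne_eq, OfNat.ofNat_ne_zero, not_false_eq_true, zero_pow] at h1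
        simpa [measureReal_eq_zero_iff] using h1
      · simp [hd]
  obtain ⟨s₀, hs₀⟩ : good.Nonempty := by
    have : NeZero m := ⟨fun h0 => hξ0 (by simpa [h0, projList_nil] using (hmL' []).symm)⟩
    exact hgood.exists
  classical
  let r (s : D → Prop) : good :=
    ⟨if s ∈ good then s else s₀, by split_ifs with hs; exacts [hs, hs₀]⟩
  have hr : Measurable r :=
    (Measurable.ite hgoodm measurable_id measurable_const).subtype_mk
  let Ψ (s : good) : Yu P :=
    yuOfDense h.subset_closure hD h.mem_interior s.1 s.2.1 s.2.2
  have hΨ : Measurable Ψ := by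
    refine measurable_to_Yu h.subset_closure fun g => ?_
    have : {s : good | g ∈ (Ψ s).carrier} =
        ⋂ d ∈ {d : D | g - d ∈ interior (P : Set G)}, Subtype.val ⁻¹' {s | s d} := by
      ext s
      simp only [mem_ofPred_eq, mem_iInter, mem_preimage]
      rfl
    rw [this]
    exact MeasurableSet.biInter (to_countable _) fun d _ => measurable_subtype_coe (hms d)
  refine ⟨m.map (Ψ ∘ r), inferInstance, fun L => ?_⟩
  -- membership of all entries of `L` is decided by the countably many `d ∈ S`; both sides of the
  -- formula are limits along an enumeration of `S`
  let S : Set D := {d | ∃ g ∈ L, g - d ∈ interior (P : Set G)}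
  let M (n : ℕ) : List D := ((List.range n).filter fun i => e i ∈ S).map e
  have hMmem : ∀ n (d : D), d ∈ M n ↔ d ∈ S ∧ ∃ i < n, e i = d := by
    intro n d
    simp only [M, List.mem_map, List.mem_filter, List.mem_range, decide_eq_true_eq]
    constructor
    · rintro ⟨i, ⟨hi, hiS⟩, rfl⟩
      exact ⟨hiS, i, hi, rfl⟩
    · rintro ⟨hd, i, hi, rfl⟩
      exact ⟨i, ⟨hi, hd⟩, rfl⟩
  have h1 : (m.map (Ψ ∘ r)).real (cyl P L) = m.real (⋂ n, {s | ∀ d ∈ M n, s d}) := by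
    rw [Measure.real, Measure.map_apply (hΨ.comp hr) (measurableSet_cyl L), Measure.real]
    congr 1
    refine measure_congr ?_
    filter_upwards [hgood] with s hs
    refine propext ?_
    change (∀ g ∈ L, ∀ d : D, g - d ∈ interior (P : Set G) → (r s).1 d) ↔ s ∈ ⋂ n, _
    have hrs : (r s).1 = s := by simp only [r, if_pos hs]
    rw [hrs, mem_iInter]
    constructor
    · intro H n d hd
      obtain ⟨⟨g, hg, hgd⟩, -⟩ := (hMmem n d).1 hd
      exact H g hg d hgd
    · intro H g hg d hgd
      obtain ⟨i, rfl⟩ := he d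
      exact H (i + 1) (e i) ((hMmem _ _).2 ⟨⟨g, hg, hgd⟩, i, by omega, rfl⟩)
  have hmeasM : ∀ n, MeasurableSet {s : D → Prop | ∀ d ∈ M n, s d} := by
    intro n
    have : {s : D → Prop | ∀ d ∈ M n, s d} = ⋂ d ∈ {d | d ∈ M n}, {s | s d} := by
      ext s; simp
    rw [this]
    exact MeasurableSet.biInter (to_countable _) fun d _ => hms d
  have hMmono : ∀ n k, n ≤ k → ∀ d ∈ M n, d ∈ M k := by
    intro n k hnk d hd
    obtain ⟨hdS, i, hi, hid⟩ := (hMmem n d).1 hd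
    exact (hMmem k d).2 ⟨hdS, i, by omega, hid⟩
  have hlim1 : Filter.Tendsto (fun n => m.real {s | ∀ d ∈ M n, s d}) Filter.atTop
      (nhds (m.real (⋂ n, {s | ∀ d ∈ M n, s d}))) := by
    refine (ENNReal.tendsto_toReal (measure_ne_top m _)).comp ?_
    refine tendsto_measure_iInter_atTop (fun n => (hmeasM n).nullMeasurableSet) ?_
      ⟨0, measure_ne_top m _⟩
    exact fun n k hnk s hs d hd => hs d (hMmono n k hnk d hd)
  have hlim2 := tendsto_of_decreasing_projections
    (Q := fun n => V.projList ((M n).map (↑))) (Q' := V.projList L)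
    (fun n => star_projList h hV _)
    (fun n k hnk => projList_mul_projList_of_le h hV (by
      intro g hg
      obtain ⟨d, hd, rfl⟩ := List.mem_map.1 hg
      exact ⟨d, List.mem_map.2 ⟨d, hMmono n k hnk d hd, rfl⟩, by simp⟩))
    (fun n => by
      rw [(projList_commute h hV _ _).eq]
      refine projList_mul_projList_of_le h hV ?_
      intro g hg
      obtain ⟨d, hd, rfl⟩ := List.mem_map.1 hg
      obtain ⟨⟨g, hg, hgd⟩, -⟩ := (hMmem n d).1 hd
      exact ⟨g, hg, interior_subset hgd⟩)
    (fun ζ hζ => by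
      have h2 : ∀ g ∈ L, V.proj g ζ = ζ := by
        intro g hg
        refine proj_apply_eq_self_of_dense h hV hc hD fun d hdD hgd => ?_
        obtain ⟨i, hi⟩ := he ⟨d, hdD⟩
        have h3 : (⟨d, hdD⟩ : D) ∈ M (i + 1) :=
          (hMmem _ _).2 ⟨⟨g, hg, hgd⟩, i, by omega, hi⟩
        have h4 := proj_mul_projList_of_mem h hV (V := V)
          (List.mem_map.2 ⟨_, h3, rfl⟩ : d ∈ (M (i + 1)).map (↑))
        have h5 := DFunLike.congr_fun h4 ζ
        rwa [mul_apply_eq_comp, hζ] at h5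
      clear_value M S
      clear h1 hlim1 hMmem
      induction L with
      | nil => rfl
      | cons g L ih =>
        rw [projList_cons, mul_apply_eq_comp, ih fun g hg => h2 g (by simp [hg]), h2 g (by simp)])
    ξ
  have hlim3 := (hlim2.norm.pow 2).congr fun n => (hmL' (M n)).symm
  rw [h1]
  exact tendsto_nhds_unique hlim1 hlim3

end SpectralMeasure

end IsometrySemigroup

/-! ### The conformal measure of a conformal family -/

/-- Measures that agree on an exhausting sequence of sets can be glued together. -/
theorem exists_measure_restrict_eq {α : Type*} [MeasurableSpace α] {B : ℕ → Set α}
    (hBm : ∀ n, MeasurableSet (B n)) (hBu : ⋃ n, B n = univ)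
    {κ : ℕ → Measure α}
    (hκ : ∀ n m, n ≤ m → (κ m).restrict (B n) = (κ n).restrict (B n)) :
    ∃ μ : Measure α, ∀ m, μ.restrict (B m) = (κ m).restrict (B m) := by
  have hDm : ∀ n, MeasurableSet (disjointed B n) := fun n => MeasurableSet.disjointed hBm n
  have hκ' : ∀ n m, n ≤ m → ∀ E, MeasurableSet E → E ⊆ B n → κ m E = κ n E := by
    intro n m hnm E hE hEB
    have := congrArg (fun ν : Measure α => ν E) (hκ n m hnm)
    simpa [Measure.restrict_apply hE, inter_eq_left.2 hEB] using this
  refine ⟨Measure.sum fun n => (κ n).restrict (disjointed B n), fun m => ?_⟩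
  ext E hE
  have hEm := hE.inter (hBm m)
  rw [Measure.restrict_apply hE, Measure.restrict_apply hE, Measure.sum_apply _ hEm]
  have h1 : ∀ n, (κ n).restrict (disjointed B n) (E ∩ B m) =
      κ m ((E ∩ B m) ∩ disjointed B n) := by
    intro n
    rw [Measure.restrict_apply hEm]
    rcases le_total n m with hnm | hnm
    · exact (hκ' n m hnm _ (hEm.inter (hDm n))
        (inter_subset_right.trans (disjointed_subset B n))).symm
    · exact hκ' m n hnm _ (hEm.inter (hDm n)) (inter_subset_left.trans inter_subset_right)
  simp_rw [h1]
  rw [← measure_iUnion (fun i j hij => ((disjoint_disjointed B hij).mono inter_subset_right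
    inter_subset_right)) fun n => hEm.inter (hDm n), ← inter_iUnion, iUnion_disjointed, hBu,
    inter_univ]

namespace IsometrySemigroup

namespace ConformalFamily

variable {G : Type u} [AddCommGroup G] [TopologicalSpace G] [IsTopologicalAddGroup G]
  {P : AddSubmonoid G} {V : IsometrySemigroup P} {a₀ : G} {c : G →+ ℝ} {β : ℝ}

/-- If `κ` is the spectral measure of `η_{2k}`, its translate by `-k`, rescaled by `e^{βc(k)}`,
gives to each slab between `-k` and `k` the mass prescribed by the conformal family. -/
theorem measure_translate (Φ : V.ConformalFamily c β) (h : IsOrderUnit P a₀)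
    (hV : V.HasCommutingRangeProjections) {k b s : P} (hb : (k : G) - b ∈ P)
    (hs : (k : G) + b - s ∈ P) {κ : Measure (Yu P)} [IsFiniteMeasure κ]
    (hκ : ∀ L : List G, κ.real (cyl P L) = ‖V.projList L (Φ.vec (k + k))‖ ^ 2) (L : List G) :
    ENNReal.ofReal (Real.exp (β * c k)) *
        κ ((k : G) +ᵥ (cyl P L ∩ slab P (-(b : G)) (s - b))) =
      ENNReal.ofReal (Real.exp (β * c b) *
        ‖V.projList (L.map ((b : G) + ·)) (Φ.vec s)‖ ^ 2) := by
  let x : P := ⟨_, hb⟩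
  let z : P := ⟨_, hs⟩
  let M := L.map ((b : G) + ·)
  have hx : (x : G) = k - b := rfl
  have hz : (z : G) = k + b - s := rfl
  have hk : k + k = s + x + z := by
    apply Subtype.ext
    push_cast
    rw [hx, hz]; abel
  have hset : (k : G) +ᵥ (cyl P L ∩ slab P (-(b : G)) (s - b)) =
      cyl P ((x : G) :: M.map ((x : G) + ·)) \
        cyl P (((s + x : P) : G) :: (x : G) :: M.map ((x : G) + ·)) := by
    have e1 : M.map ((x : G) + ·) = L.map ((k : G) + ·) := by
      rw [List.map_map]
      refine List.map_congr_left fun g _ => ?_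
      simp only [Function.comp_apply, hx]; abel
    have e2 : (k : G) + -(b : G) = x := by rw [hx]; abel
    have e3 : (k : G) + (s - b) = (s + x : P) := by push_cast; rw [hx]; abel
    rw [e1, vadd_set_inter, vadd_cyl, vadd_slab, e2, e3]
    ext A
    simp only [mem_inter_iff, mem_sdiff, mem_cyl_cons, mem_slab]
    tauto
  have hsub : cyl P (((s + x : P) : G) :: (x : G) :: M.map ((x : G) + ·)) ⊆
      cyl P ((x : G) :: M.map ((x : G) + ·)) := fun A hA => (mem_cyl_cons.1 hA).2
  have hreal := measureReal_sdiff (μ := κ) hsub (measurableSet_cyl _)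
  have hnorm := Φ.norm_sq_sub h hV M x s z
  have hcx : (V.projList (M.map ((x : G) + ·)) * V.proj x) =
      V.projList ((x : G) :: M.map ((x : G) + ·)) := by
    rw [projList_cons, (proj_commute_projList h hV _ _).eq]
  have hcx2 : V.projList (M.map ((x : G) + ·)) * (V.proj x * V.proj ((s + x : P) : G)) =
      V.projList (((s + x : P) : G) :: (x : G) :: M.map ((x : G) + ·)) := by
    rw [projList_cons, (proj_commute_projList h hV _ _).eq, ← hcx, mul_assoc]
  rw [← mul_apply_eq_comp (V.proj x), ← mul_apply_eq_comp, hcx, ← mul_apply_eq_comp, hcx2,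
    ← hk, ← hκ, ← hκ, ← hreal, ← hset] at hnorm
  rw [← ofReal_measureReal (measure_ne_top κ _), hnorm, ← ENNReal.ofReal_mul (Real.exp_pos _).le,
    ← mul_assoc, ← Real.exp_add]
  congr 3
  rw [hx, map_sub]; ring

variable [LocallyCompactSpace G] [SecondCountableTopology G] [T2Space G]

/-- A conformal family determines a measure on `Y_u`: the masses prescribed by `measure_translate`
do not depend on `k`, so the measures obtained for `k = n a₀` can be glued. For the Koopman
representation the formula says that `η_s` is the indicator function of `slab P 0 s`. -/
theorem exists_measure_slab (Φ : V.ConformalFamily c β) (h : IsOrderUnit P a₀)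
    (hV : V.HasCommutingRangeProjections) (hc : V.IsStronglyContinuous) :
    ∃ μ : Measure (Yu P), ∀ (b s : P) (L : List G),
      μ (cyl P L ∩ slab P (-(b : G)) (s - b)) = ENNReal.ofReal (Real.exp (β * c b) *
        ‖V.projList (L.map ((b : G) + ·)) (Φ.vec s)‖ ^ 2) := by
  let k (n : ℕ) : P := n • ⟨a₀, h.mem⟩
  have hk : ∀ n, (k n : G) = n • a₀ := fun n => by simp [k]
  choose κ hκf hκ using fun n =>
    exists_measure_cyl h hV hc (a := ((k n + k n : P) : G)) (Φ.proj_vec (k n + k n))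
  let κ' (n : ℕ) : Measure (Yu P) :=
    ENNReal.ofReal (Real.exp (β * c (k n))) • (κ n).map fun A => -(k n : G) +ᵥ A
  have hκ' : ∀ n E, MeasurableSet E →
      κ' n E = ENNReal.ofReal (Real.exp (β * c (k n))) * κ n ((k n : G) +ᵥ E) := by
    intro n E hE
    rw [Measure.smul_apply, Measure.map_apply (measurable_vadd _) hE, preimage_vadd_neg,
      smul_eq_mul]
  have hform : ∀ (n : ℕ) (b s : P) (L : List G), (k n : G) - b ∈ P → (k n : G) + b - s ∈ P →
      κ' n (cyl P L ∩ slab P (-(b : G)) (s - b)) = ENNReal.ofReal (Real.exp (β * c b) *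
        ‖V.projList (L.map ((b : G) + ·)) (Φ.vec s)‖ ^ 2) := by
    intro n b s L hb hs
    rw [hκ' n _ ((measurableSet_cyl L).inter (measurableSet_slab _ _))]
    exact Φ.measure_translate h hV hb hs (hκ n) L
  have hbig : ∀ n, bigSlab P a₀ n = slab P (-(k n : G)) ((k n + k n : P) - k n) := by
    intro n
    rw [bigSlab, ← hk]
    congr 1
    push_cast; abel
  have hcons : ∀ n m, n ≤ m →
      (κ' m).restrict (bigSlab P a₀ n) = (κ' n).restrict (bigSlab P a₀ n) := by
    intro n m hnm
    have hmn : (k m : G) - k n ∈ P := by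
      obtain ⟨i, rfl⟩ := Nat.exists_eq_add_of_le hnm
      rw [hk, hk, add_nsmul, add_sub_cancel_left]
      exact h.nsmul_mem i
    have heq : ∀ L, (κ' m).restrict (bigSlab P a₀ n) (cyl P L) =
        (κ' n).restrict (bigSlab P a₀ n) (cyl P L) := by
      intro L
      rw [Measure.restrict_apply (measurableSet_cyl L), Measure.restrict_apply (measurableSet_cyl L),
        hbig, hform m _ _ _ hmn, hform n]
      · simp
      · simp
      · convert hmn using 1; push_cast; abel
    have hfin : ∀ n, IsFiniteMeasure (κ' n) := fun n => Measure.smul_finite _ ENNReal.ofReal_ne_top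
    refine ext_of_generate_finite _ (generateFrom_cyl h.subset_closure) isPiSystem_range_cyl ?_ ?_
    · rintro _ ⟨L, rfl⟩
      exact heq L
    · rw [← cyl_nil]; exact heq []
  obtain ⟨μ, hμ⟩ := exists_measure_restrict_eq measurableSet_bigSlab
    (iUnion_bigSlab h) hcons
  refine ⟨μ, fun b s L => ?_⟩
  obtain ⟨n, hn⟩ := h.exists_forall_ge_finite [(b : G), s - b]
  have hb : n • a₀ - (b : G) ∈ P := interior_subset (hn n le_rfl b (by simp))
  have hs : n • a₀ - ((s : G) - b) ∈ P := interior_subset (hn n le_rfl (s - b) (by simp))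
  have hsub : cyl P L ∩ slab P (-(b : G)) (s - b) ⊆ bigSlab P a₀ n :=
    inter_subset_right.trans (slab_mono (by convert hb using 1; abel) hs)
  have h1 := congrArg (fun ν : Measure (Yu P) => ν (cyl P L ∩ slab P (-(b : G)) (s - b))) (hμ n)
  have hm := (measurableSet_cyl L).inter (measurableSet_slab (P := P) (-(b : G)) (s - b))
  simp only [Measure.restrict_apply hm, inter_eq_left.2 hsub] at h1
  rw [h1, hform n b s L]
  · rw [hk]; exact hb
  · rw [hk]; convert hs using 1; abel

/-- The measure determined by a conformal family is conformal, because translating a slab by `-p`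
amounts to replacing `b` by `p + b` in the formula for its mass. -/
theorem isConformalMeasure_of_slab (Φ : V.ConformalFamily c β) (h : IsOrderUnit P a₀)
    {μ : Measure (Yu P)} (hμ : ∀ (b s : P) (L : List G),
      μ (cyl P L ∩ slab P (-(b : G)) (s - b)) = ENNReal.ofReal (Real.exp (β * c b) *
        ‖V.projList (L.map ((b : G) + ·)) (Φ.vec s)‖ ^ 2)) :
    IsConformalMeasure c β μ := by
  let k (n : ℕ) : P := n • ⟨a₀, h.mem⟩
  have hk : ∀ n, (k n : G) = n • a₀ := fun n => by simp [k]
  have hbig : ∀ n, bigSlab P a₀ n = slab P (-(k n : G)) ((k n + k n : P) - k n) := by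
    intro n
    rw [bigSlab, ← hk]
    congr 1
    push_cast; abel
  -- it suffices to translate by the negative of an element of `P`
  have hneg : ∀ (p : P) (E : Set (Yu P)), MeasurableSet E →
      μ (-(p : G) +ᵥ E) = ENNReal.ofReal (Real.exp (β * c p)) * μ E := by
    intro p E hE
    have heq : μ.map (fun A => (p : G) +ᵥ A) = ENNReal.ofReal (Real.exp (β * c p)) • μ := by
      have hval : ∀ n L, μ.map (fun A => (p : G) +ᵥ A) (cyl P L ∩ bigSlab P a₀ n) =
          (ENNReal.ofReal (Real.exp (β * c p)) • μ) (cyl P L ∩ bigSlab P a₀ n) := by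
        intro n L
        have hm := (measurableSet_cyl L).inter (measurableSet_bigSlab (P := P) (a₀ := a₀) n)
        rw [Measure.map_apply (measurable_vadd _) hm, ← neg_neg (p : G), preimage_vadd_neg,
          vadd_set_inter, vadd_cyl, hbig, vadd_slab, Measure.smul_apply, hμ, smul_eq_mul]
        have e1 : -(p : G) + -(k n : G) = -((p + k n : P) : G) := by push_cast; abel
        have e2 : -(p : G) + ((k n + k n : P) - k n) = (k n + k n : P) - (p + k n : P) := by
          push_cast; abel
        rw [e1, e2, hμ, ← ENNReal.ofReal_mul (Real.exp_pos _).le, ← mul_assoc, ← Real.exp_add,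
          List.map_map]
        congr 3
        · simp; ring
        · congr 3
          refine List.map_congr_left fun g _ => ?_
          simp only [Function.comp_apply, AddSubmonoid.coe_add]
          abel
      refine (ext_of_cyl_inter_bigSlab h (fun n => ?_) fun n L => (hval n L).symm).symm
      have h1 := hμ (k n) (k n + k n) []
      rw [cyl_nil, univ_inter, ← hbig] at h1
      rw [Measure.smul_apply, h1, smul_eq_mul]
      exact ENNReal.mul_lt_top ENNReal.ofReal_lt_top ENNReal.ofReal_lt_top
    have h1 := congrArg (fun ν : Measure (Yu P) => ν E) heq
    simp only [Measure.map_apply (measurable_vadd _) hE, Measure.smul_apply, smul_eq_mul] at h1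
    rw [← h1, ← preimage_vadd_neg, neg_neg]
  intro s E hE
  obtain ⟨a, -, b, hs, -⟩ := h.exists_eq_sub s s
  have h1 := hneg b E hE
  have h2 := hneg a (s +ᵥ E) (measurableSet_vadd s hE)
  have e : -(a : G) +ᵥ (s +ᵥ E) = -(b : G) +ᵥ E := by
    rw [vadd_vadd, hs]; congr 1; abel
  rw [e, h1] at h2
  have h3 : Real.exp (-(β * c s)) = Real.exp (-(β * c a)) * Real.exp (β * c b) := by
    rw [← Real.exp_add, hs, map_sub]; congr 1; ring
  rw [h3, ENNReal.ofReal_mul (Real.exp_pos _).le, mul_assoc, h2, ← mul_assoc,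
    ← ENNReal.ofReal_mul (Real.exp_pos _).le, ← Real.exp_add, neg_add_cancel, Real.exp_zero,
    ENNReal.ofReal_one, one_mul]

end ConformalFamily

end IsometrySemigroup

/-! ### Irreducibility and unitary equivalence -/

/-- Two total families with the same Gram matrix are related by a unitary. -/
theorem exists_linearIsometryEquiv_of_gram {ι H K : Type*} [NormedAddCommGroup H]
    [InnerProductSpace ℂ H] [CompleteSpace H] [NormedAddCommGroup K] [InnerProductSpace ℂ K]
    [CompleteSpace K] {x : ι → H} {y : ι → K}
    (hx : (Submodule.span ℂ (range x)).topologicalClosure = ⊤)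
    (hy : (Submodule.span ℂ (range y)).topologicalClosure = ⊤)
    (hxy : ∀ i j, (inner ℂ (y i) (y j) : ℂ) = inner ℂ (x i) (x j)) :
    ∃ U : H ≃ₗᵢ[ℂ] K, ∀ i, U (x i) = y i := by
  let e₁ := Finsupp.linearCombination ℂ x
  let e₂ := Finsupp.linearCombination ℂ y
  have h₁ : DenseRange e₁ := by
    rw [DenseRange, ← LinearMap.coe_range, Finsupp.range_linearCombination]
    exact Submodule.dense_iff_topologicalClosure_eq_top.2 hx
  have h₂ : DenseRange e₂ := by
    rw [DenseRange, ← LinearMap.coe_range, Finsupp.range_linearCombination]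
    exact Submodule.dense_iff_topologicalClosure_eq_top.2 hy
  have hin : ∀ f, (inner ℂ (e₂ f) (e₂ f) : ℂ) = inner ℂ (e₁ f) (e₁ f) := by
    intro f
    simp only [e₁, e₂, Finsupp.linearCombination_apply, Finsupp.sum_inner, Finsupp.inner_sum,
      inner_smul_left, inner_smul_right, hxy]
  have hn : ∀ f, ‖e₂ (LinearEquiv.refl ℂ (ι →₀ ℂ) f)‖ = ‖e₁ f‖ := by
    intro f
    rw [@norm_eq_sqrt_re_inner ℂ, @norm_eq_sqrt_re_inner ℂ, LinearEquiv.refl_apply, hin]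
  refine ⟨(LinearEquiv.refl ℂ (ι →₀ ℂ)).extendOfIsometry e₁ e₂ h₁ h₂ hn, fun i => ?_⟩
  have := LinearEquiv.extendOfIsometry_eq (LinearEquiv.refl ℂ (ι →₀ ℂ)) e₁ e₂ h₁ h₂ hn
    (Finsupp.single i 1)
  simpa [e₁, e₂] using this

namespace IsometrySemigroup

section Irreducible

variable {G : Type u} [AddCommGroup G] {P : AddSubmonoid G} {V W : IsometrySemigroup P}

/-- Irreducibility in terms of subspaces: a non-zero closed subspace invariant under all `V_a` and
`V_a^*` is the whole space. -/
theorem IsIrreducible.eq_top (hV : V.IsIrreducible) {M : Submodule ℂ V.H}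
    (hM : IsClosed (M : Set V.H))
    (hop : ∀ a, ∀ ξ ∈ M, V.op a ξ ∈ M) (hadj : ∀ a, ∀ ξ ∈ M, V.opAdj a ξ ∈ M)
    (hne : ∃ ξ ∈ M, ξ ≠ 0) : M = ⊤ := by
  have : CompleteSpace M := hM.completeSpace_coe
  let T := M.starProjection
  have hself : star T = T := (isSelfAdjoint_starProjection M).star_eq
  have key : ∀ S : V.H →L[ℂ] V.H, (∀ ξ ∈ M, S ξ ∈ M) → T * (S * T) = S * T := by
    intro S hS
    ext ξ
    exact M.starProjection_eq_self_iff.2 (hS _ (M.starProjection_apply_mem ξ))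
  have hcomm : ∀ a, T * V.op a = V.op a * T := by
    intro a
    have h1 := key _ (hop a)
    have h2 := congrArg star (key _ (hadj a))
    simp only [star_mul, hself, star_opAdj] at h2
    rw [← h1, ← mul_assoc, h2]
  have hcomm' : ∀ a, T * V.opAdj a = V.opAdj a * T := by
    intro a
    have := congrArg star (hcomm a)
    simp only [star_mul, hself, star_op] at this
    exact this.symm
  obtain ⟨z, hz⟩ := hV T fun a => ⟨hcomm a, hcomm' a⟩
  obtain ⟨ξ, hξM, hξ0⟩ := hne
  have h1 : T ξ = ξ := M.starProjection_eq_self_iff.2 hξM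
  have h2 : z = 1 := by
    have h3 : z • ξ = ξ := by
      rw [hz] at h1; simpa using h1
    have h4 : (z - 1) • ξ = 0 := by rw [sub_smul, one_smul, h3, sub_self]
    exact sub_eq_zero.1 ((smul_eq_zero.1 h4).resolve_right hξ0)
  refine Submodule.eq_top_iff'.2 fun ζ => M.starProjection_eq_self_iff.1 ?_
  change T ζ = ζ
  rw [hz, h2, one_smul, one_apply_eq_self]

theorem equiv_opAdj {U : V.H ≃ₗᵢ[ℂ] W.H} (hU : ∀ a ξ, U (V.op a ξ) = W.op a (U ξ)) (a : P)
    (ξ : V.H) : U (V.opAdj a ξ) = W.opAdj a (U ξ) := by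
  refine ext_inner_right ℂ fun ζ => ?_
  obtain ⟨ζ, rfl⟩ := U.surjective ζ
  have h1 : Inner.inner ℂ (W.opAdj a (U ξ)) (U ζ) = Inner.inner ℂ (U ξ) (W.op a (U ζ)) :=
    ContinuousLinearMap.adjoint_inner_left (W.op a) (U ζ) (U ξ)
  have h2 : Inner.inner ℂ (V.opAdj a ξ) ζ = Inner.inner ℂ ξ (V.op a ζ) :=
    ContinuousLinearMap.adjoint_inner_left (V.op a) ζ ξ
  rw [h1, ← hU, U.inner_map_map, U.inner_map_map, h2]

theorem IsIrreducible.of_equiv (hW : W.IsIrreducible) {U : V.H ≃ₗᵢ[ℂ] W.H}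
    (hU : ∀ a ξ, U (V.op a ξ) = W.op a (U ξ)) : V.IsIrreducible := by
  intro T hT
  let e : V.H →L[ℂ] W.H := (U.toContinuousLinearEquiv : V.H →L[ℂ] W.H)
  let e' : W.H →L[ℂ] V.H := (U.symm.toContinuousLinearEquiv : W.H →L[ℂ] V.H)
  have hU' : ∀ a ζ, U.symm (W.op a ζ) = V.op a (U.symm ζ) := by
    intro a ζ
    rw [U.symm_apply_eq, hU, U.apply_symm_apply]
  obtain ⟨z, hz⟩ := hW (e.comp (T.comp e')) fun a => by
    constructor
    · ext ζ
      have h1 : T (V.op a (U.symm ζ)) = V.op a (T (U.symm ζ)) := DFunLike.congr_fun (hT a).1 _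
      change U (T (U.symm (W.op a ζ))) = W.op a (U (T (U.symm ζ)))
      rw [hU', h1, hU]
    · ext ζ
      have h1 : T (V.opAdj a (U.symm ζ)) = V.opAdj a (T (U.symm ζ)) :=
        DFunLike.congr_fun (hT a).2 _
      change U (T (U.symm (W.opAdj a ζ))) = W.opAdj a (U (T (U.symm ζ)))
      rw [equiv_opAdj hU', h1, equiv_opAdj hU]
  refine ⟨z, ContinuousLinearMap.ext fun ξ => U.injective ?_⟩
  have h1 : U (T (U.symm (U ξ))) = z • U ξ := DFunLike.congr_fun hz (U ξ)
  rw [U.symm_apply_apply] at h1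
  rw [h1, ← map_smul]; rfl

end Irreducible

namespace ConformalFamily

variable {G : Type u} [AddCommGroup G] [TopologicalSpace G] [IsTopologicalAddGroup G]
  {P : AddSubmonoid G} {V : IsometrySemigroup P} {a₀ : G} {c : G →+ ℝ} {β : ℝ}

theorem op_projList_vec (Φ : V.ConformalFamily c β) (h : IsOrderUnit P a₀)
    (hV : V.HasCommutingRangeProjections) (b : P) (L : List G) (a : P) :
    V.op b (V.projList L (Φ.vec a)) = (Real.exp (β * c b / 2) : ℂ) •
      V.projList (b :: L.map ((b : G) + ·)) (Φ.vec (b + a)) := by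
  rw [← mul_apply_eq_comp, op_mul_projList h hV, mul_apply_eq_comp, Φ.op_vec, map_smul,
    ← mul_apply_eq_comp, ← (proj_commute_projList h hV _ _).eq, projList_cons, add_comm b a]

theorem opAdj_projList_vec (Φ : V.ConformalFamily c β) (h : IsOrderUnit P a₀)
    (hV : V.HasCommutingRangeProjections) (b : P) (L : List G) (a : P) :
    V.opAdj b (V.projList L (Φ.vec a)) = (Real.exp (-(β * c b / 2)) : ℂ) •
      (V.projList (L.map fun g : G => g - b) (Φ.vec a) -
        V.projList ((L.map fun g : G => g - b) ++ [(a : G) - b]) (Φ.vec a)) := by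
  have h1 : V.opAdj b (Φ.vec a) = (Real.exp (-(β * c b / 2)) : ℂ) •
      (Φ.vec a - V.proj ((a : G) - b) (Φ.vec a)) := by
    have h2 : V.opAdj b (V.proj a (Φ.vec (a + b))) =
        V.proj ((a : G) - b) (V.opAdj b (Φ.vec (a + b))) :=
      DFunLike.congr_fun (opAdj_mul_proj h hV b (a : G)) _
    conv_lhs => rw [← Φ.vec_sub a b]
    rw [map_sub, h2, Φ.opAdj_vec_add, map_smul, smul_sub]
  rw [← mul_apply_eq_comp, opAdj_mul_projList h hV, mul_apply_eq_comp, h1, map_smul, map_sub,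
    projList_append, projList_cons, projList_nil, mul_one, mul_apply_eq_comp]

/-- The vectors `projList L (η_a)` are total if `V` is irreducible. -/
theorem topologicalClosure_span (Φ : V.ConformalFamily c β) (h : IsOrderUnit P a₀)
    (hV : V.HasCommutingRangeProjections) (hirr : V.IsIrreducible) {a : P} (ha : Φ.vec a ≠ 0) :
    (Submodule.span ℂ (range fun p : List G × P =>
      V.projList p.1 (Φ.vec p.2))).topologicalClosure = ⊤ := by
  set M := Submodule.span ℂ (range fun p : List G × P => V.projList p.1 (Φ.vec p.2))
  have hmem : ∀ L b, V.projList L (Φ.vec b) ∈ M := fun L b =>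
    Submodule.subset_span ⟨(L, b), rfl⟩
  have key : ∀ S : V.H →L[ℂ] V.H, (∀ L b, S (V.projList L (Φ.vec b)) ∈ M) →
      ∀ ξ ∈ M.topologicalClosure, S ξ ∈ M.topologicalClosure := by
    intro S hS ξ hξ
    have h1 : M ≤ M.comap (S : V.H →ₗ[ℂ] V.H) := by
      refine Submodule.span_le.2 ?_
      rintro _ ⟨⟨L, b⟩, rfl⟩
      exact hS L b
    exact map_mem_closure S.continuous hξ fun ζ hζ => h1 hζ
  refine hirr.eq_top M.isClosed_topologicalClosure (fun b => key _ fun L a => ?_)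
    (fun b => key _ fun L a => ?_) ⟨Φ.vec a, M.le_topologicalClosure (hmem [] a), ha⟩
  · rw [Φ.op_projList_vec h hV]
    exact M.smul_mem _ (hmem _ _)
  · rw [Φ.opAdj_projList_vec h hV]
    exact M.smul_mem _ (M.sub_mem (hmem _ _) (hmem _ _))

/-- The Gram matrix of the vectors `projList L (η_t)`. The right-hand side is the measure of the set
of all `A ∈ X_u` with `L ++ L' ⊆ A` and `t, t' ∉ A`. -/
theorem inner_projList_vec (Φ : V.ConformalFamily c β) (h : IsOrderUnit P a₀)
    (hV : V.HasCommutingRangeProjections) (L L' : List G) (t t' : P) :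
    Inner.inner ℂ (V.projList L (Φ.vec t)) (V.projList L' (Φ.vec t')) =
      ((‖V.projList (L ++ L') (Φ.vec t)‖ ^ 2 -
        ‖V.projList ((t' : G) :: (L ++ L')) (Φ.vec t)‖ ^ 2 : ℝ) : ℂ) := by
  set Q := V.projList (L ++ L') with hQ
  set η := Φ.vec (t + t')
  have hp : ∀ s : P, star (1 - V.proj (s : G)) = 1 - V.proj (s : G) := fun s => by
    rw [star_sub, star_one, star_proj h]
  have ht : (1 - V.proj (t : G)) η = Φ.vec t := Φ.vec_sub t t'
  have ht' : (1 - V.proj (t' : G)) η = Φ.vec t' := by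
    have := Φ.vec_sub t' t
    rwa [add_comm t' t] at this
  have htt : (1 - V.proj (t : G)) (Φ.vec t) = Φ.vec t := by
    change Φ.vec t - V.proj t (Φ.vec t) = _
    rw [Φ.proj_vec, sub_zero]
  have hc1 : Commute (1 - V.proj (t : G)) Q :=
    (Commute.one_left _).sub_left (proj_commute_projList h hV _ _)
  have hc2 : Commute (1 - V.proj (t : G)) (1 - V.proj (t' : G)) :=
    (Commute.one_left _).sub_left ((Commute.one_right _).sub_right (proj_commute h hV _ _))
  have h1 : Inner.inner ℂ (V.projList L (Φ.vec t)) (V.projList L' (Φ.vec t')) =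
      Inner.inner ℂ (Φ.vec t) (Q (Φ.vec t')) := by
    rw [inner_apply_of_star_eq (star_projList h hV L), ← mul_apply_eq_comp, ← projList_append]
  have h2 : (1 - V.proj (t : G)) (Q (Φ.vec t')) = Q (Φ.vec t) -
      V.projList ((t' : G) :: (L ++ L')) (Φ.vec t) := by
    have h3 : (1 - V.proj (t : G)) * Q * (1 - V.proj (t' : G)) =
        Q * (1 - V.proj (t' : G)) * (1 - V.proj (t : G)) := by
      rw [hc1.eq, mul_assoc, hc2.eq, mul_assoc]
    have h4 := DFunLike.congr_fun h3 η
    simp only [mul_apply_eq_comp, ht, ht'] at h4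
    rw [h4]
    change Q (Φ.vec t - V.proj t' (Φ.vec t)) = _
    rw [map_sub, projList_cons, (proj_commute_projList h hV _ _).eq, mul_apply_eq_comp]
  rw [h1]
  conv_lhs => rw [← htt]
  rw [inner_apply_of_star_eq (hp t), h2, inner_sub_right,
    inner_apply_self_of_proj (star_projList h hV _) (projList_mul_self h hV _),
    inner_apply_self_of_proj (star_projList h hV _) (projList_mul_self h hV _)]
  push_cast
  rfl

end ConformalFamily

end IsometrySemigroup

section Equivalence

open IsometrySemigroup

variable {G : Type u} [AddCommGroup G] [TopologicalSpace G] [IsTopologicalAddGroup G]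
  {P : AddSubmonoid G} {a₀ : G} {c : G →+ ℝ} {β : ℝ} {μ : ConformalRadonMeasure P c β}

variable [LocallyCompactSpace G] [SecondCountableTopology G] [T2Space G]

/-- If `μ` is the measure of a conformal family of `V`, then `V` is unitarily equivalent to the
Koopman representation of `μ`; the unitary sends the cylinder functions to the vectors
`projList L (η_a)`. -/
theorem exists_koopmanRep_equiv {V : IsometrySemigroup P} (Φ : V.ConformalFamily c β)
    (h : IsOrderUnit P a₀) (hV : V.HasCommutingRangeProjections) (hirr : V.IsIrreducible) {a : P}
    (ha : Φ.vec a ≠ 0) (hμ : ∀ (s : P) (L : List G),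
      μ.1 (cyl P L ∩ slab P 0 s) = ENNReal.ofReal (‖V.projList L (Φ.vec s)‖ ^ 2)) :
    ∃ U : (koopmanRep μ).H ≃ₗᵢ[ℂ] V.H,
      ∀ (b : P) (f : (koopmanRep μ).H), U ((koopmanRep μ).op b f) = V.op b (U f) := by
  have hgram : ∀ p q : List G × P,
      (inner ℂ (V.projList p.1 (Φ.vec p.2)) (V.projList q.1 (Φ.vec q.2)) : ℂ) =
        inner ℂ (cylVec h μ p.1 p.2) (cylVec h μ q.1 q.2) := by
    rintro ⟨L, t⟩ ⟨L', t'⟩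
    rw [inner_cylVec, Φ.inner_projList_vec h hV]
    congr 1
    have hset : ((cyl P L \ cyl P [(t : G)]) ∩ (cyl P L' \ cyl P [(t' : G)])) ∩ Xu P =
        (cyl P (L ++ L') ∩ slab P 0 t) \ (cyl P ((t' : G) :: (L ++ L')) ∩ slab P 0 t) := by
      ext A
      simp only [cyl_append, mem_inter_iff, mem_sdiff, mem_cyl_cons, mem_slab,
        Xu_eq_cyl]
      tauto
    have hreal : ∀ M : List G, μ.1.real (cyl P M ∩ slab P 0 t) = ‖V.projList M (Φ.vec t)‖ ^ 2 := by
      intro M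
      rw [Measure.real, hμ, ENNReal.toReal_ofReal (by positivity)]
    rw [Measure.real, Measure.restrict_apply
      ((measurableSet_cyl_diff L t).inter (measurableSet_cyl_diff L' t')), hset, ← Measure.real,
      measureReal_sdiff _ ((measurableSet_cyl _).inter (measurableSet_slab _ _)) (by
        rw [hμ]; exact ENNReal.ofReal_ne_top), hreal, hreal]
    exact fun A hA => ⟨(mem_cyl_cons.1 hA.1).2, hA.2⟩
  obtain ⟨U, hU⟩ := exists_linearIsometryEquiv_of_gram (topologicalClosure_span_cylVec h)
    (Φ.topologicalClosure_span h hV hirr ha) hgram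
  refine ⟨U, fun b f => ?_⟩
  let e : (koopmanRep μ).H →L[ℂ] V.H := (U.toContinuousLinearEquiv : Lp ℂ 2 μ.res →L[ℂ] V.H)
  have heq : e.comp ((koopmanRep μ).op b) = (V.op b).comp e := by
    refine ContinuousLinearMap.ext_on (Submodule.dense_iff_topologicalClosure_eq_top.2
      (topologicalClosure_span_cylVec (μ := μ) h)) ?_
    rintro _ ⟨⟨L, t⟩, rfl⟩
    change U (koopmanIsometry μ.2.2.2 b (cylVec h μ L t)) = V.op b (U (cylVec h μ L t))
    rw [koopmanIsometry_cylVec, map_smul, hU (L, t), Φ.op_projList_vec h hV]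
    congr 1
    exact hU (b :: L.map ((b : G) + ·), b + t)
  exact DFunLike.congr_fun heq f

/-- An invariant set gives a projection commuting with the Koopman representation, so
irreducibility implies ergodicity. -/
theorem isErgodicMeasure_of_isIrreducible (h : IsOrderUnit P a₀)
    (hirr : (koopmanRep μ).IsIrreducible) : IsErgodicMeasure μ.1 := by
  intro E hE hinv
  have hσ : SigmaFinite μ.1 := sigmaFinite_of_conformal h μ.2.2.2
  let T : (koopmanRep μ).H →L[ℂ] (koopmanRep μ).H := mulIndicator hE μ.res
  have hT : star T = T := by
    refine ContinuousLinearMap.ext fun f => ext_inner_right ℂ fun g => ?_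
    have h1 : Inner.inner ℂ ((star T) f) g = Inner.inner ℂ f (T g) :=
      ContinuousLinearMap.adjoint_inner_left T g f
    rw [h1]
    exact (inner_mulIndicator_comm hE (koopmanVec f) (koopmanVec g)).symm
  have hop : ∀ a : P, T * (koopmanRep μ).op a = (koopmanRep μ).op a * T := by
    intro a
    refine ContinuousLinearMap.ext fun f => ?_
    have h1 := mulIndicator_vadd_koopmanIsometry μ.2.2.2 a hE (koopmanVec f)
    simp only [hinv] at h1
    exact h1
  have hadj : ∀ a : P, T * (koopmanRep μ).opAdj a = (koopmanRep μ).opAdj a * T := by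
    intro a
    have := congrArg star (hop a)
    simp only [star_mul, hT, star_op] at this
    exact this.symm
  obtain ⟨z, hz⟩ := hirr T fun a => ⟨hop a, hadj a⟩
  have hz' : ∀ f : Lp ℂ 2 μ.res, mulIndicator hE μ.res f = z • f := fun f =>
    DFunLike.congr_fun hz f
  obtain ⟨w, hw0, -, hwL⟩ := exists_pos_memLp_two (μ := μ.res)
  let g : Lp ℂ 2 μ.res := hwL.toLp _
  have hnull : ∀ F : Set (Yu P), ∀ hF : MeasurableSet F, (∀ s : G, s +ᵥ F = F) →
      mulIndicator hF μ.res g = 0 → μ.1 F = 0 := by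
    intro F hF hFinv h0
    refine measure_eq_zero_of_inter_Xu h μ.2.2.2 hF hFinv ?_
    rw [← Measure.restrict_apply hF]
    rw [mulIndicator_eq_zero_iff] at h0
    have h1 : ∀ᵐ A ∂μ.res, A ∉ F := by
      filter_upwards [h0, hwL.coeFn_toLp] with A h2 h3 hA
      have h4 := h2 hA
      rw [h3] at h4
      exact (hw0 A).ne' (by exact_mod_cast h4)
    simpa [ae_iff] using h1
  have hidem := mulIndicator_mulIndicator hE hE g
  simp only [inter_self, hz', smul_smul] at hidem
  have h2 : (z * (z - 1)) • g = 0 := by rw [mul_sub, mul_one, sub_smul, hidem, sub_self]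
  have hcompl := mulIndicator_add_compl hE g
  rw [hz'] at hcompl
  have hEc : ∀ s : G, s +ᵥ Eᶜ = Eᶜ := fun s => by rw [vadd_set_compl, hinv]
  rcases smul_eq_zero.1 h2 with h2 | h2
  · rcases mul_eq_zero.1 h2 with h2 | h2
    · exact Or.inl (hnull E hE hinv (by rw [hz', h2, zero_smul]))
    · refine Or.inr (hnull Eᶜ hE.compl hEc ?_)
      rwa [sub_eq_zero.1 h2, one_smul, add_eq_left] at hcompl
  · exact Or.inl (hnull E hE hinv (by rw [hz', h2, smul_zero]))

/-- Every irreducible conformal isometric representation with commuting range projections is the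
Koopman representation of a normalized ergodic measure. -/
theorem exists_koopmanRep_mk_eq (h : IsOrderUnit P a₀) {V : IsometrySemigroup P}
    (hsc : V.IsStronglyContinuous) (hV : V.HasCommutingRangeProjections) (hirr : V.IsIrreducible)
    (hconf : V.IsConformal c β) :
    ∃ μ ∈ normalizedErgodic (P := P) c β a₀,
      Quotient.mk (unitaryEquiv P) (koopmanRep μ) = Quotient.mk (unitaryEquiv P) V := by
  obtain ⟨Φ₀, a, ha⟩ := exists_conformalFamily hconf
  let a₁ : P := ⟨a₀, h.mem⟩
  have ha₁ : Φ₀.vec a₁ ≠ 0 := Φ₀.vec_ne_zero h ha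
  let Φ := Φ₀.smul ((‖Φ₀.vec a₁‖⁻¹ : ℝ) : ℂ)
  have hΦ : ‖Φ.vec a₁‖ = 1 := by
    change ‖((‖Φ₀.vec a₁‖⁻¹ : ℝ) : ℂ) • Φ₀.vec a₁‖ = 1
    rw [norm_smul, Complex.norm_real, norm_inv, norm_norm, inv_mul_cancel₀ (norm_ne_zero_iff.2 ha₁)]
  have hΦ0 : Φ.vec a₁ ≠ 0 := norm_ne_zero_iff.1 (by rw [hΦ]; exact one_ne_zero)
  obtain ⟨μ, hμ⟩ := Φ.exists_measure_slab h hV hsc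
  have hμ0 : ∀ (s : P) (L : List G),
      μ (cyl P L ∩ slab P 0 s) = ENNReal.ofReal (‖V.projList L (Φ.vec s)‖ ^ 2) := by
    intro s L
    simpa using hμ 0 s L
  have hnorm : μ (Xu P \ (a₀ +ᵥ Xu P)) = 1 := by
    have := hμ0 a₁ []
    rw [cyl_nil, univ_inter] at this
    rw [← slab_zero]
    change μ (slab P 0 (a₁ : G)) = 1
    rw [this, projList_nil, one_apply_eq_self, hΦ]
    simp
  have hfin : ∀ n, μ (bigSlab P a₀ n) < ∞ := by
    intro n
    have h1 := hμ ⟨n • a₀, h.nsmul_mem n⟩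
      ⟨n • a₀ + n • a₀, P.add_mem (h.nsmul_mem n) (h.nsmul_mem n)⟩ []
    rw [cyl_nil, univ_inter] at h1
    simp only [add_sub_cancel_right] at h1
    rw [bigSlab, h1]
    exact ENNReal.ofReal_lt_top
  let ν : ConformalRadonMeasure P c β :=
    ⟨μ, fun h0 => by rw [h0] at hnorm; simp at hnorm, isFiniteMeasureOnCompacts_of_bigSlab h hfin,
      Φ.isConformalMeasure_of_slab h hμ⟩
  obtain ⟨U, hU⟩ := exists_koopmanRep_equiv (μ := ν) Φ h hV hirr hΦ0 hμ0
  exact ⟨ν, ⟨isErgodicMeasure_of_isIrreducible h (hirr.of_equiv hU), hnorm⟩,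
    Quotient.sound ⟨U, hU⟩⟩

end Equivalence

end SemigroupRep

end

theorem theorem3 {G : Type u} [AddCommGroup G] [TopologicalSpace G] [IsTopologicalAddGroup G]
    [LocallyCompactSpace G] [SecondCountableTopology G] [T2Space G]
    (P : AddSubmonoid G) (hP_closed : IsClosed (P : Set G))
    (hP_gen : ∀ s : G, ∃ a ∈ P, ∃ b ∈ P, s = a - b)
    (hP_int : (P : Set G) ⊆ closure (interior (P : Set G)))
    (a₀ : G) (ha₀ : a₀ ∈ interior (P : Set G))
    (ha₀_unit : ∀ s : G, ∃ n : ℕ, 0 < n ∧ n • a₀ - s ∈ interior (P : Set G))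
    (c : G →+ ℝ) (hc : Continuous c) (β : ℝ) :
    Set.BijOn
      (fun μ : SemigroupRep.ConformalRadonMeasure P c β =>
        Quotient.mk (SemigroupRep.IsometrySemigroup.unitaryEquiv P) (SemigroupRep.koopmanRep μ))
      (SemigroupRep.normalizedErgodic c β a₀)
      (SemigroupRep.IsometrySemigroup.irreducibleConformalClasses P c β) := by
  have h : SemigroupRep.IsOrderUnit P a₀ := ⟨hP_int, ha₀, ha₀_unit⟩
  refine ⟨fun μ hμ => ?_, SemigroupRep.koopmanRep_injOn h, ?_⟩
  · exact ⟨SemigroupRep.koopmanRep μ, ⟨SemigroupRep.koopmanRep_separableSpace h,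
      SemigroupRep.koopmanRep_isStronglyContinuous h hc, SemigroupRep.koopmanRep_isPure h,
      SemigroupRep.koopmanRep_hasCommutingRangeProjections,
      SemigroupRep.koopmanRep_isIrreducible h hμ.1,
      SemigroupRep.koopmanRep_isConformal h hμ.2⟩, rfl⟩
  · rintro _ ⟨V, ⟨-, hsc, -, hV, hirr, hconf⟩, rfl⟩
    obtain ⟨μ, hμ, hμV⟩ := SemigroupRep.exists_koopmanRep_mk_eq h hsc hV hirr hconf
    exact ⟨μ, hμ, hμV⟩
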